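/- For $x,b\in[0,1]^n$ write $x\le b$ if $x_i\le b_i$ for all $i$, and say that $b$ covers $x$. A finite set $B\subseteq[0,1]^n$ is a Pareto cover of a probability measure $\mu$ on $[0,1]^n$ if $\mu(\{x: x\le b\text{ for some }b\in B\})=1$. For $c\in\mathbb{Q}^n_{\ge 0}$ let $c_B(x)=\min\{c^{\mathsf T}b : b\in B,\ x\le b\}$ (and $c_B(x)=\infty$ if no $b\in B$ covers $x$). A probability measure $\mu$ on $[0,1]$ is called nice if there is an oracle $\sigma$ that, given rational numbers $a,b,\delta$ with $-1\le a<b\le 1$ and $\delta\in(0,1)$, returns a rational number $\sigma(a,b,\delta)$ with $$(1+\delta)^{-1}\mu((a,b]\cap[0,1])\le\sigma(a,b,\delta)\le(1+\delta)\,\mu((a,b]\cap[0,1])$$ in time polynomial in the encoding lengths of $a$, $b$ and $\delta$ (so that, in particular, the encoding length of $\sigma(a,b,\delta)$ is bounded by such a polynomial). **Theorem.** Let $k\ge 1$ be a fixed integer. There is a deterministic algorithm with the following properties. Its input consists of $c\in\mathbb{Q}^n_{\ge 0}$ with $n\ge 1$, of rational numbers $\alpha,\gamma\in(0,1)$, and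 of access (by queries only, and with encoding length $0$) to oracles $\sigma_1,\dots,\sigma_n$ for nice probability measures $\mu_1,\dots,\mu_n$ on $[0,1]$ with $\alpha\le\min_i \operatorname{E}_{X_i\sim\mu_i}[X_i]$. With $\mu=\prod_{i=1}^n\mu_i$, it computes a Pareto cover $B\subseteq([0,1]\cap\mathbb{Q})^n$ of $\mu$ with $|B|=k$ such that $$\operatorname{E}_\mu[c_B]\le(1+\gamma)\cdot\operatorname{E}_\mu[c_{B'}]\qquad\text{for every Pareto cover } B'\text{ of }\mu\text{ with }|B'|=k .$$ Moreover, if the running times of the oracles are bounded by a polynomial $q$ in the encoding lengths of their arguments, then the running time of the algorithm, including the time that the oracles take to answer, is bounded by a polynomial, which depends only on $k$ and $q$, in $\gamma^{-1}$ and the binary encoding length of $(c,\alpha,\gamma)$. In other words, for fixed $k$ the Pareto cover problem for products of nice measures and nonnegative linear costs admits an FPTAS. -/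

import Mathlib

open MeasureTheory
open scoped ENNReal

namespace ParetoCover

/-- Encoding length of a rational number: one bit for the sign and the binary lengths of the
numerator and the denominator. -/
def bitLength (q : ℚ) : ℕ := 1 + Nat.size q.num.natAbs + Nat.size q.den

/-! ### Oracles and nice measures -/

/-- An oracle with its running time: on the arguments `a`, `b`, `δ` it answers `value a b δ`
after `time a b δ` steps. -/
structure Oracle where
  value : ℚ → ℚ → ℚ → ℚ
  time : ℚ → ℚ → ℚ → ℕ

/-- The arguments on which an oracle may be called. -/
def IsQuery (a b δ : ℚ) : Prop := -1 ≤ a ∧ a < b ∧ b ≤ 1 ∧ 0 < δ ∧ δ < 1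

/-- The measure `μ` on `[0,1]` is nice, as witnessed by the oracle `σ`: the answers approximate
`μ ((a, b] ∩ [0,1])` up to a factor `1 + δ`, and they are computed (hence, in particular, written
down) in time at most `q`, a polynomial, of the encoding lengths of the arguments. -/
structure IsNice (μ : Measure unitInterval) (σ : Oracle) (q : Polynomial ℕ) : Prop where
  lower : ∀ a b δ : ℚ, IsQuery a b δ →
    (1 + (δ : ℝ))⁻¹ * μ.real {x : unitInterval | (a : ℝ) < x ∧ (x : ℝ) ≤ b} ≤ (σ.value a b δ : ℝ)
  upper : ∀ a b δ : ℚ, IsQuery a b δ →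
    (σ.value a b δ : ℝ) ≤ (1 + (δ : ℝ)) * μ.real {x : unitInterval | (a : ℝ) < x ∧ (x : ℝ) ≤ b}
  length_le : ∀ a b δ : ℚ, IsQuery a b δ → bitLength (σ.value a b δ) ≤ σ.time a b δ
  time_le : ∀ a b δ : ℚ, IsQuery a b δ →
    σ.time a b δ ≤ q.eval (bitLength a + bitLength b + bitLength δ)

/-! ### Pareto covers and their cost -/

/-- `B` is a Pareto cover of `μ`: almost every point lies below some point of `B`. -/
def IsParetoCover {n : ℕ} (μ : Measure (Fin n → unitInterval))
    (B : Finset (Fin n → unitInterval)) : Prop :=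
  μ {x | ∃ b ∈ B, x ≤ b} = 1

/-- The cost `c_B x = min {∑ i, c i * b i : b ∈ B, x ≤ b}` of covering `x` (for `c ≥ 0`); it is
`∞` if no point of `B` covers `x`. -/
noncomputable def coverCost {n : ℕ} (c : Fin n → ℚ) (B : Finset (Fin n → unitInterval))
    (x : Fin n → unitInterval) : ℝ≥0∞ :=
  ⨅ b ∈ B, ⨅ _ : x ≤ b, ENNReal.ofReal (∑ i, (c i : ℝ) * (b i : ℝ))

/-- The expected cost of covering a random point distributed according to `μ`. -/
noncomputable def expectedCost {n : ℕ} (μ : Measure (Fin n → unitInterval)) (c : Fin n → ℚ)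
    (B : Finset (Fin n → unitInterval)) : ℝ≥0∞ :=
  ∫⁻ x, coverCost c B x ∂μ

/-! ### The model of computation

Deterministic programs with oracle access, working on nested pairs of rational numbers (binary
trees with rational leaves) and charged for bit operations. Every step is charged at least
the number of bits that it reads, copies and writes, and an arithmetical operation at least the
bit complexity of the school method (with reduction to lowest terms). Thus Turing machines with
oracles and these programs simulate each other with polynomial overhead. -/

/-- The values on which programs operate. -/
inductive Data where
  | num (q : ℚ)
  | pair (x y : Data)

/-- Encoding length of a value. -/
def Data.size : Data → ℕ
  | .num q => bitLength q
  | .pair x y => x.size + y.size + 1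

/-- A finite list as a value: nested pairs, closed by the number `0`. -/
def Data.ofList : List Data → Data
  | [] => .num 0
  | x :: l => .pair x (Data.ofList l)

/-- A rational vector as a value. -/
def Data.ofVec {n : ℕ} (v : Fin n → ℚ) : Data :=
  Data.ofList (List.ofFn fun i => Data.num (v i))

/-- Elementary operations. -/
inductive Op where
  | id
  | const (q : ℚ)
  | fst
  | snd
  | isPair
  | add
  | sub
  | mul
  | div
  | le

/-- The result of an elementary operation; an operation whose argument does not have the right
shape returns `0`, and so does a division by `0`. -/
def Op.apply : Op → Data → Data
  | .id, v => v
  | .const q, _ => .num q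
  | .fst, .pair x _ => x
  | .snd, .pair _ y => y
  | .isPair, .pair _ _ => .num 1
  | .add, .pair (.num x) (.num y) => .num (x + y)
  | .sub, .pair (.num x) (.num y) => .num (x - y)
  | .mul, .pair (.num x) (.num y) => .num (x * y)
  | .div, .pair (.num x) (.num y) => .num (x / y)
  | .le, .pair (.num x) (.num y) => if x ≤ y then .num 1 else .num 0
  | _, _ => .num 0

/-- Programs. -/
inductive Prog where
  /-- an elementary operation -/
  | op (o : Op)
  /-- run both programs on the input and pair the results -/
  | pair (f g : Prog)
  /-- run `f`, then `g` on the result of `f` -/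
  | seq (f g : Prog)
  /-- run `f` on the input if `c` returns a value other than `0` on it, and `g` otherwise -/
  | ite (c f g : Prog)
  /-- as long as `c` returns a value other than `0`, replace the current value by that of `f` -/
  | loop (c f : Prog)
  /-- on the input `(i, a, b, δ)` call the oracle number `i` on `a`, `b`, `δ` -/
  | query

/-- `Eval σ p v w t`: with access to the oracles `σ 0, …, σ (n - 1)`, the program `p` halts on the
input `v` with the output `w` after `t` steps. An oracle call takes the running time of the
oracle; a call with improper arguments never returns. -/
inductive Eval {n : ℕ} (σ : Fin n → Oracle) : Prog → Data → Data → ℕ → Prop where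
  | op (o : Op) (v : Data) : Eval σ (.op o) v (o.apply v) ((v.size + (o.apply v).size) ^ 2)
  | pair {f g : Prog} {v x y : Data} {s t : ℕ} (hf : Eval σ f v x s) (hg : Eval σ g v y t) :
      Eval σ (.pair f g) v (.pair x y) (v.size + s + t + 1)
  | seq {f g : Prog} {v x y : Data} {s t : ℕ} (hf : Eval σ f v x s) (hg : Eval σ g x y t) :
      Eval σ (.seq f g) v y (s + t + 1)
  | ite_true {c f g : Prog} {v b x : Data} {s t : ℕ} (hc : Eval σ c v b s) (hb : b ≠ .num 0)
      (hf : Eval σ f v x t) : Eval σ (.ite c f g) v x (v.size + s + t + 1)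
  | ite_false {c f g : Prog} {v b x : Data} {s t : ℕ} (hc : Eval σ c v b s) (hb : b = .num 0)
      (hg : Eval σ g v x t) : Eval σ (.ite c f g) v x (v.size + s + t + 1)
  | loop_done {c f : Prog} {v b : Data} {s : ℕ} (hc : Eval σ c v b s) (hb : b = .num 0) :
      Eval σ (.loop c f) v v (v.size + s + 1)
  | loop_step {c f : Prog} {v b x y : Data} {s t u : ℕ} (hc : Eval σ c v b s) (hb : b ≠ .num 0)
      (hf : Eval σ f v x t) (hl : Eval σ (.loop c f) x y u) :
      Eval σ (.loop c f) v y (v.size + s + t + u + 1)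
  | query (i : Fin n) (a b δ : ℚ) (h : IsQuery a b δ) :
      Eval σ .query (.pair (.num ((i : ℕ) : ℚ)) (.pair (.num a) (.pair (.num b) (.num δ))))
        (.num ((σ i).value a b δ))
        ((Data.pair (.num ((i : ℕ) : ℚ)) (.pair (.num a) (.pair (.num b) (.num δ)))).size
          + (σ i).time a b δ + bitLength ((σ i).value a b δ) + 1)

/-! ### Input and output of the algorithm -/

/-- The input: the costs `c` (whose number is the dimension `n`), the lower bound `α` and the
accuracy `γ`. The oracles are not part of it and contribute nothing to its encoding length. -/
def input {n : ℕ} (c : Fin n → ℚ) (α γ : ℚ) : Data :=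
  .pair (Data.ofVec c) (.pair (.num α) (.num γ))

/-- The output `w` is a list of `k` rational vectors that are the elements of `B` (in some order,
with repetitions if `B` has fewer than `k` elements). -/
def IsListOf {n : ℕ} (k : ℕ) (w : Data) (B : Finset (Fin n → unitInterval)) : Prop :=
  ∃ (r : Fin k → Fin n → ℚ) (b : Fin k → Fin n → unitInterval),
    w = Data.ofList (List.ofFn fun j => Data.ofVec (r j)) ∧
    (∀ j i, (b j i : ℝ) = (r j i : ℝ)) ∧ ∀ x, x ∈ B ↔ ∃ j, b j = x

end ParetoCover

open ParetoCover

namespace ParetoCover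

/-! ### Encoding lengths of rational numbers -/

/-! A finite Pareto cover of a product measure contains a single point that covers almost everything
(`exists_mem_of_isParetoCover`): if every point failed in some coordinate, a box of positive measure
would be missed. This point may be given the number 0. For points b_0, …, b_k the set {j : x ≤ b_j}
is the intersection, over the coordinates i, of the independent random sets {j : x_i ≤ b_j i}, and
the cost of x is the minimum of the point costs over this set. So the expected cost is a function of
k + 1 point costs and 2^(k+1) probabilities (`lintegral_coverSet`, `expectedCost_eq`), and both can
be updated one coordinate at a time.

This gives a dynamic program with states of constant dimension. The entries of the points, the
accumulated costs and the probabilities are rounded up to a geometric grid of ratio 1 + δ that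
descends from 1 to η. The grid is short (`gridSteps_le`), so for fixed k there are polynomially many
states. One history per state suffices, because later states depend on the past only through the
present state (`foldr_treat_complete`).

Accuracy: the oracles yield upper estimates of the probabilities within (1 + δ)^2 (`mass_bounds`)
and recognise null sets exactly (`covers_iff`). With costs scaled to have sum between 1/n and 1, the
computed value is at least the true cost (`trueCost_le_cost`) and at most (1 + δ)^(4n) times the
true cost plus O(n 2^k η) (`cost_le_trueCost`). Rounding an arbitrary cover to the grid costs one
more factor 1 + δ and one more η (`exists_feasible`). Since a covering point costs at least as much
as the point covered, every cover costs at least α/n (`le_expectedCost`), which absorbs the additive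
errors. Finally, coinciding points are separated without losing any point (`exists_separate_eq`), so
the cost does not increase.

Running time: `PT` is closed under the constructions used; the essential case is `PT.loop`, where
the number of rounds and all intermediate sizes must be bounded. The number `N` in a context is set
to ⌈1/γ⌉ at the end. -/

theorem size_mul_le (a b : ℕ) : Nat.size (a * b) ≤ Nat.size a + Nat.size b := by
  rw [Nat.size_le, pow_add]
  rcases Nat.eq_zero_or_pos a with rfl | ha
  · simp only [zero_mul]; positivity
  · calc a * b < a * 2 ^ b.size := Nat.mul_lt_mul_of_pos_left (Nat.lt_size_self b) ha
      _ ≤ _ := Nat.mul_le_mul_right _ (Nat.lt_size_self a).le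

theorem size_add_le (a b : ℕ) : Nat.size (a + b) ≤ Nat.size a + Nat.size b + 1 := by
  rw [Nat.size_le, pow_succ, pow_add]
  have h1 := Nat.lt_size_self a
  have h2 := Nat.lt_size_self b
  nlinarith [Nat.one_le_two_pow (n := a.size), Nat.one_le_two_pow (n := b.size)]

theorem size_le_self (a : ℕ) : Nat.size a ≤ a := Nat.size_le.2 Nat.lt_two_pow_self

/-- Reduction to lowest terms passes to divisors of numerator and denominator, so it cannot lengthen
them. The bounds for products, inverses and sums start from an unreduced fraction. -/
theorem bitLength_div_le (a b : ℤ) (hb : b ≠ 0) :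
    bitLength ((a : ℚ) / b) ≤ 1 + Nat.size a.natAbs + Nat.size b.natAbs := by
  rw [← Rat.divInt_eq_div]
  unfold bitLength
  have hd : (Rat.divInt a b).den ∣ b.natAbs := Int.natCast_dvd.1 (Rat.den_dvd a b)
  have h2 := Nat.size_le_size (Nat.le_of_dvd (Int.natAbs_pos.2 hb) hd)
  have h1 : Nat.size (Rat.divInt a b).num.natAbs ≤ Nat.size a.natAbs := by
    rcases eq_or_ne a 0 with rfl | ha
    · simp
    · exact Nat.size_le_size (Nat.le_of_dvd (Int.natAbs_pos.2 ha)
        (Int.natAbs_dvd_natAbs.2 (Rat.num_dvd a hb)))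
  omega

theorem bitLength_mul_le (x y : ℚ) : bitLength (x * y) ≤ bitLength x + bitLength y := by
  have hx : (x.den : ℤ) ≠ 0 := by exact_mod_cast x.den_nz
  have hy : (y.den : ℤ) ≠ 0 := by exact_mod_cast y.den_nz
  have e : x * y = ((x.num * y.num : ℤ) : ℚ) / ((x.den * y.den : ℤ) : ℚ) := by
    conv_lhs => rw [← Rat.num_div_den x, ← Rat.num_div_den y]
    push_cast
    rw [div_mul_div_comm]
  rw [e]
  refine (bitLength_div_le _ _ (mul_ne_zero hx hy)).trans ?_
  rw [Int.natAbs_mul, Int.natAbs_mul]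
  have h1 := size_mul_le x.num.natAbs y.num.natAbs
  have h2 := size_mul_le x.den y.den
  simp only [Int.natAbs_natCast]
  unfold bitLength
  omega

theorem bitLength_inv_le (x : ℚ) : bitLength x⁻¹ ≤ bitLength x + 1 := by
  rcases eq_or_ne x 0 with rfl | hx
  · simp
  have e : x⁻¹ = ((x.den : ℤ) : ℚ) / ((x.num : ℤ) : ℚ) := by
    conv_lhs => rw [← Rat.num_div_den x, inv_div]
    simp
  rw [e]
  refine (bitLength_div_le _ _ (Rat.num_ne_zero.2 hx)).trans ?_
  simp only [Int.natAbs_natCast]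
  unfold bitLength
  omega

theorem bitLength_div_le' (x y : ℚ) : bitLength (x / y) ≤ bitLength x + bitLength y + 1 := by
  rw [div_eq_mul_inv]
  have := bitLength_mul_le x y⁻¹
  have := bitLength_inv_le y
  omega

theorem bitLength_neg (x : ℚ) : bitLength (-x) = bitLength x := by
  simp [bitLength]

theorem bitLength_add_le (x y : ℚ) : bitLength (x + y) ≤ 2 * (bitLength x + bitLength y) := by
  have hx : (x.den : ℤ) ≠ 0 := by exact_mod_cast x.den_nz
  have hy : (y.den : ℤ) ≠ 0 := by exact_mod_cast y.den_nz
  have e : x + y = ((x.num * y.den + x.den * y.num : ℤ) : ℚ) / ((x.den * y.den : ℤ) : ℚ) := by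
    conv_lhs => rw [← Rat.num_div_den x, ← Rat.num_div_den y]
    push_cast
    rw [div_add_div _ _ (by exact_mod_cast x.den_nz) (by exact_mod_cast y.den_nz)]
  rw [e]
  refine (bitLength_div_le _ _ (mul_ne_zero hx hy)).trans ?_
  have h0 : Nat.size (x.num * y.den + x.den * y.num : ℤ).natAbs
      ≤ Nat.size (x.num.natAbs * y.den + x.den * y.num.natAbs) := by
    apply Nat.size_le_size
    refine (Int.natAbs_add_le _ _).trans ?_
    simp [Int.natAbs_mul]
  have h3 := size_add_le (x.num.natAbs * y.den) (x.den * y.num.natAbs)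
  have h4 := size_mul_le x.num.natAbs y.den
  have h5 := size_mul_le x.den y.num.natAbs
  have h2 := size_mul_le x.den y.den
  rw [Int.natAbs_mul]
  simp only [Int.natAbs_natCast]
  unfold bitLength
  omega

theorem bitLength_sub_le (x y : ℚ) : bitLength (x - y) ≤ 2 * (bitLength x + bitLength y) := by
  rw [sub_eq_add_neg, ← bitLength_neg y]
  exact bitLength_add_le _ _

theorem bitLength_natCast_le (m : ℕ) : bitLength (m : ℚ) ≤ m + 2 := by
  have := size_le_self m
  simp only [bitLength, Rat.num_natCast, Int.natAbs_natCast, Rat.den_natCast, Nat.size_one]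
  omega

/-- Linear in m, which keeps the elements of the geometric grid short; the 3 is the length of x^0 =
1. -/
theorem bitLength_pow_le (x : ℚ) (m : ℕ) : bitLength (x ^ m) ≤ m * bitLength x + 3 := by
  induction m with
  | zero => simp [bitLength]
  | succ m ih =>
    rw [pow_succ]
    have := bitLength_mul_le (x ^ m) x
    linarith [add_mul m 1 (bitLength x)]

theorem _root_.Polynomial.eval_le_eval_of_le (p : Polynomial ℕ) {a b : ℕ} (h : a ≤ b) :
    p.eval a ≤ p.eval b := by
  rw [Polynomial.eval_eq_sum, Polynomial.eval_eq_sum]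
  exact Finset.sum_le_sum fun i _ => Nat.mul_le_mul_left _ (Nat.pow_le_pow_left h i)

/-! ### Typed values -/

/-- Types whose elements are encoded as values of programs. -/
class Enc (α : Type) where
  /-- The value that represents an element. -/
  toData : α → Data

/-- The value that represents an element. -/
abbrev enc {α : Type} [Enc α] (x : α) : Data := Enc.toData x

instance : Enc ℚ := ⟨Data.num⟩

instance : Enc ℕ := ⟨fun i => Data.num (i : ℚ)⟩

instance : Enc Bool := ⟨fun b => Data.num (if b then 1 else 0)⟩

instance {α β : Type} [Enc α] [Enc β] : Enc (α × β) := ⟨fun x => Data.pair (enc x.1) (enc x.2)⟩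

instance {α : Type} [Enc α] : Enc (List α) := ⟨fun l => Data.ofList (l.map enc)⟩

/-- The same encoding as for lists, so that input and output vectors need no conversion. -/
instance {α : Type} [Enc α] {m : ℕ} : Enc (Fin m → α) :=
  ⟨fun v => Data.ofList (List.ofFn fun i => enc (v i))⟩

/-- Encoding length. -/
def sz {α : Type} [Enc α] (x : α) : ℕ := (enc x).size

section

variable {α β : Type} [Enc α] [Enc β]

theorem sz_rat (x : ℚ) : sz x = bitLength x := rfl

theorem sz_nat_le (m : ℕ) : sz m ≤ m + 2 := bitLength_natCast_le m

theorem sz_prod (x : α × β) : sz x = sz x.1 + sz x.2 + 1 := rfl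

theorem sz_nil : sz ([] : List α) = 2 := by
  simp [sz, enc, Enc.toData, Data.ofList, Data.size, bitLength]

theorem sz_cons (x : α) (l : List α) : sz (x :: l) = sz x + sz l + 1 := rfl

theorem sz_eq_sum (l : List α) : sz l = (l.map fun x => sz x + 1).sum + 2 := by
  induction l with
  | nil => simp [sz_nil]
  | cons x l ih => rw [sz_cons, ih, List.map_cons, List.sum_cons]; ring

theorem sz_append (l m : List α) : sz (l ++ m) + 2 = sz l + sz m := by
  simp only [sz_eq_sum, List.map_append, List.sum_append]; ring

theorem sz_reverse (l : List α) : sz l.reverse = sz l := by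
  simp only [sz_eq_sum, List.map_reverse, List.sum_reverse]

theorem length_le_sz (l : List α) : l.length ≤ sz l := by
  induction l with
  | nil => simp
  | cons x l ih => rw [sz_cons, List.length_cons]; omega

theorem sz_le_of_mem {l : List α} {x : α} (h : x ∈ l) : sz x ≤ sz l := by
  induction l with
  | nil => simp at h
  | cons y l ih =>
    rw [sz_cons]
    rcases List.mem_cons.1 h with rfl | h
    · omega
    · have := ih h; omega

theorem sz_le_of_forall {l : List α} {B : ℕ} (h : ∀ x ∈ l, sz x ≤ B) :
    sz l ≤ l.length * (B + 1) + 2 := by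
  induction l with
  | nil => simp [sz_nil]
  | cons y l ih =>
    rw [sz_cons, List.length_cons, add_mul]
    have := ih fun x hx => h x (List.mem_cons_of_mem _ hx)
    have := h y List.mem_cons_self
    omega

theorem sz_flatten_le (L : List (List α)) : sz L.flatten ≤ sz L := by
  induction L with
  | nil => simp [sz_nil]
  | cons l L ih =>
    have := sz_append l L.flatten
    rw [sz_cons, List.flatten_cons]
    omega

theorem enc_fin_cons {m : ℕ} (x : α) (v : Fin m → α) :
    enc (Fin.cons x v : Fin (m + 1) → α) = Data.pair (enc x) (enc v) := by
  simp [enc, Enc.toData, List.ofFn_succ, Data.ofList]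

theorem sz_fin_le {m : ℕ} {v : Fin m → α} {B : ℕ} (h : ∀ i, sz (v i) ≤ B) :
    sz v ≤ m * (B + 1) + 2 := by
  have e : sz v = sz (List.ofFn v) := by simp [sz, enc, Enc.toData, List.map_ofFn, Function.comp_def]
  rw [e]
  refine (sz_le_of_forall (B := B) ?_).trans (by simp)
  intro x hx
  obtain ⟨i, rfl⟩ := (List.mem_ofFn' _ _).1 hx
  exact h i

end

/-! ### Polynomial time -/

/-- The oracles, and a number in which running times are allowed to be polynomial too. -/
structure Ctx where
  n : ℕ
  σ : Fin n → Oracle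
  N : ℕ

/-- All oracles answer within a time that is bounded by the polynomial `q`. -/
def Ctx.Good (q : Polynomial ℕ) (o : Ctx) : Prop :=
  ∀ i a b δ, IsQuery a b δ → bitLength ((o.σ i).value a b δ) ≤ (o.σ i).time a b δ ∧
    (o.σ i).time a b δ ≤ q.eval (bitLength a + bitLength b + bitLength δ)

/-- On the domain `D`, the function `f` can be computed in polynomial time. -/
def PT {α β : Type} [Enc α] [Enc β] (D : Ctx → α → Prop) (f : Ctx → α → β) : Prop :=
  ∃ A : Prog, ∀ q : Polynomial ℕ, ∃ p : Polynomial ℕ, ∀ o : Ctx, o.Good q → ∀ x, D o x →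
    ∃ t ≤ p.eval (sz x + o.N), Eval o.σ A (enc x) (enc (f o x)) t

/-- Every rule pays for its output, directly or through a subcomputation. Hence a time bound is also
a bound for the size of the result. -/
theorem Eval.size_le {n : ℕ} {σ : Fin n → Oracle} {A : Prog} {v w : Data} {t : ℕ}
    (h : Eval σ A v w t) : w.size ≤ t := by
  induction h with
  | op o v => nlinarith [Nat.zero_le v.size, Nat.le_self_pow two_ne_zero (v.size + (o.apply v).size)]
  | pair hf hg h1 h2 => simp only [Data.size]; omega
  | query i a b δ h => simp only [Data.size]; omega
  | _ => omega

/-! ### Closure of polynomial-time computability under composition, arithmetic and branching -/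

namespace PT

variable {α β γ : Type} [Enc α] [Enc β] [Enc γ] {D E : Ctx → α → Prop}

theorem sz_le {f : Ctx → α → β} (hf : PT D f) (q : Polynomial ℕ) :
    ∃ p : Polynomial ℕ, ∀ o : Ctx, o.Good q → ∀ x, D o x → sz (f o x) ≤ p.eval (sz x + o.N) := by
  obtain ⟨A, hA⟩ := hf
  obtain ⟨p, hp⟩ := hA q
  refine ⟨p, fun o ho x hx => ?_⟩
  obtain ⟨t, ht, he⟩ := hp o ho x hx
  exact he.size_le.trans ht

theorem mono {f : Ctx → α → β} (hf : PT D f) (h : ∀ o x, E o x → D o x) : PT E f := by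
  obtain ⟨A, hA⟩ := hf
  refine ⟨A, fun q => ?_⟩
  obtain ⟨p, hp⟩ := hA q
  exact ⟨p, fun o ho x hx => hp o ho x (h o x hx)⟩

theorem congr {f g : Ctx → α → β} (hf : PT D f) (h : ∀ o x, D o x → f o x = g o x) : PT D g := by
  obtain ⟨A, hA⟩ := hf
  refine ⟨A, fun q => ?_⟩
  obtain ⟨p, hp⟩ := hA q
  refine ⟨p, fun o ho x hx => ?_⟩
  rw [← h o x hx]
  exact hp o ho x hx

/-- Programs see encodings only. This identifies naturals with rationals, list cells with pairs, and
tuples with head and tail. -/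
theorem of_enc_eq {f : Ctx → α → β} {g : Ctx → α → γ} (hf : PT D f)
    (h : ∀ o x, D o x → enc (f o x) = enc (g o x)) : PT D g := by
  obtain ⟨A, hA⟩ := hf
  refine ⟨A, fun q => ?_⟩
  obtain ⟨p, hp⟩ := hA q
  refine ⟨p, fun o ho x hx => ?_⟩
  rw [← h o x hx]
  exact hp o ho x hx

theorem comp {g : Ctx → β → γ} {f : Ctx → α → β} {F : Ctx → β → Prop} (hg : PT F g) (hf : PT D f)
    (h : ∀ o x, D o x → F o (f o x)) : PT D fun o x => g o (f o x) := by
  obtain ⟨A, hA⟩ := hf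
  obtain ⟨B, hB⟩ := hg
  refine ⟨.seq A B, fun q => ?_⟩
  obtain ⟨p, hp⟩ := hA q
  obtain ⟨r, hr⟩ := hB q
  refine ⟨p + r.comp (p + Polynomial.X) + 1, fun o ho x hx => ?_⟩
  obtain ⟨s, hs, h1⟩ := hp o ho x hx
  obtain ⟨t, ht, h2⟩ := hr o ho _ (h o x hx)
  refine ⟨_, ?_, h1.seq h2⟩
  simp only [Polynomial.eval_add, Polynomial.eval_comp, Polynomial.eval_X, Polynomial.eval_one]
  -- The intermediate value is no longer than the time spent on it, which bounds the argument of
  -- `r`.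
  have h3 : sz (f o x) ≤ _ := h1.size_le.trans hs
  have h4 := r.eval_le_eval_of_le
    (show sz (f o x) + o.N ≤ p.eval (sz x + o.N) + (sz x + o.N) by omega)
  omega

theorem op {f : Ctx → α → β} (o : Op) (h : ∀ c x, D c x → o.apply (enc x) = enc (f c x))
    (r : Polynomial ℕ) (hr : ∀ c x, D c x → sz (f c x) ≤ r.eval (sz x)) : PT D f := by
  refine ⟨.op o, fun q => ⟨(Polynomial.X + r) ^ 2, fun c hc x hx => ?_⟩⟩
  have h0 := Eval.op (σ := c.σ) o (enc x)
  rw [h c x hx] at h0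
  refine ⟨_, ?_, h0⟩
  simp only [Polynomial.eval_add, Polynomial.eval_X, Polynomial.eval_pow]
  have h1 := hr c x hx
  have h2 := r.eval_le_eval_of_le (show sz x ≤ sz x + c.N by omega)
  refine Nat.pow_le_pow_left ?_ 2
  change sz x + sz (f c x) ≤ _
  omega

protected theorem id : PT D fun _ x => x :=
  op .id (fun _ _ _ => rfl) Polynomial.X fun _ _ _ => by simp

theorem exists_const (d : Data) : ∃ A : Prog, ∃ p : Polynomial ℕ, ∀ (o : Ctx) (v : Data),
    ∃ t ≤ p.eval v.size, Eval o.σ A v d t := by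
  induction d with
  | num q =>
    refine ⟨.op (.const q), (Polynomial.X + Polynomial.C (bitLength q)) ^ 2, fun o v => ⟨_, ?_, Eval.op _ _⟩⟩
    simp [Op.apply, Data.size]
  | pair x y hx hy =>
    obtain ⟨A, p, hA⟩ := hx
    obtain ⟨B, r, hB⟩ := hy
    refine ⟨.pair A B, Polynomial.X + p + r + 1, fun o v => ?_⟩
    obtain ⟨s, hs, h1⟩ := hA o v
    obtain ⟨t, ht, h2⟩ := hB o v
    refine ⟨_, ?_, h1.pair h2⟩
    simp only [Polynomial.eval_add, Polynomial.eval_X, Polynomial.eval_one]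
    omega

protected theorem const (c : β) : PT D fun _ _ => c := by
  obtain ⟨A, p, hA⟩ := exists_const (enc c)
  refine ⟨A, fun q => ⟨p, fun o _ x _ => ?_⟩⟩
  obtain ⟨t, ht, h⟩ := hA o (enc x)
  exact ⟨t, ht.trans (p.eval_le_eval_of_le (Nat.le_add_right _ _)), h⟩

theorem pair {f : Ctx → α → β} {g : Ctx → α → γ} (hf : PT D f) (hg : PT D g) :
    PT D fun o x => (f o x, g o x) := by
  obtain ⟨A, hA⟩ := hf
  obtain ⟨B, hB⟩ := hg
  refine ⟨.pair A B, fun q => ?_⟩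
  obtain ⟨p, hp⟩ := hA q
  obtain ⟨r, hr⟩ := hB q
  refine ⟨Polynomial.X + p + r + 1, fun o ho x hx => ?_⟩
  obtain ⟨s, hs, h1⟩ := hp o ho x hx
  obtain ⟨t, ht, h2⟩ := hr o ho x hx
  refine ⟨_, ?_, h1.pair h2⟩
  simp only [Polynomial.eval_add, Polynomial.eval_X, Polynomial.eval_one]
  change sz x + s + t + 1 ≤ _
  omega

theorem fst {f : Ctx → α → β × γ} (hf : PT D f) : PT D fun o x => (f o x).1 :=
  comp (F := fun _ _ => True) (g := fun _ (y : β × γ) => y.1)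
    (op .fst (fun _ _ _ => rfl) Polynomial.X fun _ x _ => by simp [sz_prod x]; omega)
    hf fun _ _ _ => trivial

theorem snd {f : Ctx → α → β × γ} (hf : PT D f) : PT D fun o x => (f o x).2 :=
  comp (F := fun _ _ => True) (g := fun _ (y : β × γ) => y.2)
    (op .snd (fun _ _ _ => rfl) Polynomial.X fun _ x _ => by simp [sz_prod x]; omega)
    hf fun _ _ _ => trivial

protected theorem add {f g : Ctx → α → ℚ} (hf : PT D f) (hg : PT D g) : PT D fun o x => f o x + g o x :=
  comp (F := fun _ _ => True) (g := fun _ (y : ℚ × ℚ) => y.1 + y.2)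
    (op .add (fun _ _ _ => rfl) (2 * Polynomial.X) fun _ x _ => by
      have := bitLength_add_le x.1 x.2
      simp [sz_prod x, sz_rat]; omega)
    (hf.pair hg) fun _ _ _ => trivial

protected theorem sub {f g : Ctx → α → ℚ} (hf : PT D f) (hg : PT D g) : PT D fun o x => f o x - g o x :=
  comp (F := fun _ _ => True) (g := fun _ (y : ℚ × ℚ) => y.1 - y.2)
    (op .sub (fun _ _ _ => rfl) (2 * Polynomial.X) fun _ x _ => by
      have := bitLength_sub_le x.1 x.2
      simp [sz_prod x, sz_rat]; omega)
    (hf.pair hg) fun _ _ _ => trivial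

protected theorem mul {f g : Ctx → α → ℚ} (hf : PT D f) (hg : PT D g) : PT D fun o x => f o x * g o x :=
  comp (F := fun _ _ => True) (g := fun _ (y : ℚ × ℚ) => y.1 * y.2)
    (op .mul (fun _ _ _ => rfl) (2 * Polynomial.X) fun _ x _ => by
      have := bitLength_mul_le x.1 x.2
      simp [sz_prod x, sz_rat]; omega)
    (hf.pair hg) fun _ _ _ => trivial

protected theorem div {f g : Ctx → α → ℚ} (hf : PT D f) (hg : PT D g) : PT D fun o x => f o x / g o x :=
  comp (F := fun _ _ => True) (g := fun _ (y : ℚ × ℚ) => y.1 / y.2)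
    (op .div (fun _ _ _ => rfl) (2 * Polynomial.X) fun _ x _ => by
      have := bitLength_div_le' x.1 x.2
      simp [sz_prod x, sz_rat]; omega)
    (hf.pair hg) fun _ _ _ => trivial

theorem sz_bool_le (b : Bool) : sz b ≤ 3 := by
  cases b <;> simp [sz, enc, Enc.toData, Data.size, bitLength]

protected theorem le {f g : Ctx → α → ℚ} (hf : PT D f) (hg : PT D g) :
    PT D fun o x => decide (f o x ≤ g o x) :=
  comp (F := fun _ _ => True) (g := fun _ (y : ℚ × ℚ) => decide (y.1 ≤ y.2))
    (op .le (fun _ x _ => by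
      by_cases h : x.1 ≤ x.2 <;> simp [enc, Enc.toData, Op.apply, h]) 3 fun _ x _ => by
      simpa using sz_bool_le _)
    (hf.pair hg) fun _ _ _ => trivial

/-- Each branch has to be computable only where it is taken; elsewhere its program need not even
halt. This is what permits guarded oracle calls. -/
theorem ite {c : Ctx → α → Bool} {f g : Ctx → α → β} (hc : PT D c)
    (hf : PT (fun o x => D o x ∧ c o x = true) f) (hg : PT (fun o x => D o x ∧ c o x = false) g) :
    PT D fun o x => if c o x = true then f o x else g o x := by
  obtain ⟨C, hC⟩ := hc
  obtain ⟨A, hA⟩ := hf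
  obtain ⟨B, hB⟩ := hg
  refine ⟨.ite C A B, fun q => ?_⟩
  obtain ⟨pc, hpc⟩ := hC q
  obtain ⟨p, hp⟩ := hA q
  obtain ⟨r, hr⟩ := hB q
  refine ⟨Polynomial.X + pc + p + r + 1, fun o ho x hx => ?_⟩
  obtain ⟨s, hs, h1⟩ := hpc o ho x hx
  simp only [Polynomial.eval_add, Polynomial.eval_X, Polynomial.eval_one]
  have hsz : (enc x).size = sz x := rfl
  by_cases h : c o x = true
  · obtain ⟨t, ht, h2⟩ := hp o ho x ⟨hx, h⟩
    rw [if_pos h]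
    exact ⟨_, by omega, h1.ite_true (by simp [enc, Enc.toData, h]) h2⟩
  · rw [if_neg h]
    rw [Bool.not_eq_true] at h
    obtain ⟨t, ht, h2⟩ := hr o ho x ⟨hx, h⟩
    exact ⟨_, by omega, h1.ite_false (by simp [enc, Enc.toData, h]) h2⟩

theorem ite' {c : Ctx → α → Bool} {f g : Ctx → α → β} (hc : PT D c) (hf : PT D f) (hg : PT D g) :
    PT D fun o x => if c o x = true then f o x else g o x :=
  ite hc (hf.mono fun _ _ h => h.1) (hg.mono fun _ _ h => h.1)

protected theorem not {c : Ctx → α → Bool} (hc : PT D c) : PT D fun o x => !c o x :=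
  (ite' hc (PT.const false) (PT.const true)).congr fun o x _ => by cases c o x <;> rfl

protected theorem and {c d : Ctx → α → Bool} (hc : PT D c) (hd : PT D d) : PT D fun o x => c o x && d o x :=
  (ite' hc hd (PT.const false)).congr fun o x _ => by cases c o x <;> rfl

protected theorem lt {f g : Ctx → α → ℚ} (hf : PT D f) (hg : PT D g) :
    PT D fun o x => decide (f o x < g o x) :=
  (PT.le hg hf).not.congr fun o x _ => by simp [← not_le]

protected theorem eq {f g : Ctx → α → ℚ} (hf : PT D f) (hg : PT D g) :
    PT D fun o x => decide (f o x = g o x) :=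
  ((PT.le hf hg).and (PT.le hg hf)).congr fun o x _ => by
    rw [← Bool.decide_and]; exact decide_eq_decide.2 le_antisymm_iff.symm

protected theorem max {f g : Ctx → α → ℚ} (hf : PT D f) (hg : PT D g) :
    PT D fun o x => max (f o x) (g o x) :=
  (ite' (PT.le hf hg) hg hf).congr fun o x _ => by simp [max_def]

protected theorem min {f g : Ctx → α → ℚ} (hf : PT D f) (hg : PT D g) :
    PT D fun o x => min (f o x) (g o x) :=
  (ite' (PT.le hf hg) hf hg).congr fun o x _ => by simp [min_def]

protected theorem natCast {f : Ctx → α → ℕ} (hf : PT D f) : PT D fun o x => (f o x : ℚ) :=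
  of_enc_eq hf fun _ _ _ => rfl

protected theorem succ {f : Ctx → α → ℕ} (hf : PT D f) : PT D fun o x => f o x + 1 :=
  of_enc_eq (hf.natCast.add (PT.const 1)) fun _ _ _ => by simp [enc, Enc.toData]

/-! ### Loops -/

/-- Polynomial time of a single round is not enough, since sizes could explode under iteration.
Hence one polynomial `r` in the initial size has to bound the number of rounds and the sizes of all
iterates. -/
theorem loop {Inv : Ctx → α → Prop} {c : Ctx → α → Bool} {f F : Ctx → α → α} (hc : PT Inv c)
    (hf : PT (fun o x => Inv o x ∧ c o x = true) f)
    (h : ∀ q : Polynomial ℕ, ∃ r : Polynomial ℕ, ∀ o : Ctx, o.Good q → ∀ x, D o x →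
      ∃ m ≤ r.eval (sz x + o.N), F o x = (f o)^[m] x ∧ c o ((f o)^[m] x) = false ∧
        (∀ j < m, c o ((f o)^[j] x) = true) ∧
        ∀ j ≤ m, Inv o ((f o)^[j] x) ∧ sz ((f o)^[j] x) ≤ r.eval (sz x + o.N)) : PT D F := by
  obtain ⟨C, hC⟩ := hc
  obtain ⟨A, hA⟩ := hf
  refine ⟨.loop C A, fun q => ?_⟩
  obtain ⟨pc, hpc⟩ := hC q
  obtain ⟨p, hp⟩ := hA q
  obtain ⟨r, hr⟩ := h q
  refine ⟨(r + 1) * (r + pc.comp (r + Polynomial.X) + p.comp (r + Polynomial.X) + 1),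
    fun o ho x hx => ?_⟩
  obtain ⟨m, hm, hF, hend, hcont, hinv⟩ := hr o ho x hx
  set s := sz x + o.N
  set R := r.eval s with hR
  set K := R + pc.eval (R + s) + p.eval (R + s) + 1 with hK
  -- Induction on the number `j` of remaining rounds, because the evaluation rule peels off the
  -- first round; `K` bounds the cost of one round.
  have key : ∀ j ≤ m, ∃ t ≤ (j + 1) * K,
      Eval o.σ (.loop C A) (enc ((f o)^[m - j] x)) (enc (F o x)) t := by
    intro j
    induction j with
    | zero =>
      intro _
      obtain ⟨h1, h2⟩ := hinv m le_rfl
      obtain ⟨u, hu, he⟩ := hpc o ho _ h1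
      rw [hF, Nat.sub_zero]
      refine ⟨_, ?_, he.loop_done (by rw [hend]; rfl)⟩
      have h3 := pc.eval_le_eval_of_le (show sz ((f o)^[m] x) + o.N ≤ R + s by omega)
      change sz ((f o)^[m] x) + u + 1 ≤ _
      omega
    | succ j ih =>
      intro hj
      obtain ⟨t, ht, he⟩ := ih (by omega)
      obtain ⟨h1, h2⟩ := hinv (m - (j + 1)) (by omega)
      have h3 := hcont (m - (j + 1)) (by omega)
      obtain ⟨u, hu, he1⟩ := hpc o ho _ h1
      obtain ⟨v, hv, he2⟩ := hp o ho _ ⟨h1, h3⟩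
      rw [← Function.iterate_succ_apply' (f o), show (m - (j + 1)).succ = m - j by omega] at he2
      refine ⟨_, ?_, he1.loop_step (by rw [h3]; simp [enc, Enc.toData]) he2 he⟩
      have h4 := pc.eval_le_eval_of_le (show sz ((f o)^[m - (j + 1)] x) + o.N ≤ R + s by omega)
      have h5 := p.eval_le_eval_of_le (show sz ((f o)^[m - (j + 1)] x) + o.N ≤ R + s by omega)
      change sz ((f o)^[m - (j + 1)] x) + u + v + t + 1 ≤ _
      rw [add_mul (j + 1) 1 K]
      omega
  obtain ⟨t, ht, he⟩ := key m le_rfl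
  rw [Nat.sub_self] at he
  refine ⟨t, ht.trans ?_, he⟩
  simp only [Polynomial.eval_mul, Polynomial.eval_add, Polynomial.eval_comp, Polynomial.eval_X,
    Polynomial.eval_one]
  exact Nat.mul_le_mul_right _ (by omega)

/-! ### Lists -/

theorem cons {f : Ctx → α → β} {l : Ctx → α → List β} (hf : PT D f) (hl : PT D l) :
    PT D fun o x => f o x :: l o x :=
  of_enc_eq (hf.pair hl) fun _ _ _ => rfl

theorem tail {l : Ctx → α → List β} (hl : PT D l) : PT D fun o x => (l o x).tail :=
  comp (F := fun _ _ => True) (g := fun _ (y : List β) => y.tail)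
    (op .snd (fun _ l _ => by cases l <;> rfl) Polynomial.X fun _ l _ => by
      cases l with
      | nil => simp
      | cons b l => simp [sz_cons]; omega)
    hl fun _ _ _ => trivial

theorem isEmpty {l : Ctx → α → List β} (hl : PT D l) : PT D fun o x => (l o x).isEmpty :=
  (PT.not (comp (F := fun _ _ => True) (g := fun _ (y : List β) => !y.isEmpty)
    (op .isPair (fun _ l _ => by cases l <;> rfl) 3 fun _ l _ => by simpa using sz_bool_le _)
    hl fun _ _ _ => trivial)).congr fun _ _ _ => Bool.not_not _

theorem headD {l : Ctx → α → List β} {d : Ctx → α → β} (hl : PT D l) (hd : PT D d) :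
    PT D fun o x => (l o x).headD (d o x) := by
  by_cases hβ : Nonempty β
  · obtain ⟨b⟩ := hβ
    have h1 : PT (fun _ (y : List β) => y ≠ []) fun _ y => y.headD b :=
      op .fst (fun _ l h => by
        cases l with
        | nil => exact absurd rfl h
        | cons x l => rfl) Polynomial.X fun _ l h => by
        cases l with
        | nil => exact absurd rfl h
        | cons x l => simp [sz_cons]; omega
    have h2 : PT (fun o x => D o x ∧ (l o x).isEmpty = false) fun o x => (l o x).headD b :=
      h1.comp (hl.mono fun _ _ h => h.1) fun o x h h' => by simp [h'] at h
    refine (ite hl.isEmpty (hd.mono fun _ _ h => h.1) h2).congr fun o x _ => ?_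
    cases l o x <;> simp
  · refine hd.congr fun o x _ => ?_
    exact absurd ⟨d o x⟩ hβ

/-- The domain on which the step of a fold over the list `l` is evaluated. -/
def FoldDom {α β γ : Type} (D : Ctx → α → Prop) (l : Ctx → α → List β) (a : Ctx → α → γ)
    (f : Ctx → α → γ → β → γ) (o : Ctx) (p : α × γ × β) : Prop :=
  D o p.1 ∧ ∃ l₁ l₂, l o p.1 = l₁ ++ p.2.2 :: l₂ ∧ p.2.1 = l₁.foldl (f o p.1) (a o p.1)

/-- A loop on triples of input, accumulator and remaining list. The step is needed only for
accumulators that really occur (`FoldDom`), and `hb` excludes that they grow too much. -/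
theorem foldl {l : Ctx → α → List β} {a : Ctx → α → γ} {f : Ctx → α → γ → β → γ}
    (hl : PT D l) (ha : PT D a)
    (hf : PT (FoldDom D l a f) fun o p => f o p.1 p.2.1 p.2.2)
    (hb : ∀ q : Polynomial ℕ, ∃ r : Polynomial ℕ, ∀ o : Ctx, o.Good q → ∀ x, D o x →
      ∀ l₁ l₂, l o x = l₁ ++ l₂ → sz (l₁.foldl (f o x) (a o x)) ≤ r.eval (sz x + o.N)) :
    PT D fun o x => (l o x).foldl (f o x) (a o x) := by
  by_cases hβ : Nonempty β
  swap
  · refine ha.congr fun o x _ => ?_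
    cases h : l o x with
    | nil => rfl
    | cons b _ => exact absurd ⟨b⟩ hβ
  -- `b` only serves as a default for the head of the empty list, a case excluded by the loop
  -- condition.
  obtain ⟨b⟩ := hβ
  let Inv : Ctx → α × γ × List β → Prop := fun o s =>
    D o s.1 ∧ ∃ l₁, l o s.1 = l₁ ++ s.2.2 ∧ s.2.1 = l₁.foldl (f o s.1) (a o s.1)
  let step : Ctx → α × γ × List β → α × γ × List β := fun o s =>
    (s.1, f o s.1 s.2.1 (s.2.2.headD b), s.2.2.tail)
  have hiter : ∀ o x j, j ≤ (l o x).length → (step o)^[j] (x, a o x, l o x) =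
      (x, ((l o x).take j).foldl (f o x) (a o x), (l o x).drop j) := by
    intro o x j
    induction j with
    | zero => intro _; simp
    | succ j ih =>
      intro hj
      rw [Function.iterate_succ_apply', ih (by omega)]
      simp only [step]
      rw [List.drop_eq_getElem_cons (by omega), List.take_succ_eq_append_getElem (by omega),
        List.foldl_append]
      rfl
  have hloop : PT (fun o (s : α × γ × List β) => D o s.1 ∧ s.2.1 = a o s.1 ∧ s.2.2 = l o s.1)
      (fun o (s : α × γ × List β) => (s.1, s.2.2.foldl (f o s.1) s.2.1, ([] : List β))) := by
    refine loop (Inv := Inv) (c := fun o s => !s.2.2.isEmpty) (f := step)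
      (isEmpty (PT.id.snd.snd)).not ?_ fun q => ?_
    · refine (PT.id.fst).pair (PT.pair ?_ PT.id.snd.snd.tail)
      refine hf.comp (f := fun o (s : α × γ × List β) => (s.1, s.2.1, s.2.2.headD b))
        (PT.id.fst.pair (PT.id.snd.fst.pair (PT.id.snd.snd.headD (PT.const b)))) ?_
      rintro o ⟨x, y, m⟩ ⟨⟨h1, l₁, h2, h3⟩, h4⟩
      cases m with
      | nil => simp at h4
      | cons c m => exact ⟨h1, l₁, m, h2, h3⟩
    · obtain ⟨r, hr⟩ := hb q
      obtain ⟨p, hp⟩ := hl.sz_le q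
      refine ⟨Polynomial.X + r + p + 2, fun o ho => ?_⟩
      rintro ⟨x, y, m⟩ ⟨hx, h1, h2⟩
      dsimp only at h1 h2 hx
      subst h1 h2
      have hle : sz x + o.N ≤ sz (x, a o x, l o x) + o.N := by rw [sz_prod]; dsimp only; omega
      have h0 := hp o ho x hx
      have hp1 := p.eval_le_eval_of_le hle
      have hr1 := r.eval_le_eval_of_le hle
      have h3 := length_le_sz (l o x)
      simp only [Polynomial.eval_add, Polynomial.eval_X, Polynomial.eval_ofNat]
      refine ⟨(l o x).length, by omega, ?_, ?_, ?_, ?_⟩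
      · rw [hiter o x _ le_rfl]; simp
      · rw [hiter o x _ le_rfl]; simp
      · intro j hj
        rw [hiter o x _ hj.le]
        simp [hj]
      · intro j hj
        rw [hiter o x _ hj]
        refine ⟨⟨hx, (l o x).take j, by simp, rfl⟩, ?_⟩
        rw [sz_prod, sz_prod]
        dsimp only
        have h4 := hr o ho x hx ((l o x).take j) ((l o x).drop j) (by simp)
        have h5 : sz ((l o x).drop j) ≤ sz (l o x) := by
          have e := sz_append ((l o x).take j) ((l o x).drop j)
          have e2 : 2 ≤ sz ((l o x).take j) := by rw [sz_eq_sum]; omega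
          rw [List.take_append_drop] at e
          omega
        rw [sz_prod] at hp1 hr1 ⊢
        dsimp only at *
        omega
  exact (hloop.comp (PT.id.pair (ha.pair hl)) fun o x hx => ⟨hx, rfl, rfl⟩).snd.fst

theorem reverse {l : Ctx → α → List β} (hl : PT D l) : PT D fun o x => (l o x).reverse := by
  refine (foldl (f := fun _ _ acc b => b :: acc) hl (PT.const []) (PT.cons PT.id.snd.snd PT.id.snd.fst)
    fun q => ?_).congr fun o x _ => by simp
  obtain ⟨p, hp⟩ := hl.sz_le q
  refine ⟨p, fun o ho x hx l₁ l₂ h => ?_⟩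
  have e : l₁.foldl (fun acc b => b :: acc) [] = l₁.reverse := by
    simp
  rw [e, sz_reverse]
  refine le_trans ?_ (hp o ho x hx)
  have e2 : 2 ≤ sz l₂ := by rw [sz_eq_sum]; omega
  have := sz_append l₁ l₂
  rw [h]
  omega

theorem append {l m : Ctx → α → List β} (hl : PT D l) (hm : PT D m) :
    PT D fun o x => l o x ++ m o x := by
  refine (foldl (f := fun _ _ acc b => b :: acc) hl.reverse hm
    (PT.cons PT.id.snd.snd PT.id.snd.fst) fun q => ?_).congr fun o x _ => by simp
  obtain ⟨p, hp⟩ := hl.sz_le q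
  obtain ⟨r, hr⟩ := hm.sz_le q
  refine ⟨p + r, fun o ho x hx l₁ l₂ h => ?_⟩
  have e : l₁.foldl (fun acc b => b :: acc) (m o x) = l₁.reverse ++ m o x := by
    simp
  rw [e, Polynomial.eval_add]
  have h1 := hp o ho x hx
  have h2 := hr o ho x hx
  rw [← sz_reverse, h] at h1
  have h3 := sz_append l₁.reverse (m o x)
  have h4 := sz_append l₁ l₂
  rw [sz_reverse] at h3
  have e2 : 2 ≤ sz l₂ := by rw [sz_eq_sum]; omega
  omega

theorem map {l : Ctx → α → List β} {f : Ctx → α → β → γ} (hl : PT D l)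
    (hf : PT (fun o (p : α × β) => D o p.1 ∧ p.2 ∈ l o p.1) fun o p => f o p.1 p.2) :
    PT D fun o x => (l o x).map (f o x) := by
  have e : ∀ (o : Ctx) x (m : List β), m.foldl (fun acc b => f o x b :: acc) []
      = (m.map (f o x)).reverse := by
    intro o x m
    induction m using List.reverseRecOn with
    | nil => rfl
    | append_singleton m b ih => simp [ih]
  refine (reverse (foldl (f := fun o x acc b => f o x b :: acc) hl (PT.const [])
    (PT.cons (hf.comp (PT.id.fst.pair PT.id.snd.snd) ?_) PT.id.snd.fst) fun q => ?_)).congr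
    fun o x _ => by rw [e, List.reverse_reverse]
  · rintro o ⟨x, y, b⟩ ⟨h1, l₁, l₂, h2, -⟩
    refine ⟨h1, ?_⟩
    dsimp only at h2 ⊢
    rw [h2]
    simp
  · obtain ⟨p, hp⟩ := hl.sz_le q
    obtain ⟨r, hr⟩ := hf.sz_le q
    refine ⟨p * (r.comp (Polynomial.X + p + 1) + 1) + 2, fun o ho x hx l₁ l₂ h => ?_⟩
    rw [e, sz_reverse]
    simp only [Polynomial.eval_add, Polynomial.eval_mul, Polynomial.eval_comp, Polynomial.eval_X,
      Polynomial.eval_one, Polynomial.eval_ofNat]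
    have h0 := hp o ho x hx
    refine (sz_le_of_forall (B := r.eval (sz x + o.N + p.eval (sz x + o.N) + 1)) ?_).trans ?_
    · intro y hy
      obtain ⟨b, hb, rfl⟩ := List.mem_map.1 hy
      have hb' : b ∈ l o x := by rw [h]; simp [hb]
      refine (hr o ho (x, b) ⟨hx, hb'⟩).trans (r.eval_le_eval_of_le ?_)
      rw [sz_prod]
      have := sz_le_of_mem hb'
      dsimp only
      omega
    · rw [List.length_map]
      have h1 := length_le_sz (l o x)
      have h2 : l₁.length ≤ (l o x).length := by rw [h]; simp
      gcongr
      omega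

theorem flatten {L : Ctx → α → List (List β)} (hL : PT D L) : PT D fun o x => (L o x).flatten := by
  have e : ∀ M : List (List β), M.foldl (fun acc l => acc ++ l) [] = M.flatten := by
    intro M
    induction M using List.reverseRecOn with
    | nil => rfl
    | append_singleton m b ih => simp [ih]
  refine (foldl (f := fun _ _ acc l => acc ++ l) hL (PT.const [])
    (PT.append PT.id.snd.fst PT.id.snd.snd) fun q => ?_).congr fun o x _ => e _
  obtain ⟨p, hp⟩ := hL.sz_le q
  refine ⟨p, fun o ho x hx l₁ l₂ h => ?_⟩
  rw [e]
  refine (sz_flatten_le _).trans (le_trans ?_ (hp o ho x hx))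
  rw [h]
  have := sz_append l₁ l₂
  have e2 : 2 ≤ sz l₂ := by rw [sz_eq_sum]; omega
  omega

theorem flatMap {l : Ctx → α → List β} {f : Ctx → α → β → List γ} (hl : PT D l)
    (hf : PT (fun o (p : α × β) => D o p.1 ∧ p.2 ∈ l o p.1) fun o p => f o p.1 p.2) :
    PT D fun o x => (l o x).flatMap (f o x) :=
  (flatten (map hl hf)).congr fun _ _ _ => rfl

theorem filter {l : Ctx → α → List β} {f : Ctx → α → β → Bool} (hl : PT D l)
    (hf : PT (fun o (p : α × β) => D o p.1 ∧ p.2 ∈ l o p.1) fun o p => f o p.1 p.2) :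
    PT D fun o x => (l o x).filter (f o x) := by
  refine (flatMap (f := fun o x b => if f o x b = true then [b] else []) hl
    (ite' hf (PT.cons PT.id.snd (PT.const [])) (PT.const []))).congr fun o x _ => ?_
  induction l o x with
  | nil => rfl
  | cons b m ih => by_cases h : f o x b = true <;> simp [h, ih]

theorem product {l : Ctx → α → List β} {m : Ctx → α → List γ} (hl : PT D l) (hm : PT D m) :
    PT D fun o x => (l o x) ×ˢ (m o x) :=
  (flatMap hl (map (hm.comp PT.id.fst fun _ _ h => h.1)
    (f := fun _ p c => (p.2, c)) (PT.pair PT.id.fst.snd PT.id.snd))).congr fun _ _ _ => rfl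

theorem takeOne {l : Ctx → α → List β} (hl : PT D l) : PT D fun o x => (l o x).take 1 := by
  by_cases hβ : Nonempty β
  · obtain ⟨b⟩ := hβ
    refine (ite' hl.isEmpty (PT.const []) ((hl.headD (PT.const b)).cons (PT.const []))).congr
      fun o x _ => ?_
    cases l o x <;> simp
  · refine (PT.const []).congr fun o x _ => ?_
    cases h : l o x with
    | nil => rfl
    | cons b _ => exact absurd ⟨b⟩ hβ

/-! ### Tuples of fixed length -/

theorem finCons {m : ℕ} {f : Ctx → α → β} {v : Ctx → α → Fin m → β} (hf : PT D f) (hv : PT D v) :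
    PT D fun o x => (Fin.cons (f o x) (v o x) : Fin (m + 1) → β) :=
  of_enc_eq (hf.pair hv) fun _ _ _ => (enc_fin_cons _ _).symm

/-- The program consists of one piece per entry, so its length depends on m. Here, and in the sums
and folds over fixed finite sets, it is essential that k is a constant. -/
theorem tuple {m : ℕ} {f : Ctx → α → Fin m → β} (hf : ∀ i, PT D fun o x => f o x i) : PT D f := by
  induction m with
  | zero => exact (PT.const (fun i : Fin 0 => i.elim0)).congr fun o x _ => Subsingleton.elim _ _
  | succ m ih =>
    refine (finCons (hf 0) (ih (f := fun o x i => f o x i.succ) fun i => hf i.succ)).congr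
      fun o x _ => ?_
    exact Fin.cons_self_tail _

theorem proj {m : ℕ} {f : Ctx → α → Fin m → β} (hf : PT D f) (i : Fin m) :
    PT D fun o x => f o x i := by
  induction m with
  | zero => exact i.elim0
  | succ m ih =>
    have h2 : PT D fun o x => (f o x 0, fun j : Fin m => f o x j.succ) :=
      of_enc_eq hf fun o x _ => by
        conv_lhs => rw [← Fin.cons_self_tail (f o x)]
        exact enc_fin_cons _ _
    refine Fin.cases ?_ (fun j => ?_) i
    · exact h2.fst
    · exact ih h2.snd j

theorem sum {ι : Type*} (s : Finset ι) {f : ι → Ctx → α → ℚ} (hf : ∀ i, PT D (f i)) :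
    PT D fun o x => ∑ i ∈ s, f i o x := by
  classical
  induction s using Finset.induction_on with
  | empty => simpa using PT.const (0 : ℚ)
  | insert i s hi ih => simpa only [Finset.sum_insert hi] using (hf i).add ih

theorem foldMax {ι : Type*} (s : Finset ι) {a : Ctx → α → ℚ} {f : ι → Ctx → α → ℚ} (ha : PT D a)
    (hf : ∀ i, PT D (f i)) : PT D fun o x => s.fold max (a o x) fun i => f i o x := by
  classical
  induction s using Finset.induction_on with
  | empty => simpa using ha
  | insert i s hi ih => simpa only [Finset.fold_insert hi] using (hf i).max ih

theorem foldMin {ι : Type*} (s : Finset ι) {a : Ctx → α → ℚ} {f : ι → Ctx → α → ℚ} (ha : PT D a)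
    (hf : ∀ i, PT D (f i)) : PT D fun o x => s.fold min (a o x) fun i => f i o x := by
  classical
  induction s using Finset.induction_on with
  | empty => simpa using ha
  | insert i s hi ih => simpa only [Finset.fold_insert hi] using (hf i).min ih

theorem all {ι : Type*} (s : Finset ι) {c : ι → Ctx → α → Bool} (hc : ∀ i, PT D (c i)) :
    PT D fun o x => decide (∀ i ∈ s, c i o x = true) := by
  classical
  induction s using Finset.induction_on with
  | empty => simpa using PT.const true
  | insert i s hi ih =>
    exact ((hc i).and ih).congr fun o x _ => by
      rw [Bool.eq_iff_iff]; simp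

theorem tupleEq {m : ℕ} {v w : Ctx → α → Fin m → ℚ} (hv : PT D v) (hw : PT D w) :
    PT D fun o x => decide (v o x = w o x) :=
  (all Finset.univ fun i => (hv.proj i).eq (hw.proj i)).congr fun o x _ => by
    rw [Bool.eq_iff_iff]; simp [funext_iff]

end PT

/-- All tuples of length `m` with entries in a list. -/
def tuples {β : Type} : (m : ℕ) → List β → List (Fin m → β)
  | 0, _ => [fun i => i.elim0]
  | m + 1, l => l.flatMap fun a => (tuples m l).map (Fin.cons a)

theorem mem_tuples {β : Type} {m : ℕ} {l : List β} {v : Fin m → β} :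
    v ∈ tuples m l ↔ ∀ i, v i ∈ l := by
  induction m with
  | zero => simp [tuples]; exact Subsingleton.elim _ _
  | succ m ih =>
    simp only [tuples, List.mem_flatMap, List.mem_map, ih]
    constructor
    · rintro ⟨a, ha, w, hw, rfl⟩ i
      refine Fin.cases ?_ (fun j => ?_) i
      · simpa
      · simpa using hw j
    · intro h
      exact ⟨v 0, h 0, Fin.tail v, fun i => h i.succ, Fin.cons_self_tail v⟩

theorem length_tuples {β : Type} (m : ℕ) (l : List β) : (tuples m l).length = l.length ^ m := by
  induction m with
  | zero => simp [tuples]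
  | succ m ih => simp [tuples, List.length_flatMap, ih, pow_succ, mul_comm]

/-- Polynomial only because the exponent m in the length |l|^m is built into the program. -/
theorem PT.tuples {α β : Type} [Enc α] [Enc β] {D : Ctx → α → Prop} (m : ℕ)
    {l : Ctx → α → List β} (hl : PT D l) : PT D fun o x => tuples m (l o x) := by
  induction m with
  | zero => exact PT.const _
  | succ m ih =>
    have h : PT (fun o (p : α × β) => D o p.1 ∧ p.2 ∈ l o p.1) fun o p =>
        (ParetoCover.tuples m (l o p.1)).map fun v => (Fin.cons p.2 v : Fin (m + 1) → β) :=
      PT.map (ih.comp PT.id.fst fun _ _ h => h.1) (PT.finCons PT.id.fst.snd PT.id.snd)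
    exact PT.flatMap (f := fun o x a => (ParetoCover.tuples m (l o x)).map fun v =>
      (Fin.cons a v : Fin (m + 1) → β)) hl h

section

/-! ### The algorithm -/

/-- Round up to the next element of an increasing list. -/
def roundUp (Γ : List ℚ) (x : ℚ) : ℚ := (Γ.filter fun g => decide (x ≤ g)).headD 1

/-- The powers `(1 + δ)⁻ʲ` for `j = J, …, 0`. -/
def powersUpTo (δ : ℚ) : ℕ → List ℚ
  | 0 => [1]
  | J + 1 => ((1 + δ) ^ (J + 1))⁻¹ :: powersUpTo δ J

open Classical in
/-- The first `J` such that `(1 + δ)⁻ᴶ ≤ η`. -/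
noncomputable def gridSteps (δ η : ℚ) : ℕ :=
  if h : ∃ J : ℕ, ((1 + δ) ^ J)⁻¹ ≤ η then Nat.find h else 0

/-- A geometric grid from `1` down to below `η`. -/
noncomputable def grid (δ η : ℚ) : List ℚ := powersUpTo δ (gridSteps δ η)

/-- The elements of a list where `key` is minimal. -/
def minimizers {β : Type} (key : β → ℚ) (l : List β) : List β :=
  l.filter fun e => (l.filter fun e' => decide (key e' < key e)).isEmpty

/-- The length of a list, and the reversed list with the entries numbered. -/
def numbered (l : List ℚ) : ℕ × List (ℕ × ℚ) :=
  l.foldl (fun s c => (s.1 + 1, (s.1, c) :: s.2)) (0, [])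

/-- Ask an oracle, if the arguments are proper. -/
def Ctx.ask (o : Ctx) (i : ℕ) (a b δ : ℚ) : ℚ :=
  if h : i < o.n then
    if (decide (-1 ≤ a) && decide (a < b) && decide (b ≤ 1) && decide (0 < δ) && decide (δ < 1))
      = true then (o.σ ⟨i, h⟩).value a b δ else 0
  else 0

variable {k : ℕ}

/-- The largest entry outside `T`. -/
def lowerEnd (g : Fin (k + 1) → ℚ) (T : Finset (Fin (k + 1))) : ℚ := Tᶜ.fold max (-1) g

/-- The smallest entry in `T`. -/
def upperEnd (g : Fin (k + 1) → ℚ) (T : Finset (Fin (k + 1))) : ℚ := T.fold min 1 g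

/-- An upper estimate for the probability that, of the entries of `g`, exactly those in `T` cover
the coordinate number `i`. -/
def Ctx.mass (o : Ctx) (δ : ℚ) (i : ℕ) (g : Fin (k + 1) → ℚ) (T : Finset (Fin (k + 1))) : ℚ :=
  (1 + δ) * o.ask i (lowerEnd g T) (upperEnd g T) δ

/-- The first entry of `g` always covers the coordinate number `i`. -/
def Ctx.covers (o : Ctx) (δ : ℚ) (i : ℕ) (g : Fin (k + 1) → ℚ) : Bool :=
  decide (o.ask i (g 0) 1 δ ≤ 0)

/-- A numbering of the subsets. -/
noncomputable def code (k : ℕ) :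
    Finset (Fin (k + 1)) ≃ Fin (Fintype.card (Finset (Fin (k + 1)))) := Fintype.equivFin _

/-- Estimates for the costs of the points and for the distribution of the set of points that
cover. -/
abbrev State (k : ℕ) :=
  (Fin (k + 1) → ℚ) × (Fin (Fintype.card (Finset (Fin (k + 1)))) → ℚ)

/-- No coordinate has been treated. -/
noncomputable def State.init (k : ℕ) : State k :=
  (fun _ => 0, fun r => if r = code k Finset.univ then 1 else 0)

/-- Treat a coordinate with cost `c`, where the points have the entries `g`, and where the set of
covering points is `T` with probability `m T`. -/
noncomputable def State.next (Γ : List ℚ) (c : ℚ) (g : Fin (k + 1) → ℚ)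
    (m : Finset (Fin (k + 1)) → ℚ) (s : State k) : State k :=
  (fun j => roundUp Γ (s.1 j + c * g j), fun r => roundUp Γ
    (∑ p : Finset (Fin (k + 1)) × Finset (Fin (k + 1)) with p.1 ∩ p.2 = (code k).symm r,
      s.2 (code k p.1) * m p.2))

/-- The estimate for the expected cost. -/
noncomputable def State.cost (s : State k) : ℚ :=
  ∑ S : Finset (Fin (k + 1)), s.2 (code k S) * S.fold min (s.1 0) s.1

/-- All extensions of the given partial solutions by one more coordinate. -/
noncomputable def Ctx.extensions (o : Ctx) (Γ : List ℚ) (δ : ℚ) (ic : ℕ × ℚ)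
    (L : List (State k × List (Fin (k + 1) → ℚ))) : List (State k × List (Fin (k + 1) → ℚ)) :=
  (L ×ˢ (tuples (k + 1) Γ).filter (o.covers δ ic.1)).map fun p =>
    (State.next Γ ic.2 p.2 (o.mass δ ic.1 p.2) p.1.1, p.2 :: p.1.2)

/-- All entries lie in `Γ`. -/
def allStates (k : ℕ) (Γ : List ℚ) : List (State k) := tuples _ Γ ×ˢ tuples _ Γ

/-- One step of the dynamic program: of the extensions with the same state, only one is kept. -/
noncomputable def Ctx.treat (o : Ctx) (Γ : List ℚ) (δ : ℚ) (ic : ℕ × ℚ)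
    (L : List (State k × List (Fin (k + 1) → ℚ))) : List (State k × List (Fin (k + 1) → ℚ)) :=
  (allStates k Γ).flatMap fun s =>
    ((o.extensions Γ δ ic L).filter fun e => decide (e.1 = s)).take 1

/-- The points number `i` and `j` are equal. -/
def coincide (h : List (Fin (k + 1) → ℚ)) (i j : Fin (k + 1)) : Bool :=
  (h.filter fun g => !decide (g i = g j)).isEmpty

/-- The point number `j` is equal to an earlier one. -/
def redundant (h : List (Fin (k + 1) → ℚ)) (j : Fin (k + 1)) : Bool :=
  !decide (∀ i ∈ Finset.Iio j, (!coincide h i j) = true)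

/-- Replace redundant points by new ones. -/
def separate (η : ℚ) (h : List (Fin (k + 1) → ℚ)) : List (Fin (k + 1) → ℚ) :=
  (fun j => if redundant h j = true then η * (((j : ℕ) + 1 : ℚ) / (2 * (k + 2)))
    else h.headD 0 j) :: h.tail

/-- The costs, the lower bound for the expectations and the accuracy. -/
abbrev Input := List ℚ × ℚ × ℚ

def Input.dim (x : Input) : ℕ := (numbered x.1).1

def Input.maxCost (x : Input) : ℚ := (minimizers (fun c => -c) x.1).headD 0

/-- The error analysis produces 4n + 1 factors 1 + δ, and (4n + 1)δ ≤ 5nδ = γ/8; this explains 40 =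
5 · 8. -/
def Input.ratio (x : Input) : ℚ := x.2.2 / (40 * (Input.dim x : ℚ))

/-- With this η the total additive error 4n · 2^(k+1) · η equals γ/4 times α/n, the lower bound for
the cost of any cover after scaling. -/
def Input.least (k : ℕ) (x : Input) : ℚ :=
  x.2.1 * x.2.2 / (16 * 2 ^ (k + 1) * ((Input.dim x : ℚ) * (Input.dim x : ℚ)))

noncomputable def Input.grid (k : ℕ) (x : Input) : List ℚ :=
  ParetoCover.grid (Input.ratio x) (Input.least k x)

/-- The coordinates with their costs, which are scaled such that their sum is at most `1`. -/
def Input.coords (x : Input) : List (ℕ × ℚ) :=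
  (numbered x.1).2.map fun p => (p.1, p.2 / ((Input.dim x : ℚ) * Input.maxCost x))

/-- The numbered list is reversed, so the coordinates are treated from the last to the first, and
the histories, extended at the front, come out in the natural order. -/
noncomputable def Ctx.table (k : ℕ) (o : Ctx) (x : Input) :
    List (State k × List (Fin (k + 1) → ℚ)) :=
  (Input.coords x).foldl (fun L ic => o.treat (Input.grid k x) (Input.ratio x) ic L)
    [(State.init k, [])]

noncomputable def Ctx.best (k : ℕ) (o : Ctx) (x : Input) : List (Fin (k + 1) → ℚ) :=
  ((minimizers (fun e => e.1.cost) (o.table k x)).headD (State.init k, [])).2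

/-- The algorithm. -/
noncomputable def Ctx.solve (k : ℕ) (o : Ctx) (x : Input) : Fin (k + 1) → List ℚ :=
  fun j => (separate (Input.least k x) (o.best k x)).map fun g => g j

/-! ### The grid -/

theorem powersUpTo_length (δ : ℚ) (J : ℕ) : (powersUpTo δ J).length = J + 1 := by
  induction J with
  | zero => rfl
  | succ J ih => simp [powersUpTo, ih]

theorem mem_powersUpTo {δ : ℚ} {J : ℕ} {y : ℚ} :
    y ∈ powersUpTo δ J ↔ ∃ j ≤ J, y = ((1 + δ) ^ j)⁻¹ := by
  induction J with
  | zero => simp [powersUpTo]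
  | succ J ih =>
    simp only [powersUpTo, List.mem_cons, ih]
    constructor
    · rintro (h | ⟨j, hj, h⟩)
      · exact ⟨J + 1, le_rfl, h⟩
      · exact ⟨j, by omega, h⟩
    · rintro ⟨j, hj, h⟩
      rcases Nat.lt_or_ge J j with h1 | h1
      · left; rw [h, show j = J + 1 by omega]
      · exact Or.inr ⟨j, h1, h⟩

/-- Bernoulli gives (1 + δ)^B ≥ 2 for B ≥ 1/δ, and a positive rational η is at least 1/den η ≥
2^(-bitLength η). So the grid is linear in 1/δ but only logarithmic in 1/η. -/
theorem exists_pow_inv_le {δ η : ℚ} (hδ : 0 < δ) (hη : 0 < η) {B : ℕ} (hB : δ⁻¹ ≤ B) :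
    ((1 + δ) ^ (B * bitLength η))⁻¹ ≤ η := by
  have h1 : (2 : ℚ) ≤ (1 + δ) ^ B := by
    have := one_add_mul_le_pow (show (-2 : ℚ) ≤ δ by linarith) B
    have h2 : 1 ≤ (B : ℚ) * δ := by
      rw [inv_le_iff_one_le_mul₀ hδ] at hB
      exact hB
    linarith
  have h2 : (η.den : ℚ) ≤ 2 ^ bitLength η := by
    have h3 : η.den < 2 ^ (Nat.size η.den) := Nat.lt_size_self _
    have h4 : 2 ^ (Nat.size η.den) ≤ 2 ^ bitLength η :=
      Nat.pow_le_pow_right (by norm_num) (by unfold bitLength; omega)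
    exact_mod_cast h3.le.trans h4
  have h3 : (η.den : ℚ)⁻¹ ≤ η := by
    conv_rhs => rw [← Rat.num_div_den η]
    rw [inv_eq_one_div]
    gcongr
    exact_mod_cast Rat.num_pos.2 hη
  refine le_trans ?_ h3
  have h5 : (0 : ℚ) < η.den := by exact_mod_cast η.den_pos
  apply inv_anti₀ h5
  rw [pow_mul]
  exact h2.trans (pow_le_pow_left₀ (by norm_num) h1 _)

theorem gridSteps_spec {δ η : ℚ} (hδ : 0 < δ) (hη : 0 < η) :
    ((1 + δ) ^ gridSteps δ η)⁻¹ ≤ η ∧ ∀ j < gridSteps δ η, η < ((1 + δ) ^ j)⁻¹ := by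
  classical
  have h : ∃ J : ℕ, ((1 + δ) ^ J)⁻¹ ≤ η := ⟨_, exists_pow_inv_le hδ hη (Nat.le_ceil _)⟩
  have e : gridSteps δ η = Nat.find h := by
    unfold gridSteps
    rw [dif_pos h]
  rw [e]
  exact ⟨Nat.find_spec h, fun j hj => not_le.1 (Nat.find_min h hj)⟩

theorem gridSteps_le {δ η : ℚ} (hδ : 0 < δ) (hη : 0 < η) {B : ℕ} (hB : δ⁻¹ ≤ B) :
    gridSteps δ η ≤ B * bitLength η := by
  by_contra hlt
  exact absurd (exists_pow_inv_le hδ hη hB) (not_le.2 ((gridSteps_spec hδ hη).2 _ (not_le.1 hlt)))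

/-! ### The algorithm runs in polynomial time -/

namespace PT

variable {α β γ : Type} [Enc α] [Enc β] [Enc γ] {D : Ctx → α → Prop}

theorem roundUp {Γ : Ctx → α → List ℚ} {f : Ctx → α → ℚ} (hΓ : PT D Γ) (hf : PT D f) :
    PT D fun o x => roundUp (Γ o x) (f o x) :=
  (hΓ.filter (f := fun o x g => decide (f o x ≤ g))
    (PT.le (hf.comp PT.id.fst fun _ _ h => h.1) PT.id.snd)).headD (PT.const 1)

theorem minimizers {l : Ctx → α → List β} {key : Ctx → α → β → ℚ} (hl : PT D l)
    (hk : PT (fun o (p : α × β) => D o p.1 ∧ p.2 ∈ l o p.1) fun o p => key o p.1 p.2) :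
    PT D fun o x => minimizers (key o x) (l o x) :=
  hl.filter (f := fun o x e => ((l o x).filter fun e' => decide (key o x e' < key o x e)).isEmpty)
    (PT.isEmpty (PT.filter (f := fun o (p : α × β) e' => decide (key o p.1 e' < key o p.1 p.2))
      (hl.comp PT.id.fst fun _ _ h => h.1)
      (PT.lt (hk.comp (PT.id.fst.fst.pair PT.id.snd) fun _ _ h => ⟨h.1.1, h.2⟩)
        (hk.comp PT.id.fst fun _ _ h => h.1))))

/-- An improper call never returns, so the program tests the arguments first; only the range of the
index has to be known in advance. -/
theorem ask {i : Ctx → α → ℕ} {a b δ : Ctx → α → ℚ} (hi : PT D i) (ha : PT D a) (hb : PT D b)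
    (hδ : PT D δ) (h : ∀ o x, D o x → i o x < o.n) :
    PT D fun o x => o.ask (i o x) (a o x) (b o x) (δ o x) := by
  have h1 : PT (fun o (y : ℕ × ℚ × ℚ × ℚ) => ∃ h : y.1 < o.n, IsQuery y.2.1 y.2.2.1 y.2.2.2)
      fun o y => if h : y.1 < o.n then (o.σ ⟨y.1, h⟩).value y.2.1 y.2.2.1 y.2.2.2 else 0 := by
    refine ⟨.query, fun q => ⟨Polynomial.X + q + q + 1, ?_⟩⟩
    rintro o ho ⟨i, a, b, δ⟩ ⟨hi, hq⟩
    dsimp only at hi hq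
    refine ⟨_, ?_, by
      have := Eval.query (σ := o.σ) ⟨i, hi⟩ a b δ hq
      simpa [hi, enc, Enc.toData] using this⟩
    obtain ⟨h2, h3⟩ := ho ⟨i, hi⟩ a b δ hq
    simp only [Polynomial.eval_add, Polynomial.eval_X, Polynomial.eval_one]
    have h4 : (Data.pair (.num (i : ℚ)) (.pair (.num a) (.pair (.num b) (.num δ)))).size
      = sz (i, a, b, δ) := rfl
    have h5 : bitLength a + bitLength b + bitLength δ ≤ sz (i, a, b, δ) + o.N := by
      simp only [sz_prod, sz_rat]; omega
    have h6 := q.eval_le_eval_of_le h5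
    omega
  have ht : PT D fun o x => (decide (-1 ≤ a o x) && decide (a o x < b o x) && decide (b o x ≤ 1) &&
      decide (0 < δ o x) && decide (δ o x < 1)) :=
    ((((PT.const (-1)).le ha).and (ha.lt hb)).and (hb.le (PT.const 1))).and
      ((PT.const 0).lt hδ) |>.and (hδ.lt (PT.const 1))
  refine (ite ht ((h1.comp ((hi.pair (ha.pair (hb.pair hδ))).mono fun _ _ h => h.1) ?_))
    (PT.const 0)).congr ?_
  · intro o x hx
    refine ⟨h o x hx.1, ?_⟩
    have := hx.2
    simp only [Bool.and_eq_true, decide_eq_true_eq] at this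
    exact ⟨this.1.1.1.1, this.1.1.1.2, this.1.1.2, this.1.2, this.2⟩
  · intro o x hx
    simp only [Ctx.ask, dif_pos (h o x hx)]

/-- The loop divides by 1 + δ until the power is at most η. The polynomial `B` bounds 1/δ and
thereby the number of rounds; the exact powers stay short since their exponents are polynomially
bounded. -/
theorem grid {δ η : Ctx → α → ℚ} (hδ : PT D δ) (hη : PT D η) (B : Polynomial ℕ)
    (h : ∀ o x, D o x → 0 < δ o x ∧ 0 < η o x ∧ (δ o x)⁻¹ ≤ B.eval (sz x + o.N)) :
    PT D fun o x => grid (δ o x) (η o x) := by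
  let step : Ctx → α × ℚ × List ℚ → α × ℚ × List ℚ := fun o s =>
    (s.1, s.2.1 / (1 + δ o s.1), s.2.1 / (1 + δ o s.1) :: s.2.2)
  have hiter : ∀ o x j, (step o)^[j] (x, 1, [1]) =
      (x, ((1 + δ o x) ^ j)⁻¹, powersUpTo (δ o x) j) := by
    intro o x j
    induction j with
    | zero => simp [powersUpTo]
    | succ j ih =>
      rw [Function.iterate_succ_apply', ih]
      simp only [step, powersUpTo]
      rw [pow_succ, mul_inv, div_eq_mul_inv]
  have hloop : PT (fun o (s : α × ℚ × List ℚ) => D o s.1 ∧ s.2 = (1, [1]))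
      (fun o (s : α × ℚ × List ℚ) => (step o)^[gridSteps (δ o s.1) (η o s.1)] s) := by
    have hd : PT (fun o (s : α × ℚ × List ℚ) => D o s.1) fun o s => δ o s.1 :=
      hδ.comp PT.id.fst fun _ _ h => h
    have hy : PT (fun o (s : α × ℚ × List ℚ) => D o s.1) fun o s => s.2.1 / (1 + δ o s.1) :=
      PT.id.snd.fst.div ((PT.const 1).add hd)
    have he : PT (fun o (s : α × ℚ × List ℚ) => D o s.1) fun o s => η o s.1 :=
      hη.comp PT.id.fst fun _ _ h => h
    refine loop (f := step) (he.lt PT.id.snd.fst)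
      ((PT.id.fst.pair (hy.pair (hy.cons PT.id.snd.snd))).mono fun _ _ h => h.1) fun q => ?_
    obtain ⟨pd, hpd⟩ := hδ.sz_le q
    obtain ⟨pe, hpe⟩ := hη.sz_le q
    -- `J` bounds the number of rounds, `S` the length of every power that occurs.
    let J := B * pe
    let S := J * (2 * (pd + 3)) + 5
    refine ⟨J + (Polynomial.X + S + (J + 1) * (S + 1) + 5), fun o ho => ?_⟩
    rintro ⟨x, y, l⟩ ⟨hx, hyl⟩
    dsimp only at hx hyl
    simp only [Prod.mk.injEq] at hyl
    obtain ⟨rfl, rfl⟩ := hyl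
    obtain ⟨h1, h2, h3⟩ := h o x hx
    set s := sz x + o.N with hs
    have hle : s ≤ sz (x, (1 : ℚ), [(1 : ℚ)]) + o.N := by rw [sz_prod]; dsimp only; omega
    have hm : gridSteps (δ o x) (η o x) ≤ J.eval s := by
      refine (gridSteps_le h1 h2 h3).trans ?_
      simp only [J, Polynomial.eval_mul]
      exact Nat.mul_le_mul_left _ (hpe o ho x hx)
    have hpow : ∀ j ≤ J.eval s, bitLength (((1 + δ o x) ^ j)⁻¹) ≤ S.eval s := by
      intro j hj
      have e1 := bitLength_inv_le ((1 + δ o x) ^ j)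
      have e2 := bitLength_pow_le (1 + δ o x) j
      have e3 := bitLength_add_le 1 (δ o x)
      have e4 : bitLength 1 = 3 := by simp [bitLength]
      have e5 : bitLength (δ o x) ≤ pd.eval s := hpd o ho x hx
      have e6 : j * bitLength (1 + δ o x) ≤ J.eval s * (2 * (pd.eval s + 3)) :=
        Nat.mul_le_mul hj (by omega)
      simp only [S, Polynomial.eval_add, Polynomial.eval_mul, Polynomial.eval_ofNat]
      omega
    refine ⟨gridSteps (δ o x) (η o x), ?_, rfl, ?_, ?_, ?_⟩
    · refine hm.trans ((J.eval_le_eval_of_le hle).trans ?_)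
      rw [Polynomial.eval_add]
      omega
    · rw [hiter]
      simpa using (gridSteps_spec h1 h2).1
    · intro j hj
      rw [hiter]
      simpa using (gridSteps_spec h1 h2).2 j hj
    · intro j hj
      rw [hiter]
      refine ⟨hx, ?_⟩
      refine le_trans ?_ (Polynomial.eval_le_eval_of_le _ hle)
      have hj' := hj.trans hm
      have e1 : sz (powersUpTo (δ o x) j) ≤ (J.eval s + 1) * (S.eval s + 1) + 2 := by
        refine (sz_le_of_forall (B := S.eval s) ?_).trans ?_
        · intro y hy
          obtain ⟨i, hi, rfl⟩ := mem_powersUpTo.1 hy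
          exact hpow i (hi.trans hj')
        · rw [powersUpTo_length]
          gcongr
      have e2 := hpow j hj'
      rw [sz_prod, sz_prod, sz_rat]
      simp only [Polynomial.eval_add, Polynomial.eval_mul, Polynomial.eval_one, Polynomial.eval_X,
        Polynomial.eval_ofNat]
      omega
  refine ((hloop.comp (PT.id.pair (PT.const (1, [1]))) fun o x hx => ⟨hx, rfl⟩).snd.snd).congr
    fun o x _ => ?_
  rw [hiter]
  rfl

end PT

end

/-! ### Sizes of the tables in the dynamic program -/

section

variable {k : ℕ}

theorem numbered_append_singleton (l : List ℚ) (c : ℚ) : numbered (l ++ [c]) =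
    ((numbered l).1 + 1, ((numbered l).1, c) :: (numbered l).2) := by
  simp [numbered]

theorem numbered_fst (l : List ℚ) : (numbered l).1 = l.length := by
  induction l using List.reverseRecOn with
  | nil => rfl
  | append_singleton l c ih => simp [numbered_append_singleton, ih]

theorem length_numbered_snd (l : List ℚ) : (numbered l).2.length = l.length := by
  induction l using List.reverseRecOn with
  | nil => rfl
  | append_singleton l c ih => simp [numbered_append_singleton, ih]

theorem mem_numbered_snd {l : List ℚ} {p : ℕ × ℚ} (h : p ∈ (numbered l).2) :
    p.1 < l.length ∧ p.2 ∈ l := by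
  induction l using List.reverseRecOn with
  | nil => simp [numbered] at h
  | append_singleton l c ih =>
    rw [numbered_append_singleton, List.mem_cons] at h
    rcases h with rfl | h
    · simp [numbered_fst]
    · have := ih h
      simp only [List.length_append, List.length_singleton, List.mem_append]
      exact ⟨by omega, Or.inl this.2⟩

theorem numbered_ofFn {n : ℕ} (c : Fin n → ℚ) :
    numbered (List.ofFn c) = (n, (List.ofFn fun i : Fin n => ((i : ℕ), c i)).reverse) := by
  induction n with
  | zero => rfl
  | succ n ih =>
    rw [List.ofFn_succ', List.concat_eq_append, numbered_append_singleton, ih, List.ofFn_succ',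
      List.concat_eq_append]
    simp

/-- The partial solutions that the dynamic program keeps. -/
def Kept (k : ℕ) (Γ : List ℚ) (m : ℕ) (L : List (State k × List (Fin (k + 1) → ℚ))) : Prop :=
  L.length ≤ (allStates k Γ).length + 1 ∧ ∀ e ∈ L, (e.1 = State.init k ∨ e.1 ∈ allStates k Γ) ∧
    e.2.length = m ∧ ∀ g ∈ e.2, g ∈ tuples (k + 1) Γ

theorem length_allStates (k : ℕ) (Γ : List ℚ) : (allStates k Γ).length =
    Γ.length ^ (k + 1) * Γ.length ^ Fintype.card (Finset (Fin (k + 1))) := by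
  rw [allStates, List.length_product, length_tuples, length_tuples]

/-- The initial state contains zeros, so its entries need not lie in Γ; hence the separate
alternative in `Kept`. -/
theorem kept_nil (k : ℕ) (Γ : List ℚ) : Kept k Γ 0 [(State.init k, [])] := by
  refine ⟨by simp, fun e he => ?_⟩
  simp only [List.mem_singleton] at he
  subst he
  simp

/-- At most one entry survives per state, so the length of the table is bounded independently of the
number of coordinates treated. -/
theorem kept_treat {Γ : List ℚ} {m : ℕ} {L : List (State k × List (Fin (k + 1) → ℚ))}
    (h : Kept k Γ m L) (o : Ctx) (δ : ℚ) (ic : ℕ × ℚ) : Kept k Γ (m + 1) (o.treat Γ δ ic L) := by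
  refine ⟨?_, fun e he => ?_⟩
  · unfold Ctx.treat
    rw [List.length_flatMap]
    refine le_trans ?_ (Nat.le_succ _)
    refine (List.sum_le_card_nsmul _ 1 fun y hy => ?_).trans (by simp)
    obtain ⟨s, -, rfl⟩ := List.mem_map.1 hy
    exact List.length_take_le _ _
  · simp only [Ctx.treat, List.mem_flatMap] at he
    obtain ⟨s, hs, he⟩ := he
    have he1 := List.mem_of_mem_take he
    rw [List.mem_filter, decide_eq_true_eq] at he1
    obtain ⟨he1, rfl⟩ := he1
    refine ⟨Or.inr hs, ?_⟩
    simp only [Ctx.extensions, List.mem_map] at he1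
    obtain ⟨⟨e', g⟩, hp, rfl⟩ := he1
    rw [List.mem_product, List.mem_filter] at hp
    obtain ⟨h1, h2, h3⟩ := h.2 _ hp.1
    refine ⟨by simp [h2], ?_⟩
    intro g' hg'
    rcases List.mem_cons.1 hg' with rfl | hg'
    · exact hp.2.1
    · exact h3 _ hg'

theorem kept_foldl (o : Ctx) (Γ : List ℚ) (δ : ℚ) (l : List (ℕ × ℚ)) : Kept k Γ l.length
    (l.foldl (fun L ic => o.treat Γ δ ic L) [(State.init k, [])]) := by
  induction l using List.reverseRecOn with
  | nil => exact kept_nil k Γ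
  | append_singleton l ic ih =>
    rw [List.foldl_append, List.length_append]
    exact kept_treat ih o δ ic

theorem Kept.sz_le {Γ : List ℚ} {m : ℕ} {L : List (State k × List (Fin (k + 1) → ℚ))}
    (h : Kept k Γ m L) : sz L ≤
      (Γ.length ^ (k + 1) * Γ.length ^ Fintype.card (Finset (Fin (k + 1))) + 1) *
        (sz (State.init k) + ((k + 1) * (sz Γ + 1) + 2)
          + (Fintype.card (Finset (Fin (k + 1))) * (sz Γ + 1) + 2)
          + (m * ((k + 1) * (sz Γ + 1) + 3) + 2) + 3) + 2 := by
  refine (sz_le_of_forall (B := (sz (State.init k) + ((k + 1) * (sz Γ + 1) + 2)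
          + (Fintype.card (Finset (Fin (k + 1))) * (sz Γ + 1) + 2)
          + (m * ((k + 1) * (sz Γ + 1) + 3) + 2) + 2)) ?_).trans ?_
  · intro e he
    obtain ⟨h1, h2, h3⟩ := h.2 e he
    have ht : ∀ (r : ℕ), ∀ v ∈ tuples r Γ, sz v ≤ r * (sz Γ + 1) + 2 :=
      fun _ v hv => sz_fin_le fun i => sz_le_of_mem (mem_tuples.1 hv i)
    have h4 : sz e.2 ≤ m * ((k + 1) * (sz Γ + 1) + 3) + 2 := by
      rw [← h2]
      exact sz_le_of_forall (B := (k + 1) * (sz Γ + 1) + 2) fun g hg => ht _ g (h3 g hg)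
    rw [sz_prod]
    rcases h1 with h1 | h1
    · rw [h1]; omega
    · have h5 : e.1.1 ∈ tuples _ Γ ∧ e.1.2 ∈ tuples _ Γ := List.mem_product.1 h1
      rw [sz_prod e.1]
      have := ht _ _ h5.1
      have := ht _ _ h5.2
      omega
  · have := h.1
    rw [length_allStates] at this
    gcongr

/-- The inputs with admissible parameters. -/
def Input.Proper (o : Ctx) (x : Input) : Prop :=
  x.1.length = o.n ∧ 1 ≤ o.n ∧ 0 < x.2.1 ∧ 0 < x.2.2 ∧ x.2.2⁻¹ ≤ o.N

theorem Input.dim_eq (x : Input) : x.dim = x.1.length := numbered_fst _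

theorem Input.mem_coords {x : Input} {p : ℕ × ℚ} (h : p ∈ x.coords) : p.1 < x.1.length := by
  obtain ⟨p', hp', rfl⟩ := List.mem_map.1 h
  exact (mem_numbered_snd hp').1

theorem Input.length_coords (x : Input) : x.coords.length = x.1.length := by
  rw [Input.coords, List.length_map, length_numbered_snd]

/-! ### Polynomial running time of the components of the algorithm -/

namespace PT

variable {α β γ : Type} [Enc α] [Enc β] [Enc γ] {D : Ctx → α → Prop}

theorem covers {i : Ctx → α → ℕ} {g : Ctx → α → Fin (k + 1) → ℚ} {δ : Ctx → α → ℚ} (hδ : PT D δ)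
    (hi : PT D i) (hg : PT D g) (h : ∀ o x, D o x → i o x < o.n) :
    PT D fun o x => o.covers (δ o x) (i o x) (g o x) :=
  (hi.ask (hg.proj 0) (PT.const 1) hδ h).le (PT.const 0)

theorem mass {i : Ctx → α → ℕ} {g : Ctx → α → Fin (k + 1) → ℚ} {δ : Ctx → α → ℚ} (hδ : PT D δ)
    (hi : PT D i) (hg : PT D g) (h : ∀ o x, D o x → i o x < o.n) (T : Finset (Fin (k + 1))) :
    PT D fun o x => o.mass (δ o x) (i o x) (g o x) T :=
  ((PT.const 1).add hδ).mul (hi.ask (foldMax _ (PT.const (-1)) fun j => hg.proj j)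
    (foldMin _ (PT.const 1) fun j => hg.proj j) hδ h)

theorem stateNext {Γ : Ctx → α → List ℚ} {c : Ctx → α → ℚ} {g : Ctx → α → Fin (k + 1) → ℚ}
    {m : Ctx → α → Finset (Fin (k + 1)) → ℚ} {s : Ctx → α → State k} (hΓ : PT D Γ) (hc : PT D c)
    (hg : PT D g) (hm : ∀ T, PT D fun o x => m o x T) (hs : PT D s) :
    PT D fun o x => State.next (Γ o x) (c o x) (g o x) (m o x) (s o x) :=
  (tuple fun j => hΓ.roundUp ((hs.fst.proj j).add (hc.mul (hg.proj j)))).pair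
    (tuple fun _ => hΓ.roundUp (PT.sum _ fun p => (hs.snd.proj (code k p.1)).mul (hm p.2)))

theorem stateCost {s : Ctx → α → State k} (hs : PT D s) : PT D fun o x => (s o x).cost :=
  PT.sum _ fun S => (hs.snd.proj (code k S)).mul
    (foldMin S (hs.fst.proj 0) fun j => hs.fst.proj j)

theorem extensions {Γ : Ctx → α → List ℚ} {δ : Ctx → α → ℚ} {ic : Ctx → α → ℕ × ℚ}
    {L : Ctx → α → List (State k × List (Fin (k + 1) → ℚ))} (hΓ : PT D Γ) (hδ : PT D δ)
    (hic : PT D ic) (hL : PT D L) (h : ∀ o x, D o x → (ic o x).1 < o.n) :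
    PT D fun o x => o.extensions (Γ o x) (δ o x) (ic o x) (L o x) := by
  have h1 : PT D fun o x => (ParetoCover.tuples (k + 1) (Γ o x)).filter (o.covers (δ o x) (ic o x).1) :=
    PT.filter (f := fun o x => o.covers (δ o x) (ic o x).1) (hΓ.tuples (k + 1))
      (covers (hδ.comp PT.id.fst fun _ _ h => h.1) (hic.fst.comp PT.id.fst fun _ _ h => h.1)
        PT.id.snd fun o p hp => h o p.1 hp.1)
  have h2 : PT (fun o (q : α × (State k × List (Fin (k + 1) → ℚ)) × (Fin (k + 1) → ℚ)) =>
      D o q.1 ∧ q.2 ∈ L o q.1 ×ˢ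
        (ParetoCover.tuples (k + 1) (Γ o q.1)).filter (o.covers (δ o q.1) (ic o q.1).1))
      fun o q => State.next (Γ o q.1) (ic o q.1).2 q.2.2
        (o.mass (δ o q.1) (ic o q.1).1 q.2.2) q.2.1.1 :=
    stateNext (hΓ.comp PT.id.fst fun _ _ h => h.1)
      (hic.snd.comp PT.id.fst fun _ _ h => h.1) PT.id.snd.snd
      (fun T => mass (hδ.comp PT.id.fst fun _ _ h => h.1)
        (hic.fst.comp PT.id.fst fun _ _ h => h.1) PT.id.snd.snd (fun o p hp => h o p.1 hp.1) T)
      PT.id.snd.fst.fst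
  have h3 : PT D fun o x => L o x ×ˢ
      (ParetoCover.tuples (k + 1) (Γ o x)).filter (o.covers (δ o x) (ic o x).1) := hL.product h1
  exact PT.map (f := fun o x (p : (State k × List (Fin (k + 1) → ℚ)) × (Fin (k + 1) → ℚ)) =>
    (State.next (Γ o x) (ic o x).2 p.2 (o.mass (δ o x) (ic o x).1 p.2) p.1.1, p.2 :: p.1.2)) h3
    (PT.pair h2 (PT.cons PT.id.snd.snd PT.id.snd.fst.snd))

theorem stateEq {s t : Ctx → α → State k} (hs : PT D s) (ht : PT D t) :
    PT D fun o x => decide (s o x = t o x) :=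
  ((hs.fst.tupleEq ht.fst).and (hs.snd.tupleEq ht.snd)).congr fun o x _ => by
    rw [Bool.eq_iff_iff]; simp [Prod.ext_iff]

theorem treat {Γ : Ctx → α → List ℚ} {δ : Ctx → α → ℚ} {ic : Ctx → α → ℕ × ℚ}
    {L : Ctx → α → List (State k × List (Fin (k + 1) → ℚ))} (hΓ : PT D Γ) (hδ : PT D δ)
    (hic : PT D ic) (hL : PT D L) (h : ∀ o x, D o x → (ic o x).1 < o.n) :
    PT D fun o x => o.treat (Γ o x) (δ o x) (ic o x) (L o x) := by
  refine PT.flatMap (f := fun o x s => ((o.extensions (Γ o x) (δ o x) (ic o x) (L o x)).filter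
    fun e => decide (e.1 = s)).take 1) ((hΓ.tuples _).product (hΓ.tuples _)) (takeOne ?_)
  exact PT.filter (f := fun _ (p : α × State k) (e : State k × List (Fin (k + 1) → ℚ)) =>
    decide (e.1 = p.2)) ((extensions hΓ hδ hic hL h).comp PT.id.fst fun _ _ h => h.1)
    (stateEq PT.id.snd.fst PT.id.fst.snd)

theorem numbered {l : Ctx → α → List ℚ} (hl : PT D l) : PT D fun o x => numbered (l o x) := by
  refine foldl (a := fun _ _ => ((0, []) : ℕ × List (ℕ × ℚ)))
    (f := fun _ _ s c => (s.1 + 1, (s.1, c) :: s.2)) hl (PT.const _)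
    (PT.id.snd.fst.fst.succ.pair ((PT.id.snd.fst.fst.pair PT.id.snd.snd).cons PT.id.snd.fst.snd))
    fun q => ?_
  obtain ⟨p, hp⟩ := hl.sz_le q
  refine ⟨p + 2 + (p * (p + p + 4) + 2) + 1, fun o ho x hx l₁ l₂ h => ?_⟩
  have h0 := hp o ho x hx
  have e2 : 2 ≤ sz l₂ := by rw [sz_eq_sum]; omega
  have h2 := sz_append l₁ l₂
  rw [← h] at h2
  have h3 := length_le_sz l₁
  change sz (ParetoCover.numbered l₁) ≤ _
  simp only [Polynomial.eval_add, Polynomial.eval_mul, Polynomial.eval_one, Polynomial.eval_ofNat]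
  set P := p.eval (sz x + o.N)
  have h4 : sz (ParetoCover.numbered l₁).2 ≤ P * (P + P + 4) + 2 := by
    refine (sz_le_of_forall (B := P + P + 3) fun y hy => ?_).trans ?_
    · obtain ⟨h5, h6⟩ := mem_numbered_snd hy
      have h7 := sz_nat_le y.1
      have h8 := sz_le_of_mem h6
      rw [sz_prod]
      omega
    · rw [length_numbered_snd]
      gcongr
      omega
  have h5 := sz_nat_le (ParetoCover.numbered l₁).1
  have h6 := numbered_fst l₁
  rw [sz_prod]
  omega

theorem dim {x : Ctx → α → Input} (hx : PT D x) : PT D fun o y => (x o y).dim :=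
  hx.fst.numbered.fst

theorem neg {f : Ctx → α → ℚ} (hf : PT D f) : PT D fun o x => -f o x :=
  ((PT.const 0).sub hf).congr fun _ _ _ => by simp

theorem maxCost {x : Ctx → α → Input} (hx : PT D x) : PT D fun o y => (x o y).maxCost :=
  (hx.fst.minimizers (key := fun _ _ c => -c) (neg PT.id.snd)).headD (PT.const 0)

theorem ratio {x : Ctx → α → Input} (hx : PT D x) : PT D fun o y => (x o y).ratio :=
  hx.snd.snd.div ((PT.const 40).mul hx.dim.natCast)

theorem least (k : ℕ) {x : Ctx → α → Input} (hx : PT D x) : PT D fun o y => (x o y).least k :=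
  (hx.snd.fst.mul hx.snd.snd).div
    ((PT.const (16 * 2 ^ (k + 1))).mul (hx.dim.natCast.mul hx.dim.natCast))

/-- Since 1/δ = 40n/γ, the length of the grid is governed by 1/γ itself and not by its encoding
length. This is the only place where `N` ≥ 1/γ is used. -/
theorem inputGrid (k : ℕ) : PT Input.Proper fun _ x => x.grid k := by
  refine grid (ratio PT.id) (least k PT.id) (40 * Polynomial.X * Polynomial.X) ?_
  rintro o x ⟨h1, h2, h3, h4, h5⟩
  have hn : (1 : ℚ) ≤ (x.dim : ℚ) := by
    rw [Input.dim_eq, h1]; exact_mod_cast h2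
  refine ⟨?_, ?_, ?_⟩
  · unfold Input.ratio; positivity
  · unfold Input.least; positivity
  · have h6 : x.dim ≤ sz x := by
      rw [Input.dim_eq, sz_prod]
      have := length_le_sz x.1
      omega
    have h7 : (x.dim : ℚ) ≤ (sz x : ℚ) + o.N := by
      have : (x.dim : ℚ) ≤ sz x := by exact_mod_cast h6
      have : (0 : ℚ) ≤ o.N := by positivity
      linarith
    have h8 : x.2.2⁻¹ ≤ (sz x : ℚ) + o.N := by
      have : (0 : ℚ) ≤ sz x := by positivity
      linarith
    simp only [Input.ratio, inv_div, Polynomial.eval_mul, Polynomial.eval_X, Polynomial.eval_ofNat]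
    push_cast
    rw [div_eq_mul_inv]
    gcongr

theorem coords {x : Ctx → α → Input} (hx : PT D x) : PT D fun o y => (x o y).coords :=
  PT.map (f := fun o y (p : ℕ × ℚ) => (p.1, p.2 / (((x o y).dim : ℚ) * (x o y).maxCost)))
    hx.fst.numbered.snd (PT.id.snd.fst.pair (PT.id.snd.snd.div
      ((hx.dim.natCast.mul hx.maxCost).comp PT.id.fst fun _ _ h => h.1)))

/-- All intermediate tables satisfy `Kept`, which supplies the size bound that a fold requires. -/
theorem table (k : ℕ) : PT Input.Proper fun o x => o.table k x := by
  refine foldl (f := fun o (x : Input) L ic => o.treat (x.grid k) x.ratio ic L) (coords PT.id)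
    (PT.const [(State.init k, [])]) (treat ((inputGrid k).comp PT.id.fst fun _ _ h => h.1)
      (PT.id.fst.ratio) PT.id.snd.snd PT.id.snd.fst ?_) fun q => ?_
  · rintro o ⟨x, L, ic⟩ ⟨h1, l₁, l₂, h2, -⟩
    dsimp only at h2 h1 ⊢
    rw [← h1.1]
    exact Input.mem_coords (by rw [h2]; simp)
  · obtain ⟨p, hp⟩ := (inputGrid k).sz_le q
    refine ⟨(p ^ (k + 1) * p ^ Fintype.card (Finset (Fin (k + 1))) + 1) *
        (Polynomial.C (sz (State.init k)) + (Polynomial.C (k + 1) * (p + 1) + 2)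
          + (Polynomial.C (Fintype.card (Finset (Fin (k + 1)))) * (p + 1) + 2)
          + (Polynomial.X * (Polynomial.C (k + 1) * (p + 1) + 3) + 2) + 3) + 2,
      fun o ho x hx l₁ l₂ h => ?_⟩
    refine (kept_foldl o (x.grid k) x.ratio l₁).sz_le.trans ?_
    have h1 := hp o ho x hx
    have h2 := length_le_sz (x.grid k)
    have h3 : l₁.length ≤ sz x + o.N := by
      have e := x.length_coords
      rw [h, List.length_append] at e
      have := length_le_sz x.1
      rw [sz_prod]
      omega
    simp only [Polynomial.eval_add, Polynomial.eval_mul, Polynomial.eval_one, Polynomial.eval_X,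
      Polynomial.eval_ofNat, Polynomial.eval_pow, Polynomial.eval_C]
    have h4 := h2.trans h1
    gcongr

theorem best (k : ℕ) : PT Input.Proper fun o x => o.best k x := by
  have h : PT (fun o (p : Input × State k × List (Fin (k + 1) → ℚ)) =>
      Input.Proper o p.1 ∧ p.2 ∈ o.table k p.1) fun _ p => p.2.1.cost := stateCost PT.id.snd.fst
  have h2 : PT Input.Proper fun o x =>
      ParetoCover.minimizers (fun e => e.1.cost) (o.table k x) :=
    PT.minimizers (key := fun _ _ (e : State k × List (Fin (k + 1) → ℚ)) => e.1.cost) (table k) h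
  exact PT.snd (PT.headD h2 (PT.const (State.init k, [])))

theorem coincide {h : Ctx → α → List (Fin (k + 1) → ℚ)} (hh : PT D h) (i j : Fin (k + 1)) :
    PT D fun o x => coincide (h o x) i j :=
  isEmpty (PT.filter (f := fun _ _ g => !decide (g i = g j)) hh
    (PT.not ((PT.id.snd.proj i).eq (PT.id.snd.proj j))))

theorem redundant {h : Ctx → α → List (Fin (k + 1) → ℚ)} (hh : PT D h) (j : Fin (k + 1)) :
    PT D fun o x => redundant (h o x) j :=
  (PT.not (PT.all (Finset.Iio j) fun i => (hh.coincide i j).not)).congr fun o x _ => by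
    unfold ParetoCover.redundant
    congr

theorem separate {η : Ctx → α → ℚ} {h : Ctx → α → List (Fin (k + 1) → ℚ)} (hη : PT D η)
    (hh : PT D h) : PT D fun o x => separate (η o x) (h o x) :=
  PT.cons (tuple fun j => ite' (hh.redundant j) (hη.mul (PT.const _))
    ((hh.headD (PT.const 0)).proj j)) hh.tail

theorem solve (k : ℕ) : PT Input.Proper fun o x => o.solve k x :=
  tuple (f := fun o x => o.solve k x) fun j =>
    PT.map (f := fun _ _ (g : Fin (k + 1) → ℚ) => g j) ((least k PT.id).separate (best k))
    (PT.id.snd.proj j)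

end PT

end

section

variable {k : ℕ}

/-! ### Rounding -/

theorem one_mem_powersUpTo (δ : ℚ) (J : ℕ) : (1 : ℚ) ∈ powersUpTo δ J :=
  mem_powersUpTo.2 ⟨0, Nat.zero_le _, by simp⟩

theorem roundUp_mem {Γ : List ℚ} (h : (1 : ℚ) ∈ Γ) (x : ℚ) : roundUp Γ x ∈ Γ := by
  unfold roundUp
  cases hf : Γ.filter fun g => decide (x ≤ g) with
  | nil => exact h
  | cons a l =>
    have : a ∈ Γ.filter fun g => decide (x ≤ g) := by rw [hf]; exact List.mem_cons_self
    exact (List.mem_filter.1 this).1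

/-- The default value 1 caps the rounding. This is harmless for upper bounds of quantities that are
at most 1, such as probabilities and scaled costs. -/
theorem min_le_roundUp (Γ : List ℚ) (x : ℚ) : min x 1 ≤ roundUp Γ x := by
  unfold roundUp
  cases hf : Γ.filter fun g => decide (x ≤ g) with
  | nil => exact min_le_right _ _
  | cons a l =>
    have : a ∈ Γ.filter fun g => decide (x ≤ g) := by rw [hf]; exact List.mem_cons_self
    exact (min_le_left _ _).trans (by simpa using (List.mem_filter.1 this).2)

/-- If x exceeds the smallest power, that power can be dropped, and the next one is 1 + δ times as
large, hence at most (1 + δ)x. Otherwise x is rounded to the smallest power. -/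
theorem roundUp_powersUpTo_le {δ : ℚ} (hδ : 0 < δ) (J : ℕ) (x : ℚ) :
    roundUp (powersUpTo δ J) x ≤ max ((1 + δ) ^ J)⁻¹ ((1 + δ) * x) := by
  induction J with
  | zero =>
    refine le_trans ?_ (le_max_left _ _)
    simp only [pow_zero, inv_one]
    by_cases h : x ≤ 1 <;> simp [roundUp, powersUpTo, h]
  | succ J ih =>
    by_cases h : x ≤ ((1 + δ) ^ (J + 1))⁻¹
    · refine le_trans (le_of_eq ?_) (le_max_left _ _)
      simp only [roundUp, powersUpTo]
      rw [List.filter_cons_of_pos (by simpa using h)]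
      rfl
    · have e : roundUp (powersUpTo δ (J + 1)) x = roundUp (powersUpTo δ J) x := by
        simp only [roundUp, powersUpTo]
        rw [List.filter_cons_of_neg (by simpa using h)]
      rw [e]
      refine ih.trans (max_le ?_ (le_max_right _ _))
      refine le_trans ?_ (le_max_right _ _)
      have h1 : (1 + δ) * ((1 + δ) ^ (J + 1))⁻¹ = ((1 + δ) ^ J)⁻¹ := by
        rw [pow_succ]; field_simp
      rw [← h1]
      exact mul_le_mul_of_nonneg_left (not_le.1 h).le (by positivity)

theorem one_mem_grid (δ η : ℚ) : (1 : ℚ) ∈ grid δ η := one_mem_powersUpTo _ _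

theorem pos_of_mem_grid {δ η y : ℚ} (hδ : 0 < δ) (h : y ∈ grid δ η) : 0 < y := by
  obtain ⟨j, -, rfl⟩ := mem_powersUpTo.1 h
  positivity

theorem le_one_of_mem_grid {δ η y : ℚ} (hδ : 0 < δ) (h : y ∈ grid δ η) : y ≤ 1 := by
  obtain ⟨j, -, rfl⟩ := mem_powersUpTo.1 h
  exact inv_le_one_of_one_le₀ (one_le_pow₀ (by linarith))

/-- The number of steps is minimal, so every power but the last exceeds η. This leaves room below
η/2 for the entries that separate coinciding points. -/
theorem lt_mul_of_mem_grid {δ η y : ℚ} (hδ : 0 < δ) (hη : 0 < η) (hη1 : η < 1) (h : y ∈ grid δ η) :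
    η < (1 + δ) * y := by
  obtain ⟨j, hj, rfl⟩ := mem_powersUpTo.1 h
  obtain ⟨-, h2⟩ := gridSteps_spec hδ hη
  cases j with
  | zero => simp; linarith
  | succ j =>
    have h1 : (1 + δ) * ((1 + δ) ^ (j + 1))⁻¹ = ((1 + δ) ^ j)⁻¹ := by
      rw [pow_succ]; field_simp
    rw [h1]
    exact h2 j (by omega)

theorem roundUp_grid_le {δ η x : ℚ} (hδ : 0 < δ) (hη : 0 < η) (hx : 0 ≤ x) :
    roundUp (grid δ η) x ≤ (1 + δ) * x + η := by
  refine (roundUp_powersUpTo_le hδ _ x).trans (max_le ?_ ?_)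
  · have := (gridSteps_spec hδ hη).1
    have : 0 ≤ (1 + δ) * x := by positivity
    linarith
  · linarith

/-! ### The dynamic program -/

/-- The state after treating coordinates with the given costs, entries of the points, and
estimates for the distributions. -/
noncomputable def State.run (Γ : List ℚ)
    (l : List (ℚ × (Fin (k + 1) → ℚ) × (Finset (Fin (k + 1)) → ℚ))) : State k :=
  l.foldr (fun it s => State.next Γ it.1 it.2.1 it.2.2 s) (State.init k)

/-- The points whose entries are given by `h` form a partial solution. -/
def IsPartial (o : Ctx) (Γ : List ℚ) (δ : ℚ) (l : List (ℕ × ℚ)) (h : List (Fin (k + 1) → ℚ)) :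
    Prop :=
  List.Forall₂ (fun ic g => g ∈ tuples (k + 1) Γ ∧ o.covers δ ic.1 g = true) l h

/-- The data that determine the state of a partial solution. -/
def Ctx.items (o : Ctx) (δ : ℚ) (l : List (ℕ × ℚ)) (h : List (Fin (k + 1) → ℚ)) :
    List (ℚ × (Fin (k + 1) → ℚ) × (Finset (Fin (k + 1)) → ℚ)) :=
  List.zipWith (fun ic g => (ic.2, g, o.mass δ ic.1 g)) l h

theorem State.next_mem_allStates {Γ : List ℚ} (h : (1 : ℚ) ∈ Γ) (c : ℚ) (g : Fin (k + 1) → ℚ)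
    (m : Finset (Fin (k + 1)) → ℚ) (s : State k) : State.next Γ c g m s ∈ allStates k Γ :=
  List.mem_product.2 ⟨mem_tuples.2 fun _ => roundUp_mem h _, mem_tuples.2 fun _ => roundUp_mem h _⟩

theorem mem_extensions {o : Ctx} {Γ : List ℚ} {δ : ℚ} {ic : ℕ × ℚ}
    {L : List (State k × List (Fin (k + 1) → ℚ))} {e : State k × List (Fin (k + 1) → ℚ)} :
    e ∈ o.extensions Γ δ ic L ↔ ∃ e' ∈ L, ∃ g ∈ tuples (k + 1) Γ, o.covers δ ic.1 g = true ∧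
      e = (State.next Γ ic.2 g (o.mass δ ic.1 g) e'.1, g :: e'.2) := by
  simp only [Ctx.extensions, List.mem_map]
  constructor
  · rintro ⟨⟨e', g⟩, hp, rfl⟩
    rw [List.mem_product, List.mem_filter] at hp
    exact ⟨e', hp.1, g, hp.2.1, hp.2.2, rfl⟩
  · rintro ⟨e', he', g, hg, hc, rfl⟩
    exact ⟨(e', g), List.mem_product.2 ⟨he', List.mem_filter.2 ⟨hg, hc⟩⟩, rfl⟩

theorem mem_extensions_of_mem_treat {o : Ctx} {Γ : List ℚ} {δ : ℚ} {ic : ℕ × ℚ}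
    {L : List (State k × List (Fin (k + 1) → ℚ))} {e : State k × List (Fin (k + 1) → ℚ)}
    (h : e ∈ o.treat Γ δ ic L) : e ∈ o.extensions Γ δ ic L := by
  simp only [Ctx.treat, List.mem_flatMap] at h
  obtain ⟨s, -, he⟩ := h
  exact (List.mem_filter.1 (List.mem_of_mem_take he)).1

theorem exists_mem_treat {o : Ctx} {Γ : List ℚ} {δ : ℚ} {ic : ℕ × ℚ}
    {L : List (State k × List (Fin (k + 1) → ℚ))} {e : State k × List (Fin (k + 1) → ℚ)}
    (h : e ∈ o.extensions Γ δ ic L) (hs : e.1 ∈ allStates k Γ) :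
    ∃ e' ∈ o.treat Γ δ ic L, e'.1 = e.1 := by
  have hf : e ∈ (o.extensions Γ δ ic L).filter fun e' => decide (e'.1 = e.1) :=
    List.mem_filter.2 ⟨h, by simp⟩
  cases hc : (o.extensions Γ δ ic L).filter fun e' => decide (e'.1 = e.1) with
  | nil => rw [hc] at hf; simp at hf
  | cons a l =>
    have ha : a ∈ (o.extensions Γ δ ic L).filter fun e' => decide (e'.1 = e.1) := by
      rw [hc]; exact List.mem_cons_self
    refine ⟨a, ?_, by simpa using (List.mem_filter.1 ha).2⟩
    simp only [Ctx.treat, List.mem_flatMap]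
    exact ⟨e.1, hs, by rw [hc]; simp⟩

theorem foldr_treat_sound {o : Ctx} {Γ : List ℚ} {δ : ℚ} (l : List (ℕ × ℚ))
    {e : State k × List (Fin (k + 1) → ℚ)}
    (he : e ∈ l.foldr (fun ic L => o.treat Γ δ ic L) [(State.init k, [])]) :
    IsPartial o Γ δ l e.2 ∧ e.1 = State.run Γ (o.items δ l e.2) := by
  induction l generalizing e with
  | nil =>
    simp only [List.foldr_nil, List.mem_singleton] at he
    subst he
    exact ⟨List.Forall₂.nil, rfl⟩
  | cons ic l ih =>
    obtain ⟨e', he', g, hg, hc, rfl⟩ := mem_extensions.1 (mem_extensions_of_mem_treat he)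
    obtain ⟨h1, h2⟩ := ih he'
    refine ⟨List.Forall₂.cons ⟨hg, hc⟩ h1, ?_⟩
    simp only [Ctx.items, List.zipWith_cons_cons, State.run, List.foldr_cons]
    rw [h2]
    rfl

/-- A new state depends only on the previous state and the entries chosen for the new coordinate. A
history can therefore be replaced by the representative kept for its state without affecting any
later state. -/
theorem foldr_treat_complete {o : Ctx} {Γ : List ℚ} (hΓ : (1 : ℚ) ∈ Γ) {δ : ℚ} {l : List (ℕ × ℚ)}
    {h : List (Fin (k + 1) → ℚ)} (hp : IsPartial o Γ δ l h) :
    ∃ e ∈ l.foldr (fun ic L => o.treat Γ δ ic L) [(State.init k, [])],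
      e.1 = State.run Γ (o.items δ l h) := by
  induction hp with
  | nil => exact ⟨_, List.mem_singleton_self _, rfl⟩
  | @cons ic g l h hg hp ih =>
    obtain ⟨e, he, hs⟩ := ih
    obtain ⟨e', he', hs'⟩ := exists_mem_treat
      (mem_extensions.2 ⟨e, he, g, hg.1, hg.2, rfl⟩) (State.next_mem_allStates hΓ _ _ _ _)
    refine ⟨e', he', ?_⟩
    rw [hs']
    simp only [Ctx.items, List.zipWith_cons_cons, State.run, List.foldr_cons]
    rw [hs]
    rfl

/-! ### Minimizers -/

theorem minimizers_ne_nil {β : Type} (key : β → ℚ) {l : List β} (h : l ≠ []) :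
    minimizers key l ≠ [] := by
  classical
  obtain ⟨e, he, hmin⟩ := l.toFinset.exists_min_image key (List.toFinset_nonempty_iff _ |>.2 h)
  refine List.ne_nil_of_mem (a := e) ?_
  simp only [List.mem_toFinset] at he hmin
  simp only [minimizers, List.mem_filter, List.isEmpty_iff, List.filter_eq_nil_iff,
    decide_eq_true_eq, not_lt]
  exact ⟨he, hmin⟩

theorem minimizers_spec {β : Type} {key : β → ℚ} {l : List β} {e : β}
    (h : e ∈ minimizers key l) : e ∈ l ∧ ∀ e' ∈ l, key e ≤ key e' := by
  simp only [minimizers, List.mem_filter, List.isEmpty_iff, List.filter_eq_nil_iff,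
    decide_eq_true_eq, not_lt] at h
  exact h

theorem minimizers_headD_spec {β : Type} (key : β → ℚ) {l : List β} (h : l ≠ []) (d : β) :
    (minimizers key l).headD d ∈ l ∧ ∀ e' ∈ l, key ((minimizers key l).headD d) ≤ key e' := by
  cases hm : minimizers key l with
  | nil => exact absurd hm (minimizers_ne_nil key h)
  | cons a t =>
    have : a ∈ minimizers key l := by rw [hm]; exact List.mem_cons_self
    exact minimizers_spec this

/-! ### Points made distinct -/

theorem coincide_iff {h : List (Fin (k + 1) → ℚ)} {i j : Fin (k + 1)} :
    coincide h i j = true ↔ ∀ g ∈ h, g i = g j := by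
  simp [coincide, List.filter_eq_nil_iff]

theorem redundant_iff {h : List (Fin (k + 1) → ℚ)} {j : Fin (k + 1)} :
    redundant h j = true ↔ ∃ i < j, ∀ g ∈ h, g i = g j := by
  simp [redundant, coincide_iff]

end

section

variable {k : ℕ}

/-! ### Accuracy of the estimates -/

/-- The smallest of the values at `0` and at the elements of `S`. -/
noncomputable def minOf (S : Finset (Fin (k + 1))) (f : Fin (k + 1) → ℝ) : ℝ := S.fold min (f 0) f

theorem le_minOf_iff {S : Finset (Fin (k + 1))} {f : Fin (k + 1) → ℝ} {y : ℝ} :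
    y ≤ minOf S f ↔ y ≤ f 0 ∧ ∀ j ∈ S, y ≤ f j := Finset.le_fold_min _

theorem minOf_le_iff {S : Finset (Fin (k + 1))} {f : Fin (k + 1) → ℝ} {y : ℝ} :
    minOf S f ≤ y ↔ f 0 ≤ y ∨ ∃ j ∈ S, f j ≤ y := Finset.fold_min_le _

theorem minOf_mono {S : Finset (Fin (k + 1))} {f g : Fin (k + 1) → ℝ} (h : ∀ j, f j ≤ g j) :
    minOf S f ≤ minOf S g := by
  rcases minOf_le_iff.1 (le_refl (minOf S g)) with h1 | ⟨j, hj, h1⟩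
  · exact minOf_le_iff.2 (Or.inl ((h 0).trans h1))
  · exact minOf_le_iff.2 (Or.inr ⟨j, hj, (h j).trans h1⟩)

theorem minOf_affine (S : Finset (Fin (k + 1))) (f : Fin (k + 1) → ℝ) {a : ℝ} (ha : 0 ≤ a)
    (b : ℝ) : minOf S (fun j => a * (f j + b)) = a * (minOf S f + b) := by
  apply le_antisymm
  · rcases minOf_le_iff.1 (le_refl (minOf S f)) with h1 | ⟨j, hj, h1⟩
    · exact minOf_le_iff.2 (Or.inl (by gcongr))
    · exact minOf_le_iff.2 (Or.inr ⟨j, hj, by gcongr⟩)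
  · have h := le_minOf_iff.1 (le_refl (minOf S f))
    refine le_minOf_iff.2 ⟨?_, fun j hj => ?_⟩
    · have := h.1; gcongr
    · have := h.2 j hj; gcongr

theorem cast_fold_min (S : Finset (Fin (k + 1))) (a : ℚ) (f : Fin (k + 1) → ℚ) :
    ((S.fold min a f : ℚ) : ℝ) = S.fold min (a : ℝ) fun j => (f j : ℝ) := by
  induction S using Finset.induction_on with
  | empty => simp
  | insert i s hi ih => rw [Finset.fold_insert hi, Finset.fold_insert hi, ← ih, Rat.cast_min]

/-- The distribution of the intersection of independent random sets with given distributions. -/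
noncomputable def interDist :
    List (Finset (Fin (k + 1)) → ℝ) → Finset (Fin (k + 1)) → ℝ
  | [], R => if R = Finset.univ then 1 else 0
  | m :: l, R => ∑ p : Finset (Fin (k + 1)) × Finset (Fin (k + 1)) with p.1 ∩ p.2 = R,
      interDist l p.1 * m p.2

theorem sum_sum_inter (F : Finset (Fin (k + 1)) × Finset (Fin (k + 1)) → ℝ) :
    ∑ R, ∑ p : Finset (Fin (k + 1)) × Finset (Fin (k + 1)) with p.1 ∩ p.2 = R, F p
      = ∑ S, ∑ T, F (S, T) := by
  rw [Finset.sum_fiberwise, ← Finset.univ_product_univ, Finset.sum_product]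

/-- Costs, entries of the points and estimates for the distributions, together with the true
distributions. -/
abbrev Item (k : ℕ) := (ℚ × (Fin (k + 1) → ℚ) × (Finset (Fin (k + 1)) → ℚ)) ×
  (Finset (Fin (k + 1)) → ℝ)

/-- The estimates are upper bounds, up to a factor `(1 + δ) ^ 2`. -/
structure Item.Accurate (δ : ℚ) (it : Item k) : Prop where
  cost_nonneg : 0 ≤ it.1.1
  entry_nonneg : ∀ j, 0 ≤ it.1.2.1 j
  nonneg : ∀ T, 0 ≤ it.2 T
  sum_eq_one : ∑ T, it.2 T = 1
  le_estimate : ∀ T, it.2 T ≤ it.1.2.2 T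
  estimate_le : ∀ T, (it.1.2.2 T : ℝ) ≤ (1 + δ) ^ 2 * it.2 T

/-- The list `Γ` is fine enough for rounding up with a relative error `δ` and an additional
absolute error `η`. -/
structure IsFine (Γ : List ℚ) (δ η : ℚ) : Prop where
  le_error : ∀ x, 0 ≤ x → roundUp Γ x ≤ (1 + δ) * x + η

theorem isFine_grid {δ η : ℚ} (hδ : 0 < δ) (hη : 0 < η) : IsFine (grid δ η) δ η :=
  ⟨fun _ hx => roundUp_grid_le hδ hη hx⟩

theorem roundUp_nonneg (Γ : List ℚ) {x : ℚ} (hx : 0 ≤ x) : 0 ≤ roundUp Γ x :=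
  (le_min hx zero_le_one).trans (min_le_roundUp Γ x)

theorem le_roundUp_of_le (Γ : List ℚ) {x : ℚ} {y : ℝ} (h : y ≤ x) (h1 : y ≤ 1) :
    y ≤ roundUp Γ x := by
  have h2 : ((min x 1 : ℚ) : ℝ) ≤ roundUp Γ x := by exact_mod_cast min_le_roundUp Γ x
  refine le_trans ?_ h2
  rw [Rat.cast_min]
  exact le_min h (by simpa using h1)

/-- The true costs of the points. -/
noncomputable def pointCost (l : List (Item k)) (j : Fin (k + 1)) : ℝ :=
  (l.map fun it => (it.1.1 : ℝ) * it.1.2.1 j).sum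

/-- The true expected cost. -/
noncomputable def trueCost (l : List (Item k)) : ℝ :=
  ∑ S, interDist (l.map Prod.snd) S * minOf S (pointCost l)

/-! ### Comparison of the rounded states with the exact costs and distributions -/

section

variable {Γ : List ℚ} {δ η : ℚ} {l : List (Item k)}

theorem pointCost_nonneg (hl : ∀ it ∈ l, it.Accurate δ) (j : Fin (k + 1)) : 0 ≤ pointCost l j := by
  refine List.sum_nonneg fun y hy => ?_
  obtain ⟨it, hit, rfl⟩ := List.mem_map.1 hy
  have h1 := (hl it hit).cost_nonneg
  have h2 := (hl it hit).entry_nonneg j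
  exact mul_nonneg (by exact_mod_cast h1) (by exact_mod_cast h2)

theorem pointCost_cons (it : Item k) (l : List (Item k)) (j : Fin (k + 1)) :
    pointCost (it :: l) j = it.1.1 * it.1.2.1 j + pointCost l j := by
  simp [pointCost]

theorem run_fst_nonneg (hl : ∀ it ∈ l, it.Accurate δ) (j : Fin (k + 1)) :
    0 ≤ (State.run Γ (l.map Prod.fst)).1 j := by
  induction l with
  | nil => exact le_rfl
  | cons it l ih =>
    have h1 := hl it List.mem_cons_self
    exact roundUp_nonneg _ (add_nonneg (ih fun it' h => hl it' (List.mem_cons_of_mem _ h))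
      (mul_nonneg h1.cost_nonneg (h1.entry_nonneg j)))

theorem pointCost_le_run (hl : ∀ it ∈ l, it.Accurate δ) (j : Fin (k + 1))
    (h1 : pointCost l j ≤ 1) : pointCost l j ≤ (State.run Γ (l.map Prod.fst)).1 j := by
  induction l with
  | nil => simp [pointCost, State.run, State.init]
  | cons it l ih =>
    have h2 := hl it List.mem_cons_self
    have h3 : (0 : ℝ) ≤ it.1.1 * it.1.2.1 j :=
      mul_nonneg (by exact_mod_cast h2.cost_nonneg) (by exact_mod_cast h2.entry_nonneg j)
    refine le_roundUp_of_le Γ ?_ h1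
    rw [pointCost_cons] at h1 ⊢
    have h4 := ih (fun it' h => hl it' (List.mem_cons_of_mem _ h)) (by linarith)
    push_cast
    have e : (List.foldr (fun it s => State.next Γ it.1 it.2.1 it.2.2 s) (State.init k)
      (l.map Prod.fst)) = State.run Γ (l.map Prod.fst) := rfl
    rw [e]
    linarith

/-- Each coordinate contributes one factor 1 + δ and one η; factors ≥ 1 may be applied to all
summands. -/
theorem run_fst_le (hδ : 0 ≤ δ) (hη : 0 ≤ η) (hΓ : IsFine Γ δ η) (hl : ∀ it ∈ l, it.Accurate δ)
    (j : Fin (k + 1)) : ((State.run Γ (l.map Prod.fst)).1 j : ℝ) ≤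
      (1 + δ) ^ l.length * (pointCost l j + l.length * η) := by
  induction l with
  | nil => simp [pointCost, State.run, State.init]
  | cons it l ih =>
    have hl' : ∀ it ∈ l, Item.Accurate δ it := fun it' h => hl it' (List.mem_cons_of_mem _ h)
    have h2 := hl it List.mem_cons_self
    have hδ' : (0 : ℝ) ≤ δ := by exact_mod_cast hδ
    have hη' : (0 : ℝ) ≤ η := by exact_mod_cast hη
    have h3 : (0 : ℝ) ≤ it.1.1 * it.1.2.1 j :=
      mul_nonneg (by exact_mod_cast h2.cost_nonneg) (by exact_mod_cast h2.entry_nonneg j)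
    have h4 : ((State.run Γ ((it :: l).map Prod.fst)).1 j : ℝ) ≤
        (1 + δ) * ((State.run Γ (l.map Prod.fst)).1 j + it.1.1 * it.1.2.1 j) + η := by
      have := hΓ.le_error _ (add_nonneg (run_fst_nonneg (Γ := Γ) hl' j)
        (mul_nonneg h2.cost_nonneg (h2.entry_nonneg j)))
      exact_mod_cast this
    have h5 := ih hl'
    refine h4.trans ?_
    rw [pointCost_cons, List.length_cons]
    have hp : (1 : ℝ) ≤ (1 + δ) ^ l.length := one_le_pow₀ (by linarith)
    have hp' : (1 : ℝ) ≤ (1 + δ) ^ (l.length + 1) := one_le_pow₀ (by linarith)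
    have h6 : (1 + (δ : ℝ)) * ((State.run Γ (l.map Prod.fst)).1 j + it.1.1 * it.1.2.1 j) ≤
        (1 + δ) * ((1 + δ) ^ l.length * (pointCost l j + l.length * η)
          + (1 + δ) ^ l.length * (it.1.1 * it.1.2.1 j)) := by
      rw [mul_add, mul_add]
      exact add_le_add (mul_le_mul_of_nonneg_left h5 (by linarith))
        (mul_le_mul_of_nonneg_left (le_mul_of_one_le_left h3 hp) (by linarith))
    have h7 : (η : ℝ) ≤ (1 + δ) ^ (l.length + 1) * η := le_mul_of_one_le_left hη' hp'
    push_cast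
    rw [pow_succ] at h7 ⊢
    linarith

theorem interDist_nonneg (hl : ∀ it ∈ l, it.Accurate δ) (R : Finset (Fin (k + 1))) :
    0 ≤ interDist (l.map Prod.snd) R := by
  induction l generalizing R with
  | nil => simp only [List.map_nil, interDist]; split_ifs <;> norm_num
  | cons it l ih =>
    exact Finset.sum_nonneg fun p _ => mul_nonneg
      (ih (fun it' h => hl it' (List.mem_cons_of_mem _ h)) _) ((hl it List.mem_cons_self).nonneg _)

theorem sum_interDist (hl : ∀ it ∈ l, it.Accurate δ) :
    ∑ R, interDist (l.map Prod.snd) R = 1 := by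
  induction l with
  | nil => simp [interDist]
  | cons it l ih =>
    simp only [List.map_cons, interDist]
    rw [sum_sum_inter fun p => interDist (l.map Prod.snd) p.1 * it.2 p.2]
    simp only [← Finset.mul_sum, (hl it List.mem_cons_self).sum_eq_one, mul_one]
    exact ih fun it' h => hl it' (List.mem_cons_of_mem _ h)

theorem interDist_le_one (hl : ∀ it ∈ l, it.Accurate δ) (R : Finset (Fin (k + 1))) :
    interDist (l.map Prod.snd) R ≤ 1 := by
  rw [← sum_interDist hl]
  exact Finset.single_le_sum (fun R _ => interDist_nonneg hl R) (Finset.mem_univ R)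

theorem interDist_le_run (hl : ∀ it ∈ l, it.Accurate δ) (R : Finset (Fin (k + 1))) :
    interDist (l.map Prod.snd) R ≤ (State.run Γ (l.map Prod.fst)).2 (code k R) := by
  induction l generalizing R with
  | nil => by_cases h : R = Finset.univ <;> simp [interDist, State.run, State.init, h]
  | cons it l ih =>
    have hl' : ∀ it ∈ l, Item.Accurate δ it := fun it' h => hl it' (List.mem_cons_of_mem _ h)
    have h2 := hl it List.mem_cons_self
    refine le_roundUp_of_le Γ ?_ (interDist_le_one hl R)
    simp only [List.map_cons, interDist]
    push_cast
    rw [Equiv.symm_apply_apply]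
    refine Finset.sum_le_sum fun p _ => ?_
    have h3 := ih hl' p.1
    have h4 := interDist_nonneg hl' p.1
    exact mul_le_mul h3 (h2.le_estimate p.2) (h2.nonneg _) (h4.trans h3)

/-- The additive error `e` is transported like a distribution: intersecting with a random set of
true law `it.2` preserves total mass, so each coordinate adds just one η for each of the 2^(k+1)
sets. Of the three factors 1 + δ per coordinate, one comes from rounding and two from the estimates.
-/
theorem run_snd_le (hδ : 0 ≤ δ) (hη : 0 ≤ η) (hΓ : IsFine Γ δ η) (hl : ∀ it ∈ l, it.Accurate δ) :
    ∃ e : Finset (Fin (k + 1)) → ℝ, (∀ S, 0 ≤ e S) ∧ ∑ S, e S = l.length * 2 ^ (k + 1) * η ∧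
      ∀ S, ((State.run Γ (l.map Prod.fst)).2 (code k S) : ℝ) ≤
        (1 + δ) ^ (3 * l.length) * (interDist (l.map Prod.snd) S + e S) := by
  induction l with
  | nil => exact ⟨fun _ => 0, fun _ => le_rfl, by simp, fun S => by
      by_cases h : S = Finset.univ <;> simp [interDist, State.run, State.init, h]⟩
  | cons it l ih =>
    have hl' : ∀ it ∈ l, Item.Accurate δ it := fun it' h => hl it' (List.mem_cons_of_mem _ h)
    have h2 := hl it List.mem_cons_self
    have hδ' : (0 : ℝ) ≤ δ := by exact_mod_cast hδ
    have hη' : (0 : ℝ) ≤ η := by exact_mod_cast hη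
    obtain ⟨e, he0, hes, he⟩ := ih hl'
    refine ⟨fun R => (∑ p : Finset (Fin (k + 1)) × Finset (Fin (k + 1)) with p.1 ∩ p.2 = R,
      e p.1 * it.2 p.2) + η, fun R => ?_, ?_, fun R => ?_⟩
    · exact add_nonneg (Finset.sum_nonneg fun p _ => mul_nonneg (he0 _) (h2.nonneg _)) hη'
    · rw [Finset.sum_add_distrib, sum_sum_inter fun p => e p.1 * it.2 p.2]
      simp only [← Finset.mul_sum, h2.sum_eq_one, mul_one, hes]
      simp
      ring
    · set A : ℝ := (1 + δ) ^ (3 * l.length) with hA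
      have hA1 : 1 ≤ A := one_le_pow₀ (by linarith)
      have hm0 : ∀ T, (0 : ℝ) ≤ it.1.2.2 T := fun T => (h2.nonneg T).trans (h2.le_estimate T)
      have hs0 : ∀ S, (0 : ℝ) ≤ (State.run Γ (l.map Prod.fst)).2 (code k S) := fun S =>
        (interDist_nonneg hl' S).trans (interDist_le_run hl' S)
      have h4 : ((State.run Γ ((it :: l).map Prod.fst)).2 (code k R) : ℝ) ≤
          (1 + δ) * (∑ p : Finset (Fin (k + 1)) × Finset (Fin (k + 1)) with p.1 ∩ p.2 = R,
            ((State.run Γ (l.map Prod.fst)).2 (code k p.1) : ℝ) * it.1.2.2 p.2) + η := by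
        have := hΓ.le_error (∑ p : Finset (Fin (k + 1)) × Finset (Fin (k + 1)) with
          p.1 ∩ p.2 = (code k).symm (code k R),
            (State.run Γ (l.map Prod.fst)).2 (code k p.1) * it.1.2.2 p.2)
          (Finset.sum_nonneg fun p _ => mul_nonneg (by exact_mod_cast hs0 p.1)
            (by exact_mod_cast hm0 p.2))
        have h5 : (State.run Γ ((it :: l).map Prod.fst)).2 (code k R) ≤ _ := this
        rw [Equiv.symm_apply_apply] at h5
        exact_mod_cast h5
      have h5 : (∑ p : Finset (Fin (k + 1)) × Finset (Fin (k + 1)) with p.1 ∩ p.2 = R,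
            ((State.run Γ (l.map Prod.fst)).2 (code k p.1) : ℝ) * it.1.2.2 p.2) ≤
          ∑ p : Finset (Fin (k + 1)) × Finset (Fin (k + 1)) with p.1 ∩ p.2 = R,
            A * (1 + δ) ^ 2 * ((interDist (l.map Prod.snd) p.1 + e p.1) * it.2 p.2) := by
        refine Finset.sum_le_sum fun p _ => ?_
        refine (mul_le_mul (he p.1) (h2.estimate_le p.2) (hm0 _) ?_).trans (le_of_eq (by ring))
        exact mul_nonneg (by linarith) (add_nonneg (interDist_nonneg hl' _) (he0 _))
      rw [← Finset.mul_sum] at h5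
      have e3 : (1 + (δ : ℝ)) ^ (3 * (it :: l).length) = A * (1 + δ) ^ 2 * (1 + δ) := by
        rw [List.length_cons, hA]; ring
      have h7 : (η : ℝ) ≤ A * (1 + δ) ^ 2 * (1 + δ) * η := by
        refine le_mul_of_one_le_left hη' ?_
        rw [← e3]
        exact one_le_pow₀ (by linarith)
      refine h4.trans ?_
      rw [e3]
      have h8 := mul_le_mul_of_nonneg_left h5 (show (0 : ℝ) ≤ 1 + δ by linarith)
      simp only [add_mul _ _ (it.2 _), Finset.sum_add_distrib] at h8
      simp only [List.map_cons, interDist]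
      linarith

theorem cast_cost (s : State k) : (s.cost : ℝ) =
    ∑ S, (s.2 (code k S) : ℝ) * minOf S fun j => (s.1 j : ℝ) := by
  simp only [State.cost, Rat.cast_sum, Rat.cast_mul, cast_fold_min, minOf]

theorem minOf_nonneg {S : Finset (Fin (k + 1))} {f : Fin (k + 1) → ℝ} (h : ∀ j, 0 ≤ f j) :
    0 ≤ minOf S f := le_minOf_iff.2 ⟨h 0, fun j _ => h j⟩

theorem trueCost_le_cost (hl : ∀ it ∈ l, it.Accurate δ) (h1 : ∀ j, pointCost l j ≤ 1) :
    trueCost l ≤ (State.run Γ (l.map Prod.fst)).cost := by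
  rw [cast_cost]
  refine Finset.sum_le_sum fun S _ => ?_
  exact mul_le_mul (interDist_le_run hl S) (minOf_mono fun j => pointCost_le_run hl j (h1 j))
    (minOf_nonneg (pointCost_nonneg hl)) ((interDist_nonneg hl S).trans (interDist_le_run hl S))

/-- Let n be the number of coordinates. Three factors for the probabilities and one for the costs
give the exponent 4n. In ∑ (P + e)(M + nη), the mass 1 of P contributes nη to the error, and M + nη
≤ 2 lets `e` contribute at most 2n · 2^(k+1) · η. -/
theorem cost_le_trueCost (hδ : 0 ≤ δ) (hη : 0 ≤ η) (hΓ : IsFine Γ δ η)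
    (hl : ∀ it ∈ l, it.Accurate δ) (h1 : ∀ j, pointCost l j ≤ 1) (hη1 : l.length * η ≤ 1) :
    ((State.run Γ (l.map Prod.fst)).cost : ℝ) ≤
      (1 + δ) ^ (4 * l.length) * (trueCost l + 3 * l.length * 2 ^ (k + 1) * η) := by
  have hδ' : (0 : ℝ) ≤ δ := by exact_mod_cast hδ
  have hη' : (0 : ℝ) ≤ η := by exact_mod_cast hη
  have hη1' : (l.length : ℝ) * η ≤ 1 := by exact_mod_cast hη1
  obtain ⟨e, he0, hes, he⟩ := run_snd_le hδ hη hΓ hl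
  have hC : ∀ S, (minOf S fun j => ((State.run Γ (l.map Prod.fst)).1 j : ℝ)) ≤
      (1 + δ) ^ l.length * (minOf S (pointCost l) + l.length * η) := fun S => by
    rw [← minOf_affine _ _ (by positivity)]
    exact minOf_mono fun j => run_fst_le hδ hη hΓ hl j
  have hM1 : ∀ S, minOf S (pointCost l) ≤ 1 := fun S => minOf_le_iff.2 (Or.inl (h1 0))
  have hM0 : ∀ S, 0 ≤ minOf S (pointCost l) := fun S => minOf_nonneg (pointCost_nonneg hl)
  rw [cast_cost]
  calc _ ≤ ∑ S, ((1 + (δ : ℝ)) ^ (3 * l.length) * (interDist (l.map Prod.snd) S + e S)) *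
        ((1 + δ) ^ l.length * (minOf S (pointCost l) + l.length * η)) := by
        refine Finset.sum_le_sum fun S _ => mul_le_mul (he S) (hC S) ?_ ?_
        · exact minOf_nonneg fun j => by exact_mod_cast run_fst_nonneg hl j
        · exact mul_nonneg (by positivity) (add_nonneg (interDist_nonneg hl S) (he0 S))
    _ = (1 + δ) ^ (4 * l.length) * ∑ S, (interDist (l.map Prod.snd) S + e S) *
        (minOf S (pointCost l) + l.length * η) := by
        rw [Finset.mul_sum]
        refine Finset.sum_congr rfl fun S _ => ?_
        rw [show 4 * l.length = 3 * l.length + l.length by ring, pow_add]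
        ring
    _ ≤ _ := by
        refine mul_le_mul_of_nonneg_left ?_ (by positivity)
        calc _ ≤ ∑ S, (interDist (l.map Prod.snd) S * minOf S (pointCost l) +
              interDist (l.map Prod.snd) S * (l.length * η) + e S * 2) := by
              refine Finset.sum_le_sum fun S _ => ?_
              have := mul_le_mul_of_nonneg_left
                (show minOf S (pointCost l) + l.length * η ≤ 2 by linarith [hM1 S]) (he0 S)
              linarith
          _ = trueCost l + l.length * η + 2 * (l.length * 2 ^ (k + 1) * η) := by
              rw [Finset.sum_add_distrib, Finset.sum_add_distrib, ← Finset.sum_mul,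
                ← Finset.sum_mul, sum_interDist hl, hes, trueCost]
              ring
          _ ≤ _ := by
              have h3 : (l.length : ℝ) * η ≤ l.length * η * 2 ^ (k + 1) :=
                le_mul_of_one_le_right (by positivity) (one_le_pow₀ (by norm_num))
              linarith

end

end

section

variable {k n : ℕ}

/-! ### Expected costs -/

/-- The points whose entry in the coordinate number `i` covers `x`. -/
noncomputable def coverSet (b : Fin (k + 1) → Fin n → unitInterval) (i : Fin n)
    (x : unitInterval) : Finset (Fin (k + 1)) := {j | x ≤ b j i}

/-- The distribution of the set of points that cover the coordinate number `i`. -/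
noncomputable def coverDist (μ : Fin n → Measure unitInterval)
    (b : Fin (k + 1) → Fin n → unitInterval) (i : Fin n) (T : Finset (Fin (k + 1))) : ℝ :=
  (μ i).real {x | coverSet b i x = T}

/-- The cost of the point `v`. -/
noncomputable def linearCost (c : Fin n → ℚ) (v : Fin n → unitInterval) : ℝ :=
  ∑ i, (c i : ℝ) * (v i : ℝ)

theorem linearCost_nonneg {c : Fin n → ℚ} (hc : ∀ i, 0 ≤ c i) (v : Fin n → unitInterval) :
    0 ≤ linearCost c v :=
  Finset.sum_nonneg fun i _ => mul_nonneg (by exact_mod_cast hc i) (v i).2.1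

/-- The law of an intersection of independent sets. The induction splits off the set T₀ of the first
coordinate and applies the hypothesis to S ↦ f (S ∩ T₀), so f has to vary. -/
theorem sum_prod_eq_sum_interDist (m : Fin n → Finset (Fin (k + 1)) → ℝ)
    (f : Finset (Fin (k + 1)) → ℝ) :
    ∑ T : Fin n → Finset (Fin (k + 1)), (∏ i, m i (T i)) * f {j | ∀ i, j ∈ T i}
      = ∑ R, interDist (List.ofFn m) R * f R := by
  induction n generalizing f with
  | zero => simp [interDist]
  | succ n ih =>
    have h1 : ∀ T₀ : Finset (Fin (k + 1)), ∑ T : Fin n → Finset (Fin (k + 1)),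
        (∏ i, m i.succ (T i)) * f (({j | ∀ i, j ∈ T i} : Finset (Fin (k + 1))) ∩ T₀) =
        ∑ S, interDist (List.ofFn fun i => m i.succ) S * f (S ∩ T₀) := fun T₀ =>
      ih (fun i => m i.succ) fun S => f (S ∩ T₀)
    rw [← (Fin.consEquiv fun _ : Fin (n + 1) => Finset (Fin (k + 1))).sum_comp,
      Fintype.sum_prod_type]
    simp only [Fin.consEquiv_apply, Fin.prod_univ_succ, Fin.cons_zero, Fin.cons_succ,
      Fin.forall_fin_succ]
    have h2 : ∀ (T₀ : Finset (Fin (k + 1))) (T : Fin n → Finset (Fin (k + 1))),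
        ({j | j ∈ T₀ ∧ ∀ i, j ∈ T i} : Finset (Fin (k + 1))) =
          ({j | ∀ i, j ∈ T i} : Finset (Fin (k + 1))) ∩ T₀ := by
      intro T₀ T
      ext j
      simp [and_comm]
    simp only [h2, mul_assoc, ← Finset.mul_sum, h1]
    rw [List.ofFn_succ]
    simp only [interDist, Finset.sum_mul]
    have h3 := sum_sum_inter fun p : Finset (Fin (k + 1)) × Finset (Fin (k + 1)) =>
      interDist (List.ofFn fun i => m i.succ) p.1 * m 0 p.2 * f (p.1 ∩ p.2)
    calc _ = ∑ S, ∑ T, interDist (List.ofFn fun i => m i.succ) S * m 0 T * f (S ∩ T) := by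
          rw [Finset.sum_comm]
          refine Finset.sum_congr rfl fun T _ => ?_
          rw [Finset.mul_sum]
          exact Finset.sum_congr rfl fun S _ => by ring
      _ = _ := h3.symm
      _ = _ := by
          refine Finset.sum_congr rfl fun R _ => Finset.sum_congr rfl fun p hp => ?_
          rw [(Finset.mem_filter.1 hp).2]

theorem measurableSet_coverSet_eq (b : Fin (k + 1) → Fin n → unitInterval) (i : Fin n)
    (T : Finset (Fin (k + 1))) : MeasurableSet {x | coverSet b i x = T} := by
  have e : {x | coverSet b i x = T} = ⋂ j, {x | x ≤ b j i ↔ j ∈ T} := by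
    ext x
    simp [coverSet, Finset.ext_iff]
  rw [e]
  exact MeasurableSet.iInter fun j => (measurableSet_Iic (a := b j i)).iff (MeasurableSet.const _)

theorem coverDist_nonneg (μ : Fin n → Measure unitInterval)
    (b : Fin (k + 1) → Fin n → unitInterval) (i : Fin n) (T : Finset (Fin (k + 1))) :
    0 ≤ coverDist μ b i T := measureReal_nonneg

variable (μ : Fin n → Measure unitInterval) [∀ i, IsProbabilityMeasure (μ i)]

/-- The integrand depends on x only through the cover sets of the coordinates, and their joint law
is the product of the pushforwards. On this finite space the integral is a finite sum. -/
theorem lintegral_coverSet (b : Fin (k + 1) → Fin n → unitInterval)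
    (f : Finset (Fin (k + 1)) → ℝ) (hf : ∀ S, 0 ≤ f S) :
    ∫⁻ x, ENNReal.ofReal (f {j | ∀ i, x i ≤ b j i}) ∂(Measure.pi μ) =
      ENNReal.ofReal (∑ R, interDist (List.ofFn (coverDist μ b)) R * f R) := by
  let _ : MeasurableSpace (Finset (Fin (k + 1))) := ⊤
  have hm : ∀ i, Measurable (coverSet b i) := fun i =>
    measurable_to_countable' fun T => measurableSet_coverSet_eq b i T
  have : ∀ i, IsProbabilityMeasure (Measure.map (coverSet b i) (μ i)) := fun i =>
    Measure.isProbabilityMeasure_map (hm i).aemeasurable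
  have hτ : Measurable fun (x : Fin n → unitInterval) i => coverSet b i (x i) :=
    measurable_pi_lambda _ fun i => (hm i).comp (measurable_pi_apply i)
  have e : ∀ x : Fin n → unitInterval, ({j | ∀ i, x i ≤ b j i} : Finset (Fin (k + 1))) =
      ({j | ∀ i, j ∈ coverSet b i (x i)} : Finset (Fin (k + 1))) := by
    intro x
    simp [coverSet]
  simp only [e]
  rw [← lintegral_map (μ := Measure.pi μ)
    (f := fun T : Fin n → Finset (Fin (k + 1)) => ENNReal.ofReal (f {j | ∀ i, j ∈ T i}))
    (measurable_of_countable _) hτ, Measure.pi_map_pi fun i => (hm i).aemeasurable,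
    lintegral_fintype, ← sum_prod_eq_sum_interDist, ENNReal.ofReal_sum_of_nonneg]
  · refine Finset.sum_congr rfl fun T _ => ?_
    rw [Measure.pi_singleton, mul_comm, ENNReal.ofReal_mul
      (Finset.prod_nonneg fun i _ => coverDist_nonneg μ b i _),
      ENNReal.ofReal_prod_of_nonneg fun i _ => coverDist_nonneg μ b i _]
    congr 1
    refine Finset.prod_congr rfl fun i _ => ?_
    rw [Measure.map_apply (hm i) (measurableSet_singleton _), coverDist, ofReal_measureReal]
    rfl
  · exact fun T _ => mul_nonneg (Finset.prod_nonneg fun i _ => coverDist_nonneg μ b i _) (hf _)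

/-- Because point 0 covers x, the value at 0 that `minOf` always includes does not alter the
minimum. -/
theorem coverCost_eq {c : Fin n → ℚ} {B : Finset (Fin n → unitInterval)}
    {b : Fin (k + 1) → Fin n → unitInterval} (hB : ∀ v, v ∈ B ↔ ∃ j, b j = v)
    {x : Fin n → unitInterval} (hx : x ≤ b 0) :
    coverCost c B x = ENNReal.ofReal (minOf {j | ∀ i, x i ≤ b j i} fun j => linearCost c (b j)) := by
  apply le_antisymm
  · rcases minOf_le_iff.1 (le_refl (minOf {j | ∀ i, x i ≤ b j i} fun j => linearCost c (b j)))
      with h | ⟨j, hj, h⟩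
    · exact (iInf₂_le_of_le (b 0) ((hB _).2 ⟨0, rfl⟩) (iInf_le_of_le hx le_rfl)).trans
        (ENNReal.ofReal_le_ofReal h)
    · exact (iInf₂_le_of_le (b j) ((hB _).2 ⟨j, rfl⟩)
        (iInf_le_of_le (Finset.mem_filter.1 hj).2 le_rfl)).trans (ENNReal.ofReal_le_ofReal h)
  · refine le_iInf₂ fun v hv => le_iInf fun hxv => ENNReal.ofReal_le_ofReal ?_
    obtain ⟨j, rfl⟩ := (hB v).1 hv
    exact minOf_le_iff.2 (Or.inr ⟨j, Finset.mem_filter.2 ⟨Finset.mem_univ _, hxv⟩, le_rfl⟩)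

theorem ae_le_of_forall {v : Fin n → unitInterval} (h : ∀ i, μ i {x | v i < x} = 0) :
    ∀ᵐ x ∂(Measure.pi μ), x ≤ v := by
  simp only [Pi.le_def]
  refine Filter.eventually_all.2 fun i => ?_
  have h1 : ∀ᵐ y ∂(μ i), y ≤ v i := by
    rw [ae_iff]
    simpa using h i
  exact (measurePreserving_eval μ i).quasiMeasurePreserving.ae h1

theorem expectedCost_eq {c : Fin n → ℚ} (hc : ∀ i, 0 ≤ c i) {B : Finset (Fin n → unitInterval)}
    {b : Fin (k + 1) → Fin n → unitInterval} (hB : ∀ v, v ∈ B ↔ ∃ j, b j = v)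
    (h : ∀ i, μ i {x | b 0 i < x} = 0) :
    expectedCost (Measure.pi μ) c B = ENNReal.ofReal (∑ R,
      interDist (List.ofFn (coverDist μ b)) R * minOf R fun j => linearCost c (b j)) := by
  rw [← lintegral_coverSet μ b (fun R => minOf R fun j => linearCost c (b j))
    fun S => minOf_nonneg fun j => linearCost_nonneg hc _]
  refine lintegral_congr_ae ?_
  filter_upwards [ae_le_of_forall μ h] with x hx
  exact coverCost_eq hB hx

theorem isParetoCover_of_mem {B : Finset (Fin n → unitInterval)} {v : Fin n → unitInterval}
    (hv : v ∈ B) (h : ∀ i, μ i {x | v i < x} = 0) : IsParetoCover (Measure.pi μ) B := by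
  unfold IsParetoCover
  rw [← measure_univ (μ := Measure.pi μ)]
  refine measure_congr ?_
  filter_upwards [ae_le_of_forall μ h] with x hx
  exact propext ⟨fun _ => trivial, fun _ => ⟨v, hv, hx⟩⟩

/-- Otherwise every v ∈ B leaves positive mass above itself in some coordinate i v. In coordinate i
v the box ∏ A l lies strictly above v, so no point of B covers anything in it, although it is not
null. -/
theorem exists_mem_of_isParetoCover {B : Finset (Fin n → unitInterval)}
    (hB : IsParetoCover (Measure.pi μ) B) : ∃ v ∈ B, ∀ i, μ i {x | v i < x} = 0 := by
  classical
  by_contra! hne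
  obtain ⟨x, v, hv, -⟩ : {x : Fin n → unitInterval | ∃ b ∈ B, x ≤ b}.Nonempty :=
    nonempty_of_measure_ne_zero (by rw [hB]; exact one_ne_zero)
  have : Nonempty (Fin n) := ⟨(hne v hv).choose⟩
  choose! i hi using hne
  -- `A l` is everything if no point is assigned to l; otherwise it contains all that lies above the
  -- largest l-th entry of the assigned points, which is not null by the choice of `i`.
  let A : Fin n → Set unitInterval := fun l => {x | ∀ v ∈ B, i v = l → v l < x}
  have hA : ∀ l, μ l (A l) ≠ 0 := by
    intro l
    rcases (B.filter fun v => i v = l).eq_empty_or_nonempty with he | hne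
    · have : A l = Set.univ := by
        ext x
        simp only [A, Set.mem_ofPred_eq, Set.mem_univ, iff_true]
        intro v hv hl
        have : v ∈ B.filter fun v => i v = l := Finset.mem_filter.2 ⟨hv, hl⟩
        rw [he] at this
        simp at this
      rw [this]
      simp
    · obtain ⟨w, hw, hmax⟩ := (B.filter fun v => i v = l).exists_max_image (fun v => v l) hne
      obtain ⟨hwB, rfl⟩ := Finset.mem_filter.1 hw
      refine fun h0 => hi w hwB (measure_mono_null ?_ h0)
      intro x hx v hv hl
      exact (hmax v (Finset.mem_filter.2 ⟨hv, hl⟩)).trans_lt hx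
  have hsub : Set.univ.pi A ⊆ {x | ∃ b ∈ B, x ≤ b}ᶜ := by
    rintro x hx ⟨v, hv, hxv⟩
    exact absurd (hx (i v) (Set.mem_univ _) v hv rfl) (not_lt.2 (hxv (i v)))
  have hmeas : MeasurableSet {x : Fin n → unitInterval | ∃ b ∈ B, x ≤ b} := by
    have e : {x : Fin n → unitInterval | ∃ b ∈ B, x ≤ b} = ⋃ b ∈ B, Set.Iic b := by
      ext x; simp
    rw [e]
    refine B.measurableSet_biUnion fun b _ => ?_
    rw [← Set.pi_univ_Iic]
    exact MeasurableSet.univ_pi fun i => measurableSet_Iic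
  have h0 : Measure.pi μ {x | ∃ b ∈ B, x ≤ b}ᶜ = 0 := (prob_compl_eq_zero_iff hmeas).2 hB
  have h1 := measure_mono_null hsub h0
  rw [Measure.pi_pi, Finset.prod_eq_zero_iff] at h1
  obtain ⟨l, -, hl⟩ := h1
  exact hA l hl

/-- Any v that covers x costs at least as much as x itself, since c ≥ 0. Integration gives a bound
that holds for all B. -/
theorem le_expectedCost {c : Fin n → ℚ} (hc : ∀ i, 0 ≤ c i) {α : ℝ}
    (hα : ∀ i, α ≤ ∫ x : unitInterval, (x : ℝ) ∂(μ i)) (B : Finset (Fin n → unitInterval)) :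
    ENNReal.ofReal (α * ∑ i, (c i : ℝ)) ≤ expectedCost (Measure.pi μ) c B := by
  have hint : ∀ i, Integrable (fun x : Fin n → unitInterval => ((x i : unitInterval) : ℝ))
      (Measure.pi μ) := fun i =>
    Integrable.of_bound ((measurable_subtype_coe.comp (measurable_pi_apply i)).aestronglyMeasurable)
      1 (Filter.Eventually.of_forall fun x => by
        rw [Real.norm_of_nonneg (x i).2.1]; exact (x i).2.2)
  have h1 : α * ∑ i, (c i : ℝ) ≤ ∫ x, linearCost c x ∂(Measure.pi μ) := by
    unfold linearCost
    rw [integral_finsetSum _ fun i _ => (hint i).const_mul _, Finset.mul_sum]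
    refine Finset.sum_le_sum fun i _ => ?_
    rw [integral_const_mul, integral_comp_eval (μ := μ) (i := i)
      (f := fun x : unitInterval => (x : ℝ)) measurable_subtype_coe.aestronglyMeasurable, mul_comm]
    exact mul_le_mul_of_nonneg_left (hα i) (by exact_mod_cast hc i)
  refine (ENNReal.ofReal_le_ofReal h1).trans ?_
  have h2 : Integrable (linearCost c) (Measure.pi μ) :=
    integrable_finsetSum _ fun i _ => (hint i).const_mul _
  rw [ofReal_integral_eq_lintegral_ofReal h2
    (Filter.Eventually.of_forall fun x => linearCost_nonneg hc x)]
  refine lintegral_mono fun x => le_iInf₂ fun v _ => le_iInf fun hxv => ENNReal.ofReal_le_ofReal ?_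
  exact Finset.sum_le_sum fun i _ => mul_le_mul_of_nonneg_left (hxv i) (by exact_mod_cast hc i)

/-- The point w that replaces v covers everything below v. Where B' covers nothing the right-hand
side is infinite, as a > 0. -/
theorem expectedCost_le_of_forall {c : Fin n → ℚ} {B B' : Finset (Fin n → unitInterval)} {a e : ℝ}
    (ha : 0 < a)
    (h : ∀ v ∈ B', ∃ w ∈ B, v ≤ w ∧ linearCost c w ≤ a * linearCost c v + e) :
    expectedCost (Measure.pi μ) c B ≤
      ENNReal.ofReal a * expectedCost (Measure.pi μ) c B' + ENNReal.ofReal e := by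
  have h1 : ∀ x, coverCost c B x ≤ ENNReal.ofReal a * coverCost c B' x + ENNReal.ofReal e := by
    intro x
    unfold coverCost
    simp only [ENNReal.mul_iInf_of_ne (ENNReal.ofReal_pos.2 ha).ne' ENNReal.ofReal_ne_top,
      ENNReal.iInf_add]
    refine le_iInf₂ fun v hv => le_iInf fun hxv => ?_
    obtain ⟨w, hw, hvw, hle⟩ := h v hv
    refine (iInf₂_le_of_le w hw (iInf_le_of_le (hxv.trans hvw) le_rfl)).trans ?_
    have h2 : ENNReal.ofReal (linearCost c w) ≤ ENNReal.ofReal (a * linearCost c v + e) :=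
      ENNReal.ofReal_le_ofReal hle
    refine h2.trans (ENNReal.ofReal_add_le.trans ?_)
    rw [ENNReal.ofReal_mul ha.le]
    rfl
  refine (lintegral_mono h1).trans ?_
  rw [lintegral_add_right _ measurable_const, lintegral_const_mul' _ _ ENNReal.ofReal_ne_top]
  simp [expectedCost]

end

section

variable {k n : ℕ}

/-! ### Separation of the points -/

theorem redundant_ofFn_iff {g : Fin n → Fin (k + 1) → ℚ} {j : Fin (k + 1)} :
    redundant (List.ofFn g) j = true ↔ ∃ l < j, ∀ i, g i l = g i j := by
  rw [redundant_iff]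
  simp [List.mem_ofFn']

/-- A redundant point gets a new first entry η(j + 1)/(2(k + 2)). These entries differ for different
j, and as j ≤ k they lie below η/2, hence below all entries of g. The earliest copy of each point is
kept, so no point is lost. -/
theorem exists_separate_eq (hn : 1 ≤ n) (g : Fin n → Fin (k + 1) → ℚ) {η : ℚ} (hη : 0 < η)
    (hη1 : η ≤ 1) (hg : ∀ i j, η / 2 < g i j) (hg1 : ∀ i j, g i j ≤ 1) :
    ∃ g' : Fin n → Fin (k + 1) → ℚ, separate η (List.ofFn g) = List.ofFn g' ∧
      (∀ i j, 0 ≤ g' i j ∧ g' i j ≤ 1) ∧ (∀ j l, (∀ i, g' i j = g' i l) → j = l) ∧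
      ∀ j, ∃ l, ∀ i, g' i l = g i j := by
  obtain ⟨m, rfl⟩ : ∃ m, n = m + 1 := ⟨n - 1, by omega⟩
  let fresh : Fin (k + 1) → ℚ := fun j => η * (((j : ℕ) + 1 : ℚ) / (2 * (k + 2)))
  let g₀ : Fin (k + 1) → ℚ := fun j =>
    if redundant (List.ofFn g) j = true then fresh j else g 0 j
  let g' : Fin (m + 1) → Fin (k + 1) → ℚ := Fin.cons g₀ (Fin.tail g)
  have hpos : ∀ j, 0 < fresh j := fun j => by simp only [fresh]; positivity
  have hlt : ∀ j, fresh j < η / 2 := fun j => by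
    have h1 : (((j : ℕ) : ℚ) + 1) < k + 2 := by
      have : ((j : ℕ) : ℚ) < k + 1 := by exact_mod_cast j.2
      linarith
    have h2 : ((j : ℕ) + 1 : ℚ) / (2 * (k + 2)) < 1 / 2 := by
      rw [div_lt_div_iff₀ (by positivity) (by norm_num)]
      linarith
    have := mul_lt_mul_of_pos_left h2 hη
    simp only [fresh]
    linarith
  have hinj : ∀ j l, fresh j = fresh l → j = l := fun j l h => by
    have h1 := mul_left_cancel₀ hη.ne' h
    rw [div_left_inj' (by positivity)] at h1
    exact Fin.ext (by exact_mod_cast add_right_cancel h1)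
  have hkeep : ∀ j, ¬ redundant (List.ofFn g) j = true → ∀ i, g' i j = g i j := by
    intro j hj i
    refine Fin.cases ?_ (fun i => ?_) i
    · simp only [g', Fin.cons_zero, g₀, if_neg hj]
    · simp [g', Fin.tail]
  have hfresh : ∀ j, redundant (List.ofFn g) j = true → g' 0 j = fresh j := by
    intro j hj
    simp only [g', Fin.cons_zero, g₀, if_pos hj]
  refine ⟨g', ?_, ?_, ?_, ?_⟩
  · simp only [separate, List.ofFn_succ, List.headD_cons, List.tail_cons]
    simp only [g', Fin.cons_zero, Fin.cons_succ, g₀, List.ofFn_succ, fresh]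
    rfl
  · intro i j
    by_cases hj : redundant (List.ofFn g) j = true
    · refine Fin.cases ?_ (fun i => ?_) i
      · rw [hfresh j hj]
        exact ⟨(hpos j).le, by linarith [hlt j]⟩
      · simp only [g', Fin.cons_succ, Fin.tail]
        exact ⟨by linarith [hg i.succ j], hg1 _ _⟩
    · rw [hkeep j hj]
      exact ⟨by linarith [hg i j], hg1 _ _⟩
  · intro j l h
    by_cases hj : redundant (List.ofFn g) j = true <;>
      by_cases hl : redundant (List.ofFn g) l = true
    · have := h 0
      rw [hfresh j hj, hfresh l hl] at this
      exact hinj _ _ this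
    · have := h 0
      rw [hfresh j hj, hkeep l hl] at this
      linarith [hlt j, hg 0 l]
    · have := h 0
      rw [hkeep j hj, hfresh l hl] at this
      linarith [hlt l, hg 0 j]
    · simp only [hkeep j hj, hkeep l hl] at h
      rcases lt_trichotomy j l with hjl | hjl | hjl
      · exact absurd (redundant_ofFn_iff.2 ⟨j, hjl, h⟩) hl
      · exact hjl
      · exact absurd (redundant_ofFn_iff.2 ⟨l, hjl, fun i => (h i).symm⟩) hj
  · intro j
    induction j using WellFoundedLT.induction with
    | ind j ih =>
      by_cases hj : redundant (List.ofFn g) j = true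
      · obtain ⟨l, hl, he⟩ := redundant_ofFn_iff.1 hj
        obtain ⟨l', hl'⟩ := ih l hl
        exact ⟨l', fun i => (hl' i).trans (he i)⟩
      · exact ⟨j, hkeep j hj⟩

/-! ### Answers of the oracles -/

theorem cast_fold_max (S : Finset (Fin (k + 1))) (a : ℚ) (f : Fin (k + 1) → ℚ) :
    ((S.fold max a f : ℚ) : ℝ) = S.fold max (a : ℝ) fun j => (f j : ℝ) := by
  induction S using Finset.induction_on with
  | empty => simp
  | insert i s hi ih => rw [Finset.fold_insert hi, Finset.fold_insert hi, ← ih, Rat.cast_max]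

theorem Ctx.ask_of_isQuery {o : Ctx} (i : Fin o.n) {a b δ : ℚ} (h : IsQuery a b δ) :
    o.ask i a b δ = (o.σ i).value a b δ := by
  obtain ⟨h1, h2, h3, h4, h5⟩ := h
  simp [Ctx.ask, h1, h2, h3, h4, h5]

theorem Ctx.ask_of_not_lt {o : Ctx} (i : ℕ) {a b δ : ℚ} (h : ¬ a < b) : o.ask i a b δ = 0 := by
  simp [Ctx.ask, h]

variable {o : Ctx} {μ : Fin o.n → Measure unitInterval}
  {q : Polynomial ℕ} {δ : ℚ} {b : Fin (k + 1) → Fin o.n → unitInterval}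
  {g : Fin o.n → Fin (k + 1) → ℚ}

/-- Exactly the entries in T cover x when x lies above all entries outside T and not above any in T:
a half-open interval, as the oracle expects. The default -1 for its lower end makes sure that x = 0
is included. The factor 1 + δ in `mass` turns the answer into an upper bound. -/
theorem mass_bounds (hσ : ∀ i, IsNice (μ i) (o.σ i) q) (hδ : 0 < δ) (hδ1 : δ < 1)
    (hb : ∀ j i, (b j i : ℝ) = g i j) (i : Fin o.n) (T : Finset (Fin (k + 1))) :
    coverDist μ b i T ≤ o.mass δ i (g i) T ∧
      (o.mass δ i (g i) T : ℝ) ≤ (1 + δ) ^ 2 * coverDist μ b i T := by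
  have hδ' : (0 : ℝ) < δ := by exact_mod_cast hδ
  have e : {x | coverSet b i x = T} =
      {x : unitInterval | (lowerEnd (g i) T : ℝ) < x ∧ (x : ℝ) ≤ upperEnd (g i) T} := by
    ext x
    simp only [Set.mem_ofPred_eq, lowerEnd, upperEnd, cast_fold_max, cast_fold_min,
      Finset.fold_max_lt, Finset.le_fold_min, Finset.ext_iff, coverSet, Finset.mem_filter,
      Finset.mem_univ, true_and, Finset.mem_compl, ← Subtype.coe_le_coe, hb]
    have h1 := x.2.1
    have h2 := x.2.2
    constructor
    · intro h
      refine ⟨⟨?_, fun j hj => ?_⟩, ?_, fun j hj => (h j).2 hj⟩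
      · push_cast; linarith
      · rw [← h] at hj
        exact not_le.1 hj
      · push_cast; exact h2
    · rintro ⟨⟨-, h3⟩, -, h4⟩ j
      exact ⟨fun h => by_contra fun hj => absurd h (not_le.2 (h3 j hj)), h4 j⟩
  unfold coverDist Ctx.mass
  rw [e]
  push_cast
  by_cases h : lowerEnd (g i) T < upperEnd (g i) T
  · have hq : IsQuery (lowerEnd (g i) T) (upperEnd (g i) T) δ :=
      ⟨((Finset.le_fold_max _).2 (Or.inl le_rfl)), h,
        (Finset.fold_min_le _).2 (Or.inl le_rfl), hδ, hδ1⟩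
    rw [Ctx.ask_of_isQuery i hq]
    have h1 := (hσ i).lower _ _ _ hq
    have h2 := (hσ i).upper _ _ _ hq
    constructor
    · rw [inv_mul_le_iff₀ (by linarith)] at h1
      exact h1
    · rw [pow_two, mul_assoc]
      exact mul_le_mul_of_nonneg_left h2 (by linarith)
  · have h1 : {x : unitInterval | (lowerEnd (g i) T : ℝ) < x ∧ (x : ℝ) ≤ upperEnd (g i) T} = ∅ := by
      ext x
      simp only [Set.mem_ofPred_eq, Set.mem_empty_iff_false, iff_false, not_and, not_le]
      intro hx
      have : (upperEnd (g i) T : ℝ) ≤ lowerEnd (g i) T := by exact_mod_cast not_lt.1 h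
      linarith
    rw [h1, Ctx.ask_of_not_lt _ h]
    simp

/-- The error of the oracle is purely relative, so the answer is nonpositive exactly for null sets.
Covering with probability 1 is thus decided without any tolerance. -/
theorem covers_iff [∀ i, IsFiniteMeasure (μ i)] (hσ : ∀ i, IsNice (μ i) (o.σ i) q) (hδ : 0 < δ)
    (hδ1 : δ < 1) (hb : ∀ j i, (b j i : ℝ) = g i j) (i : Fin o.n) :
    o.covers δ i (g i) = true ↔ μ i {x | b 0 i < x} = 0 := by
  have hδ' : (0 : ℝ) < δ := by exact_mod_cast hδ
  have e : {x : unitInterval | b 0 i < x} =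
      {x : unitInterval | (g i 0 : ℝ) < x ∧ (x : ℝ) ≤ (1 : ℚ)} := by
    ext x
    simp only [Set.mem_ofPred_eq, ← Subtype.coe_lt_coe, hb]
    exact ⟨fun h => ⟨h, by push_cast; exact x.2.2⟩, fun h => h.1⟩
  rw [← measureReal_eq_zero_iff, e]
  simp only [Ctx.covers, decide_eq_true_eq]
  have h0 : (0 : ℝ) ≤ g i 0 := by rw [← hb]; exact (b 0 i).2.1
  by_cases h : g i 0 < 1
  · have hq : IsQuery (g i 0) 1 δ := ⟨by
      have : (0 : ℚ) ≤ g i 0 := by exact_mod_cast h0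
      linarith, h, le_rfl, hδ, hδ1⟩
    rw [Ctx.ask_of_isQuery i hq]
    have h1 := (hσ i).lower _ _ _ hq
    have h2 := (hσ i).upper _ _ _ hq
    constructor
    · intro h3
      have h4 : ((o.σ i).value (g i 0) 1 δ : ℝ) ≤ 0 := by exact_mod_cast h3
      rw [inv_mul_le_iff₀ (by linarith)] at h1
      refine le_antisymm (h1.trans ?_) measureReal_nonneg
      exact mul_nonpos_of_nonneg_of_nonpos (by linarith) h4
    · intro h3
      rw [h3, mul_zero] at h2
      exact_mod_cast h2
  · rw [Ctx.ask_of_not_lt _ h]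
    simp only [le_refl, true_iff]
    have h1 : {x : unitInterval | (g i 0 : ℝ) < x ∧ (x : ℝ) ≤ (1 : ℚ)} = ∅ := by
      ext x
      simp only [Set.mem_ofPred_eq, Set.mem_empty_iff_false, iff_false, not_and, not_le]
      intro hx
      have : ((1 : ℚ) : ℝ) ≤ g i 0 := by exact_mod_cast not_lt.1 h
      linarith
    rw [h1]
    simp

theorem sum_coverDist [∀ i, IsProbabilityMeasure (μ i)] (i : Fin o.n) : ∑ T, coverDist μ b i T = 1 := by
  have h := sum_measureReal_preimage_singleton (μ := μ i) (f := coverSet b i) Finset.univ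
    fun T _ => measurableSet_coverSet_eq b i T
  rw [Finset.coe_univ, Set.preimage_univ, probReal_univ] at h
  exact h

/-! ### Partial solutions for all coordinates -/

/-- The items for given points. -/
noncomputable def itemList (μ : Fin o.n → Measure unitInterval) (δ : ℚ) (c : Fin o.n → ℚ)
    (g : Fin o.n → Fin (k + 1) → ℚ) (b : Fin (k + 1) → Fin o.n → unitInterval) : List (Item k) :=
  List.ofFn fun i => ((c i, g i, o.mass δ i (g i)), coverDist μ b i)

/-- The coordinates with their costs. -/
def coordList (c : Fin n → ℚ) : List (ℕ × ℚ) := List.ofFn fun i : Fin n => ((i : ℕ), c i)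

variable {c : Fin o.n → ℚ}

theorem map_fst_itemList : (itemList μ δ c g b).map Prod.fst =
    o.items δ (coordList c) (List.ofFn g) := by
  refine List.ext_getElem (by simp [itemList, coordList, Ctx.items]) fun i h1 h2 => ?_
  simp [itemList, coordList, Ctx.items]

theorem accurate_of_mem_itemList [∀ i, IsProbabilityMeasure (μ i)] 
    (hσ : ∀ i, IsNice (μ i) (o.σ i) q) (hδ : 0 < δ) (hδ1 : δ < 1)
    (hb : ∀ j i, (b j i : ℝ) = g i j) (hc : ∀ i, 0 ≤ c i) :
    ∀ it ∈ itemList μ δ c g b, it.Accurate δ := by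
  intro it hit
  obtain ⟨i, rfl⟩ := (List.mem_ofFn' _ _).1 hit
  exact ⟨hc i, fun j => by
    have : (0 : ℝ) ≤ g i j := by rw [← hb]; exact (b j i).2.1
    exact_mod_cast this, coverDist_nonneg μ b i, sum_coverDist i,
    fun T => (mass_bounds hσ hδ hδ1 hb i T).1, fun T => (mass_bounds hσ hδ hδ1 hb i T).2⟩

theorem pointCost_itemList (hb : ∀ j i, (b j i : ℝ) = g i j) (j : Fin (k + 1)) :
    pointCost (itemList μ δ c g b) j = linearCost c (b j) := by
  simp [pointCost, itemList, linearCost, List.map_ofFn, List.sum_ofFn, hb]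

theorem expectedCost_eq_trueCost [∀ i, IsProbabilityMeasure (μ i)] 
    (hb : ∀ j i, (b j i : ℝ) = g i j) (hc : ∀ i, 0 ≤ c i)
    {B : Finset (Fin o.n → unitInterval)} (hB : ∀ v, v ∈ B ↔ ∃ j, b j = v)
    (h : ∀ i, μ i {x | b 0 i < x} = 0) : expectedCost (Measure.pi μ) c B =
      ENNReal.ofReal (trueCost (itemList μ δ c g b)) := by
  rw [expectedCost_eq μ hc hB h, trueCost]
  have e1 : (itemList μ δ c g b).map Prod.snd = List.ofFn (coverDist μ b) := by
    simp [itemList, List.map_ofFn, Function.comp_def]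
  have e2 : pointCost (itemList μ δ c g b) = fun j => linearCost c (b j) :=
    funext (pointCost_itemList hb)
  rw [e1, e2]

theorem isPartial_ofFn {Γ : List ℚ} : IsPartial o Γ δ (coordList c) (List.ofFn g) ↔
    ∀ i : Fin o.n, g i ∈ tuples (k + 1) Γ ∧ o.covers δ i (g i) = true := by
  unfold IsPartial coordList
  rw [List.forall₂_iff_get]
  simp
  constructor
  · intro h i
    exact h i i.2
  · intro h i hi
    exact h ⟨i, hi⟩

/-- The competing covers may have irrational entries, hence this version of rounding for real
numbers. -/
theorem exists_mem_grid {δ η : ℚ} (hδ : 0 < δ) (hη : 0 < η) {y : ℝ} (h0 : 0 ≤ y) (h1 : y ≤ 1) :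
    ∃ a ∈ grid δ η, y ≤ (a : ℝ) ∧ (a : ℝ) ≤ (1 + (δ : ℝ)) * y + η := by
  have hδ' : (0 : ℝ) < δ := by exact_mod_cast hδ
  have key : ∀ J : ℕ, ∃ j ≤ J, y ≤ ((1 + (δ : ℝ)) ^ j)⁻¹ ∧
      ((1 + (δ : ℝ)) ^ j)⁻¹ ≤ max ((1 + (δ : ℝ)) ^ J)⁻¹ ((1 + δ) * y) := by
    intro J
    induction J with
    | zero => exact ⟨0, le_rfl, by simpa using h1, by simp⟩
    | succ J ih =>
      by_cases h : y ≤ ((1 + (δ : ℝ)) ^ (J + 1))⁻¹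
      · exact ⟨J + 1, le_rfl, h, le_max_left _ _⟩
      · obtain ⟨j, hj, h2, h3⟩ := ih
        refine ⟨j, by omega, h2, h3.trans (max_le ?_ (le_max_right _ _))⟩
        refine le_trans ?_ (le_max_right _ _)
        have h4 : (1 + (δ : ℝ)) * ((1 + (δ : ℝ)) ^ (J + 1))⁻¹ = ((1 + (δ : ℝ)) ^ J)⁻¹ := by
          rw [pow_succ]; field_simp
        rw [← h4]
        exact mul_le_mul_of_nonneg_left (not_le.1 h).le (by positivity)
  obtain ⟨j, hj, h2, h3⟩ := key (gridSteps δ η)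
  refine ⟨((1 + δ) ^ j)⁻¹, mem_powersUpTo.2 ⟨j, hj, rfl⟩, by push_cast; exact h2, ?_⟩
  push_cast
  have h5 := (gridSteps_spec hδ hη).1
  have h6 : ((1 + (δ : ℝ)) ^ gridSteps δ η)⁻¹ ≤ η := by exact_mod_cast h5
  have h7 : (0 : ℝ) ≤ (1 + δ) * y := by positivity
  have h8 : (0 : ℝ) < η := by exact_mod_cast hη
  refine h3.trans (max_le ?_ ?_) <;> linarith

end

section

variable {k n : ℕ}

/-! ### The output of the algorithm -/

/-- By Bernoulli 1 - γ/8 ≤ (1 - δ)^m, so (1 + δ)^m (1 - γ/8) ≤ (1 - δ²)^m ≤ 1; and 1 + γ/4 ≤ (1 +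
γ)(1 - γ/8) as γ < 1. -/
theorem pow_mul_le {γ δ : ℝ} (hγ : 0 < γ) (hγ1 : γ < 1) (hδ : 0 < δ) {m : ℕ} (h : m * δ ≤ γ / 8) :
    (1 + δ) ^ m * (1 + γ / 4) ≤ 1 + γ := by
  have h1 : (1 + δ) ^ m * (1 - γ / 8) ≤ 1 := by
    rcases Nat.eq_zero_or_pos m with rfl | hm
    · simp; linarith
    have hm1 : (1 : ℝ) ≤ m := by exact_mod_cast hm
    have hd : δ ≤ 1 := by nlinarith
    have h2 : 1 - γ / 8 ≤ (1 - δ) ^ m := by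
      have := one_add_mul_le_pow (show (-2 : ℝ) ≤ -δ by linarith) m
      rw [← sub_eq_add_neg] at this
      linarith
    calc (1 + δ) ^ m * (1 - γ / 8) ≤ (1 + δ) ^ m * (1 - δ) ^ m := by gcongr
      _ = (1 - δ ^ 2) ^ m := by rw [← mul_pow]; ring
      _ ≤ 1 := pow_le_one₀ (by nlinarith) (by nlinarith)
  have h3 : 0 < (1 + δ) ^ m := by positivity
  nlinarith

section

variable {o : Ctx} {μ : Fin o.n → Measure unitInterval} {q : Polynomial ℕ}

/-- The sets of points that the dynamic program considers. -/
def Feasible (o : Ctx) (Γ : List ℚ) (δ : ℚ) (g : Fin o.n → Fin (k + 1) → ℚ) : Prop :=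
  ∀ i : Fin o.n, g i ∈ tuples (k + 1) Γ ∧ o.covers δ i (g i) = true

/-- The estimated cost. -/
noncomputable def estimate (o : Ctx) (Γ : List ℚ) (δ : ℚ) (c : Fin o.n → ℚ)
    (g : Fin o.n → Fin (k + 1) → ℚ) : ℚ :=
  (State.run Γ (o.items δ (coordList c) (List.ofFn g))).cost

/-- The points of B' are numbered such that one that covers almost everything comes first, and all
entries are rounded up to the grid. Domination is preserved, and because the costs have sum at most
1 the additive loss is at most η. It does not matter here if points merge. -/
theorem exists_feasible [∀ i, IsProbabilityMeasure (μ i)] (hσ : ∀ i, IsNice (μ i) (o.σ i) q)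
    {δ η : ℚ} (hδ : 0 < δ) (hδ1 : δ < 1) (hη : 0 < η) {c : Fin o.n → ℚ} (hc : ∀ i, 0 ≤ c i)
    (hc1 : ∑ i, c i ≤ 1) {B' : Finset (Fin o.n → unitInterval)} (hcard : B'.card = k + 1)
    (hB' : IsParetoCover (Measure.pi μ) B') :
    ∃ g : Fin o.n → Fin (k + 1) → ℚ, Feasible o (grid δ η) δ g ∧
      ∀ b : Fin (k + 1) → Fin o.n → unitInterval, (∀ j i, (b j i : ℝ) = g i j) →
        ENNReal.ofReal (trueCost (itemList μ δ c g b)) ≤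
          ENNReal.ofReal (1 + δ) * expectedCost (Measure.pi μ) c B' + ENNReal.ofReal η := by
  classical
  obtain ⟨v, hv, hv0⟩ := exists_mem_of_isParetoCover μ hB'
  have e0 : Fin (k + 1) ≃ B' := (Fintype.equivFinOfCardEq (by simpa using hcard)).symm
  let e : Fin (k + 1) ≃ B' := (Equiv.swap 0 (e0.symm ⟨v, hv⟩)).trans e0
  have he0 : (e 0 : Fin o.n → unitInterval) = v := by simp [e]
  have hex : ∀ i j, ∃ a ∈ grid δ η, (((e j : Fin o.n → unitInterval) i : unitInterval) : ℝ) ≤ a ∧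
      (a : ℝ) ≤ (1 + (δ : ℝ)) * ((e j : Fin o.n → unitInterval) i : unitInterval) + η :=
    fun i j => exists_mem_grid hδ hη (unitInterval.nonneg _) (unitInterval.le_one _)
  choose g hgm hg1 hg2 using hex
  have hg01 : ∀ i j, (g i j : ℝ) ∈ unitInterval := fun i j =>
    ⟨by exact_mod_cast (pos_of_mem_grid hδ (hgm i j)).le,
      by exact_mod_cast le_one_of_mem_grid hδ (hgm i j)⟩
  have hnull : ∀ b : Fin (k + 1) → Fin o.n → unitInterval, (∀ j i, (b j i : ℝ) = g i j) →
      ∀ i, μ i {x | b 0 i < x} = 0 := by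
    intro b hb i
    refine measure_mono_null (fun x hx => ?_) (hv0 i)
    refine lt_of_le_of_lt ?_ (show b 0 i < x from hx)
    rw [← Subtype.coe_le_coe, hb, ← he0]
    exact hg1 i 0
  refine ⟨g, fun i => ⟨mem_tuples.2 (hgm i), ?_⟩, fun b hb => ?_⟩
  · have hb : ∀ j i, ((⟨g i j, hg01 i j⟩ : unitInterval) : ℝ) = g i j := fun _ _ => rfl
    exact (covers_iff hσ hδ hδ1 (b := fun j i => ⟨g i j, hg01 i j⟩) hb i).2 (hnull _ hb i)
  · have hB : ∀ w, w ∈ Finset.univ.image b ↔ ∃ j, b j = w := by simp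
    rw [← expectedCost_eq_trueCost hb hc hB (hnull b hb)]
    have hδ' : (0 : ℝ) < δ := by exact_mod_cast hδ
    refine expectedCost_le_of_forall μ (by linarith) fun w hw => ?_
    refine ⟨b (e.symm ⟨w, hw⟩), (hB _).2 ⟨_, rfl⟩, fun i => ?_, ?_⟩
    · rw [← Subtype.coe_le_coe, hb]
      simpa using hg1 i (e.symm ⟨w, hw⟩)
    · have h1 : ∀ i, (c i : ℝ) * (b (e.symm ⟨w, hw⟩) i : ℝ) ≤
          (1 + δ) * ((c i : ℝ) * (w i : ℝ)) + c i * η := by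
        intro i
        rw [hb]
        have h2 := hg2 i (e.symm ⟨w, hw⟩)
        simp only [Equiv.apply_symm_apply] at h2
        have := mul_le_mul_of_nonneg_left h2 (show (0 : ℝ) ≤ c i by exact_mod_cast hc i)
        linarith
      have h3 := Finset.sum_le_sum fun i (_ : i ∈ Finset.univ) => h1 i
      rw [Finset.sum_add_distrib, ← Finset.mul_sum, ← Finset.sum_mul] at h3
      refine h3.trans (add_le_add le_rfl ?_)
      have h4 : (∑ i, (c i : ℝ)) ≤ 1 := by exact_mod_cast hc1
      have h5 : (0 : ℝ) < η := by exact_mod_cast hη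
      nlinarith

theorem linearCost_le_one {c : Fin n → ℚ} (hc : ∀ i, 0 ≤ c i) (hc1 : ∑ i, c i ≤ 1)
    (v : Fin n → unitInterval) : linearCost c v ≤ 1 := by
  have h4 : (∑ i, (c i : ℝ)) ≤ 1 := by exact_mod_cast hc1
  refine le_trans (Finset.sum_le_sum fun i _ => ?_) h4
  exact mul_le_of_le_one_right (by exact_mod_cast hc i) (v i).2.2

/-- A feasible set of points with the least estimate is nearly optimal. -/
theorem expectedCost_le_of_estimate_le [∀ i, IsProbabilityMeasure (μ i)]
    (hσ : ∀ i, IsNice (μ i) (o.σ i) q) (hn : 1 ≤ o.n) {α γ δ η : ℚ} (hα : 0 < α) (hα1 : α < 1)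
    (hγ : 0 < γ) (hγ1 : γ < 1) (hδ : δ = γ / (40 * o.n))
    (hη : η = α * γ / (16 * 2 ^ (k + 1) * (o.n * o.n)))
    (hμ : ∀ i, (α : ℝ) ≤ ∫ x : unitInterval, (x : ℝ) ∂(μ i))
    {c : Fin o.n → ℚ} (hc : ∀ i, 0 ≤ c i) (hc1 : ∑ i, c i ≤ 1) (hc2 : 1 / (o.n : ℚ) ≤ ∑ i, c i)
    {g : Fin o.n → Fin (k + 1) → ℚ} (hg : Feasible o (grid δ η) δ g)
    (hmin : ∀ g' : Fin o.n → Fin (k + 1) → ℚ, Feasible o (grid δ η) δ g' →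
      estimate o (grid δ η) δ c g ≤ estimate o (grid δ η) δ c g')
    {b : Fin (k + 1) → Fin o.n → unitInterval} (hb : ∀ j i, (b j i : ℝ) = g i j)
    {B B' : Finset (Fin o.n → unitInterval)} (hB : ∀ w, w ∈ B ↔ ∃ j, b j = w)
    (hcard : B'.card = k + 1) (hB' : IsParetoCover (Measure.pi μ) B') :
    expectedCost (Measure.pi μ) c B ≤
      ENNReal.ofReal (1 + (γ : ℝ)) * expectedCost (Measure.pi μ) c B' := by
  have hn' : (1 : ℚ) ≤ o.n := by exact_mod_cast hn
  have hK : (1 : ℚ) ≤ 2 ^ (k + 1) := one_le_pow₀ (by norm_num)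
  have hδ0 : 0 < δ := by rw [hδ]; positivity
  have hδ1 : δ < 1 := by
    rw [hδ, div_lt_one (by positivity)]
    linarith
  have hη0 : 0 < η := by rw [hη]; positivity
  have hδn : (o.n : ℚ) * δ = γ / 40 := by rw [hδ]; field_simp
  have hηn : 4 * o.n * 2 ^ (k + 1) * η = γ / 4 * (α * (1 / o.n)) := by
    rw [hη]; field_simp; norm_num
  have hηn' : o.n * η ≤ 1 := by
    have h1 : (o.n : ℚ) * η ≤ 4 * o.n * 2 ^ (k + 1) * η := by
      have h3 : (1 : ℚ) ≤ 4 * 2 ^ (k + 1) := by linarith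
      have h2 : 0 ≤ (o.n : ℚ) * η := by positivity
      nlinarith
    refine h1.trans ?_
    rw [hηn]
    have h2 : 1 / (o.n : ℚ) ≤ 1 := by rw [div_le_one (by positivity)]; exact hn'
    have h3 : (0 : ℚ) ≤ 1 / o.n := by positivity
    nlinarith [mul_le_mul hα1.le h2 h3 zero_le_one]
  have hΓ := isFine_grid hδ0 hη0
  have hacc : ∀ {g : Fin o.n → Fin (k + 1) → ℚ} {b : Fin (k + 1) → Fin o.n → unitInterval},
      (∀ j i, (b j i : ℝ) = g i j) → ∀ it ∈ itemList μ δ c g b, it.Accurate δ :=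
    fun hb => accurate_of_mem_itemList hσ hδ0 hδ1 hb hc
  have hone : ∀ {g : Fin o.n → Fin (k + 1) → ℚ} {b : Fin (k + 1) → Fin o.n → unitInterval},
      (∀ j i, (b j i : ℝ) = g i j) → ∀ j, pointCost (itemList μ δ c g b) j ≤ 1 := by
    intro g b hb j
    rw [pointCost_itemList hb]
    exact linearCost_le_one hc hc1 _
  have hlen : ∀ {g : Fin o.n → Fin (k + 1) → ℚ} {b : Fin (k + 1) → Fin o.n → unitInterval},
      (itemList μ δ c g b).length = o.n := by simp [itemList]
  obtain ⟨g', hg', hcost⟩ := exists_feasible hσ hδ0 hδ1 hη0 hc hc1 hcard hB'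
  have hg01 : ∀ i j, (g' i j : ℝ) ∈ unitInterval := fun i j =>
    ⟨by exact_mod_cast (pos_of_mem_grid hδ0 (mem_tuples.1 (hg' i).1 j)).le,
      by exact_mod_cast le_one_of_mem_grid hδ0 (mem_tuples.1 (hg' i).1 j)⟩
  let b' : Fin (k + 1) → Fin o.n → unitInterval := fun j i => ⟨g' i j, hg01 i j⟩
  have hb' : ∀ j i, (b' j i : ℝ) = g' i j := fun _ _ => rfl
  rw [expectedCost_eq_trueCost (δ := δ) hb hc hB
    fun i => (covers_iff hσ hδ0 hδ1 hb i).1 (hg i).2]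
  rcases eq_or_ne (expectedCost (Measure.pi μ) c B') ⊤ with htop | htop
  · rw [htop, ENNReal.mul_top]
    · exact le_top
    · have : (0 : ℝ) < γ := by exact_mod_cast hγ
      exact (ENNReal.ofReal_pos.2 (by linarith)).ne'
  obtain ⟨E, hE0, hE⟩ : ∃ E : ℝ, 0 ≤ E ∧ expectedCost (Measure.pi μ) c B' = ENNReal.ofReal E :=
    ⟨_, ENNReal.toReal_nonneg, (ENNReal.ofReal_toReal htop).symm⟩
  have hlow := le_expectedCost μ hc hμ B'
  have h1 := hcost b' hb'
  have hδR : (0 : ℝ) < δ := by exact_mod_cast hδ0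
  have hηR : (0 : ℝ) < η := by exact_mod_cast hη0
  have hγR : (0 : ℝ) < γ := by exact_mod_cast hγ
  have hγ1R : (γ : ℝ) < 1 := by exact_mod_cast hγ1
  have hαR : (0 : ℝ) < α := by exact_mod_cast hα
  rw [hE] at hlow h1 ⊢
  rw [ENNReal.ofReal_le_ofReal_iff hE0] at hlow
  rw [← ENNReal.ofReal_mul (by linarith), ← ENNReal.ofReal_add (by positivity) hηR.le,
    ENNReal.ofReal_le_ofReal_iff (by positivity)] at h1
  rw [← ENNReal.ofReal_mul (by linarith)]
  refine ENNReal.ofReal_le_ofReal ?_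
  have h2 := trueCost_le_cost (Γ := grid δ η) (hacc hb) (hone hb)
  have h3 := cost_le_trueCost hδ0.le hη0.le hΓ (hacc hb') (hone hb') (by rw [hlen]; exact hηn')
  rw [map_fst_itemList] at h2 h3
  rw [hlen] at h3
  have h4 : ((State.run (grid δ η) (o.items δ (coordList c) (List.ofFn g))).cost : ℝ) ≤
      (State.run (grid δ η) (o.items δ (coordList c) (List.ofFn g'))).cost := by
    exact_mod_cast hmin g' hg'
  -- True cost of g ≤ estimate for g ≤ estimate for the rounded competitor g' ≤ true cost of g' up
  -- to the errors.
  refine (h2.trans (h4.trans h3)).trans ?_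
  have hαE : (α : ℝ) * (1 / o.n) ≤ E := by
    refine le_trans ?_ hlow
    have h := (Rat.cast_le (K := ℝ)).2 hc2
    push_cast at h
    exact mul_le_mul_of_nonneg_left h hαR.le
  have hηnR : 4 * (o.n : ℝ) * 2 ^ (k + 1) * η = γ / 4 * (α * (1 / o.n)) := by
    have h := congrArg (Rat.cast : ℚ → ℝ) hηn
    push_cast at h
    exact h
  have hnK : (1 : ℝ) ≤ o.n * 2 ^ (k + 1) := by
    have : (1 : ℚ) ≤ o.n * 2 ^ (k + 1) := by nlinarith
    exact_mod_cast this
  -- The estimate loses 3n · 2^(k+1) · η and the rounding of the competitor one η; together at most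
  -- 4n · 2^(k+1) · η, which is at most γ/4 · E.
  have h5 : trueCost (itemList μ δ c g' b') + 3 * o.n * 2 ^ (k + 1) * η ≤
      (1 + δ) * E + γ / 4 * E := by
    have h6 : (η : ℝ) ≤ o.n * 2 ^ (k + 1) * η := le_mul_of_one_le_left hηR.le hnK
    have h7 : (γ : ℝ) / 4 * (α * (1 / o.n)) ≤ γ / 4 * E := by gcongr
    linarith
  have h8 : (1 + (δ : ℝ)) * E + γ / 4 * E ≤ (1 + δ) * (1 + γ / 4) * E := by
    have : 0 ≤ (δ : ℝ) * (γ / 4) * E := by positivity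
    linarith
  -- 4n factors come from the estimate and one from the rounding of the competitor.
  have h9 : (1 + (δ : ℝ)) ^ (4 * o.n + 1) * (1 + γ / 4) ≤ 1 + γ := by
    refine pow_mul_le hγR hγ1R hδR ?_
    have h10 : ((4 * o.n + 1 : ℕ) : ℚ) * δ ≤ γ / 8 := by
      push_cast
      have : δ ≤ o.n * δ := le_mul_of_one_le_left hδ0.le hn'
      linarith
    exact_mod_cast h10
  calc _ ≤ (1 + (δ : ℝ)) ^ (4 * o.n) * ((1 + δ) * (1 + γ / 4) * E) :=
        mul_le_mul_of_nonneg_left (h5.trans h8) (by positivity)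
    _ = (1 + (δ : ℝ)) ^ (4 * o.n + 1) * (1 + γ / 4) * E := by ring
    _ ≤ _ := mul_le_mul_of_nonneg_right h9 hE0

end

/-! ### Scaling of costs, enlarging of covers, and the outcome of the dynamic program -/

theorem expectedCost_smul (μ : Fin n → Measure unitInterval) (c : Fin n → ℚ) {a : ℚ} (ha : 0 < a)
    (B : Finset (Fin n → unitInterval)) : expectedCost (Measure.pi μ) (fun i => a * c i) B =
      ENNReal.ofReal a * expectedCost (Measure.pi μ) c B := by
  have haR : (0 : ℝ) < a := by exact_mod_cast ha
  unfold expectedCost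
  rw [← lintegral_const_mul' _ _ ENNReal.ofReal_ne_top]
  refine lintegral_congr fun x => ?_
  unfold coverCost
  simp only [ENNReal.mul_iInf_of_ne (ENNReal.ofReal_pos.2 haR).ne' ENNReal.ofReal_ne_top,
    ← ENNReal.ofReal_mul haR.le, Finset.mul_sum]
  push_cast
  simp only [mul_assoc]

theorem expectedCost_anti (μ : Measure (Fin n → unitInterval)) (c : Fin n → ℚ)
    {B B' : Finset (Fin n → unitInterval)} (h : B ⊆ B') :
    expectedCost μ c B' ≤ expectedCost μ c B :=
  lintegral_mono fun _ => biInf_mono fun _ hb => h hb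

theorem Input.maxCost_spec {n : ℕ} (hn : 1 ≤ n) (c : Fin n → ℚ) (α γ : ℚ) :
    (∃ i, Input.maxCost (List.ofFn c, α, γ) = c i) ∧
      ∀ i, c i ≤ Input.maxCost (List.ofFn c, α, γ) := by
  have h := minimizers_headD_spec (fun x : ℚ => -x) (l := List.ofFn c) (d := 0) (by
    rw [Ne, List.ofFn_eq_nil_iff]; omega)
  refine ⟨?_, fun i => ?_⟩
  · obtain ⟨i, hi⟩ := (List.mem_ofFn' _ _).1 h.1
    exact ⟨i, hi.symm⟩
  · exact neg_le_neg_iff.1 (h.2 (c i) ((List.mem_ofFn' _ _).2 ⟨i, rfl⟩))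

/-- The points that the algorithm finds, before they are made distinct. -/
theorem best_spec (o : Ctx) (c : Fin o.n → ℚ) (α γ : ℚ) (x : Input) (hx : x = (List.ofFn c, α, γ))
    (h : ∃ g : Fin o.n → Fin (k + 1) → ℚ, Feasible o (x.grid k) x.ratio g) :
    ∃ g : Fin o.n → Fin (k + 1) → ℚ, o.best k x = List.ofFn g ∧ Feasible o (x.grid k) x.ratio g ∧
      ∀ g' : Fin o.n → Fin (k + 1) → ℚ, Feasible o (x.grid k) x.ratio g' →
        estimate o (x.grid k) x.ratio (fun i => c i / (o.n * x.maxCost)) g ≤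
          estimate o (x.grid k) x.ratio (fun i => c i / (o.n * x.maxCost)) g' := by
  set Γ := x.grid k with hΓdef
  set δ := x.ratio
  set c' : Fin o.n → ℚ := fun i => c i / (o.n * x.maxCost) with hc'
  have hdim : x.dim = o.n := by rw [Input.dim_eq, hx]; simp
  have hcoords : x.coords = (coordList c').reverse := by
    have e : (numbered x.1).2 = (List.ofFn fun i : Fin o.n => ((i : ℕ), c i)).reverse := by
      rw [hx]; simp [numbered_ofFn]
    rw [Input.coords, e, List.map_reverse, List.map_ofFn, hdim]
    rfl
  have htable : o.table k x =
      (coordList c').foldr (fun ic L => o.treat Γ δ ic L) [(State.init k, [])] := by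
    -- The left fold over the reversed coordinates is a right fold, in the order of `State.run`.
    rw [Ctx.table, hcoords, List.foldl_reverse]
  have hΓ : (1 : ℚ) ∈ Γ := one_mem_grid _ _
  have hcompl : ∀ g : Fin o.n → Fin (k + 1) → ℚ, Feasible o Γ δ g →
      ∃ e ∈ o.table k x, e.1.cost = estimate o Γ δ c' g := by
    intro g hg
    obtain ⟨e, he, hs⟩ := foldr_treat_complete hΓ ((isPartial_ofFn (c := c')).2 hg)
    exact ⟨e, by rw [htable]; exact he, by rw [hs]; rfl⟩
  obtain ⟨g₀, hg₀⟩ := h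
  have hne : o.table k x ≠ [] := by
    obtain ⟨e, he, -⟩ := hcompl g₀ hg₀
    exact List.ne_nil_of_mem he
  obtain ⟨hmem, hmin⟩ := minimizers_headD_spec
    (fun e : State k × List (Fin (k + 1) → ℚ) => e.1.cost) hne (State.init k, [])
  rw [htable] at hmem
  obtain ⟨h1, h2⟩ := foldr_treat_sound _ hmem
  rw [← htable] at h1 h2
  change IsPartial o Γ δ (coordList c') (o.best k x) at h1
  have hlen : (o.best k x).length = o.n := by
    rw [← h1.length_eq]; simp [coordList]
  obtain ⟨g, hg⟩ : ∃ g : Fin o.n → Fin (k + 1) → ℚ, o.best k x = List.ofFn g := by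
    refine ⟨fun i => (o.best k x)[i]'(by rw [hlen]; exact i.2), ?_⟩
    refine List.ext_getElem (by simp [hlen]) fun i _ _ => by simp
  rw [hg] at h1
  refine ⟨g, hg, (isPartial_ofFn (c := c')).1 h1, fun g' hg' => ?_⟩
  obtain ⟨e, he, hs⟩ := hcompl g' hg'
  rw [← hs]
  refine le_trans (le_of_eq ?_) (hmin e he)
  rw [h2]
  change _ = (State.run Γ (o.items δ (coordList c') (o.best k x))).cost
  rw [hg]
  rfl

end

/-! ### Correctness of the output and conclusion -/

theorem enc_input {n : ℕ} (c : Fin n → ℚ) (α γ : ℚ) :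
    enc ((List.ofFn c, α, γ) : Input) = input c α γ := by
  simp [enc, Enc.toData, input, Data.ofVec, List.map_ofFn, Function.comp_def]

theorem enc_output {k n : ℕ} (g : Fin n → Fin k → ℚ) :
    enc (fun j : Fin k => ((List.ofFn g).map fun v => v j : List ℚ)) =
      Data.ofList (List.ofFn fun j => Data.ofVec fun i => g i j) := by
  simp [enc, Enc.toData, Data.ofVec, List.map_ofFn, Function.comp_def]

/-- The output contains all points found by the dynamic program. It therefore inherits the covering
property and costs no more, while separation provides the exact cardinality. Both sides of the
inequality scale with c, so normalised costs suffice. -/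
theorem solve_spec (k : ℕ) (q : Polynomial ℕ) (o : Ctx) (hn : 1 ≤ o.n)
    (μ : Fin o.n → Measure unitInterval) [∀ i, IsProbabilityMeasure (μ i)]
    (hσ : ∀ i, IsNice (μ i) (o.σ i) q) (c : Fin o.n → ℚ) (hc : ∀ i, 0 ≤ c i) {α γ : ℚ}
    (hα : 0 < α) (hα1 : α < 1) (hμ : ∀ i, (α : ℝ) ≤ ∫ x : unitInterval, (x : ℝ) ∂(μ i))
    (hγ : 0 < γ) (hγ1 : γ < 1) :
    ∃ B : Finset (Fin o.n → unitInterval),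
      IsListOf (k + 1) (enc (o.solve k (List.ofFn c, α, γ))) B ∧ B.card = k + 1 ∧
      IsParetoCover (Measure.pi μ) B ∧
      ∀ B' : Finset (Fin o.n → unitInterval), B'.card = k + 1 → IsParetoCover (Measure.pi μ) B' →
        expectedCost (Measure.pi μ) c B
          ≤ ENNReal.ofReal (1 + (γ : ℝ)) * expectedCost (Measure.pi μ) c B' := by
  classical
  set x : Input := (List.ofFn c, α, γ) with hx
  have hdim : x.dim = o.n := by rw [Input.dim_eq, hx]; simp
  have hn' : (1 : ℚ) ≤ o.n := by exact_mod_cast hn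
  have hδ : x.ratio = γ / (40 * o.n) := by rw [Input.ratio, hdim]
  have hη : x.least k = α * γ / (16 * 2 ^ (k + 1) * (o.n * o.n)) := by rw [Input.least, hdim]
  have hK : (1 : ℚ) ≤ 2 ^ (k + 1) := one_le_pow₀ (by norm_num)
  have hδ0 : 0 < x.ratio := by rw [hδ]; positivity
  have hδ1 : x.ratio < 1 := by
    rw [hδ, div_lt_one (by positivity)]
    linarith
  have hη0 : 0 < x.least k := by rw [hη]; positivity
  have hη1 : x.least k < 1 := by
    rw [hη, div_lt_one (by positivity)]
    have h1 : α * γ < 1 := by nlinarith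
    have h2 : (1 : ℚ) ≤ o.n * o.n := by nlinarith
    nlinarith
  obtain ⟨⟨iM, hiM⟩, hM⟩ := Input.maxCost_spec hn c α γ
  rw [← hx] at hiM hM
  have hM0 : 0 ≤ x.maxCost := by rw [hiM]; exact hc iM
  have hfeas : ∃ g : Fin o.n → Fin (k + 1) → ℚ, Feasible o (x.grid k) x.ratio g := by
    -- With all entries equal to 1 there is nothing above the points, and `ask` returns 0 without
    -- calling the oracle.
    refine ⟨fun _ _ => 1, fun i => ⟨mem_tuples.2 fun _ => one_mem_grid _ _, ?_⟩⟩
    simp only [Ctx.covers, Ctx.ask_of_not_lt _ (lt_irrefl (1 : ℚ)), le_refl, decide_true]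
  obtain ⟨g, hbest, hg, hmin⟩ := best_spec o c α γ x hx hfeas
  have hgm : ∀ i j, g i j ∈ grid x.ratio (x.least k) := fun i j => mem_tuples.1 (hg i).1 j
  have hg1 : ∀ i j, g i j ≤ 1 := fun i j => le_one_of_mem_grid hδ0 (hgm i j)
  have hghalf : ∀ i j, x.least k / 2 < g i j := fun i j => by
    have h1 := lt_mul_of_mem_grid hδ0 hη0 hη1 (hgm i j)
    have h2 := pos_of_mem_grid hδ0 (hgm i j)
    nlinarith
  obtain ⟨g', hsep, hg'01, hg'inj, hg'sub⟩ :=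
    exists_separate_eq hn g hη0 hη1.le hghalf hg1
  have hg01 : ∀ i j, (g i j : ℝ) ∈ unitInterval := fun i j =>
    ⟨by exact_mod_cast (pos_of_mem_grid hδ0 (hgm i j)).le, by exact_mod_cast hg1 i j⟩
  have hg'01R : ∀ i j, (g' i j : ℝ) ∈ unitInterval := fun i j =>
    ⟨by exact_mod_cast (hg'01 i j).1, by exact_mod_cast (hg'01 i j).2⟩
  let b : Fin (k + 1) → Fin o.n → unitInterval := fun j i => ⟨g i j, hg01 i j⟩
  let b' : Fin (k + 1) → Fin o.n → unitInterval := fun j i => ⟨g' i j, hg'01R i j⟩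
  have hb : ∀ j i, (b j i : ℝ) = g i j := fun _ _ => rfl
  have hb'inj : Function.Injective b' := fun j l h => hg'inj j l fun i => by
    have := congrArg (Subtype.val : unitInterval → ℝ) (congrFun h i)
    simp only [b'] at this
    exact_mod_cast this
  have hsub : Finset.univ.image b ⊆ Finset.univ.image b' := by
    intro v hv
    obtain ⟨j, -, rfl⟩ := Finset.mem_image.1 hv
    obtain ⟨l, hl⟩ := hg'sub j
    exact Finset.mem_image.2 ⟨l, Finset.mem_univ _, funext fun i => Subtype.ext (by
      simp only [b', b, hl i])⟩
  have hnull : ∀ i, μ i {y | b 0 i < y} = 0 := fun i =>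
    (covers_iff hσ hδ0 hδ1 hb i).1 (hg i).2
  have hB : ∀ w, w ∈ Finset.univ.image b ↔ ∃ j, b j = w := by simp
  refine ⟨Finset.univ.image b', ⟨fun j i => g' i j, b', ?_, fun _ _ => rfl, by simp⟩, ?_, ?_,
    fun B' hcard hB' => ?_⟩
  · rw [← enc_output g', ← hsep, ← hbest]
    rfl
  · rw [Finset.card_image_of_injective _ hb'inj]
    simp
  · exact isParetoCover_of_mem μ (hsub ((hB _).2 ⟨0, rfl⟩)) hnull
  · refine (expectedCost_anti _ c hsub).trans ?_
    -- If the largest cost is 0, scaling is impossible, but then the expected cost vanishes.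
    rcases hM0.eq_or_lt with h0 | hpos
    · have hc0 : ∀ i, c i = 0 := fun i => le_antisymm (by rw [h0]; exact hM i) (hc i)
      rw [expectedCost_eq μ hc hB hnull]
      have e : ∀ R : Finset (Fin (k + 1)), minOf R (fun j => linearCost c (b j)) = 0 := by
        intro R
        have e1 : ∀ v : Fin o.n → unitInterval, linearCost c v = 0 := by
          intro v; simp [linearCost, hc0]
        simp only [e1]
        exact le_antisymm (minOf_le_iff.2 (Or.inl le_rfl)) (minOf_nonneg fun _ => le_rfl)
      simp [e]
    · have hnM : 0 < (o.n : ℚ) * x.maxCost := by positivity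
      set c' : Fin o.n → ℚ := fun i => c i / (o.n * x.maxCost) with hc'
      have hcc : c = fun i => (o.n * x.maxCost) * c' i := by
        funext i
        simp only [hc']
        rw [mul_div_cancel₀ _ hnM.ne']
      have hc'0 : ∀ i, 0 ≤ c' i := fun i => div_nonneg (hc i) hnM.le
      have hc'1 : ∑ i, c' i ≤ 1 := by
        simp only [hc']
        rw [← Finset.sum_div, div_le_one hnM]
        refine (Finset.sum_le_sum fun i _ => hM i).trans (by simp)
      -- The coordinate with the largest cost alone contributes 1/n.
      have hc'2 : 1 / (o.n : ℚ) ≤ ∑ i, c' i := by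
        refine le_trans (le_of_eq ?_)
          (Finset.single_le_sum (fun i _ => hc'0 i) (Finset.mem_univ iM))
        simp only [hc', ← hiM]
        field_simp
      have key := expectedCost_le_of_estimate_le hσ hn hα hα1 hγ hγ1 hδ hη hμ hc'0 hc'1 hc'2 hg
        hmin hb hB hcard hB'
      rw [hcc, expectedCost_smul μ c' hnM, expectedCost_smul μ c' hnM, mul_left_comm]
      exact mul_le_mul_right key _

theorem Ctx.good_of_isNice {q : Polynomial ℕ} {o : Ctx} {μ : Fin o.n → Measure unitInterval}
    (hσ : ∀ i, IsNice (μ i) (o.σ i) q) : o.Good q :=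
  fun i a b δ h => ⟨(hσ i).length_le a b δ h, (hσ i).time_le a b δ h⟩

end ParetoCover

theorem theorem3 (k : ℕ) (hk : 1 ≤ k) :
    ∃ A : Prog, ∀ q : Polynomial ℕ, ∃ p : Polynomial ℕ,
      ∀ (n : ℕ) (_ : 1 ≤ n) (μ : Fin n → Measure unitInterval) (_ : ∀ i, IsProbabilityMeasure (μ i))
        (σ : Fin n → Oracle) (_ : ∀ i, IsNice (μ i) (σ i) q)
        (c : Fin n → ℚ) (_ : ∀ i, 0 ≤ c i)
        (α : ℚ) (_ : 0 < α) (_ : α < 1) (_ : ∀ i, (α : ℝ) ≤ ∫ x : unitInterval, (x : ℝ) ∂(μ i))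
        (γ : ℚ) (_ : 0 < γ) (_ : γ < 1),
        ∃ (w : Data) (t : ℕ) (B : Finset (Fin n → unitInterval)),
          Eval σ A (input c α γ) w t ∧
          t ≤ p.eval ((input c α γ).size + ⌈γ⁻¹⌉₊) ∧
          IsListOf k w B ∧
          B.card = k ∧
          IsParetoCover (Measure.pi μ) B ∧
          ∀ B' : Finset (Fin n → unitInterval), B'.card = k → IsParetoCover (Measure.pi μ) B' →
            expectedCost (Measure.pi μ) c B
              ≤ ENNReal.ofReal (1 + (γ : ℝ)) * expectedCost (Measure.pi μ) c B' := by
  -- There is at least one point, and number 0 is reserved for one that covers almost everything.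
  obtain ⟨k, rfl⟩ : ∃ l, k = l + 1 := ⟨k - 1, by omega⟩
  obtain ⟨A, hA⟩ := PT.solve k
  refine ⟨A, fun q => ?_⟩
  obtain ⟨p, hp⟩ := hA q
  refine ⟨p, fun n hn μ hμP σ hσ c hc α hα hα1 hμ γ hγ hγ1 => ?_⟩
  -- With `N` = ⌈1/γ⌉ a bound that is polynomial in size plus `N` is the required one.
  let o : Ctx := ⟨n, σ, ⌈γ⁻¹⌉₊⟩
  have hprop : Input.Proper o (List.ofFn c, α, γ) :=
    ⟨by simp [o], hn, hα, hγ, Nat.le_ceil _⟩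
  obtain ⟨t, ht, hE⟩ := hp o (Ctx.good_of_isNice (o := o) hσ) _ hprop
  obtain ⟨B, h1, h2, h3, h4⟩ := solve_spec k q o hn μ hσ c hc hα hα1 hμ hγ hγ1
  rw [enc_input] at hE
  refine ⟨_, t, B, hE, ?_, h1, h2, h3, h4⟩
  have e : sz ((List.ofFn c, α, γ) : Input) = (input c α γ).size := by
    rw [← enc_input]; rfl
  rw [e] at ht
  exact ht
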